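/- **Setting.** Let $T\ge 1$, $S=\bigcup_{l=1}^s\{-(M_l+N_l),\dots,-M_l\}\subset\mathbb Z_-=\{-1,-2,\dots\}$, $S^+=-S$, $Z^S=\{1,2,\dots\}\setminus S^+$, $U=S\cup\{0,1,2,\dots\}$, and let $\vec a(j)\in\mathbb C^T$ with $\sum_{j\in Z^S}\sum_k|a_k(j)|<\infty$; put $\vec a(j)=\vec 0$ for $j\notin Z^S$ and $A(e^{i\lambda})=\sum_{j\in Z^S}\vec a(j)e^{-ij\lambda}$. A spectral density is an integrable function on $[-\pi,\pi)$ with values in the Hermitian nonnegative definite $T\times T$ matrices. For spectral densities $F,G$ let $L_2^s(F+G)$ be the closed subspace of $L_2(F+G)$ (norm$^2$ $\int h^\top(F+G)\overline h\,d\lambda$) generated by $e^{in\lambda}\delta_k$, $n\in\mathbb Z_-\setminus S$, $k=1,\dots,T$. For $h\in L_2^s(F+G)$ let $$\Delta(h;F,G)=\frac1{2\pi}\int_{-\pi}^{\pi}(A-h)^\top F\,\overline{(A-h)}\,d\lambda+\frac1{2\pi}\int_{-\pi}^{\pi}h^\top G\,\overline h\,d\lambda ,$$ the mean square error of the linear estimate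 with spectral characteristic $h$ of $A\vec\xi=\sum_{j\in Z^S}\vec a(j)^\top\vec\xi(-j)$ from $\vec\xi(j)+\vec\eta(j)$, $j\in\mathbb Z_-\setminus S$, where $\vec\xi,\vec\eta$ are uncorrelated stationary sequences with densities $F,G$. Let $h(F,G)$ be the minimizer of $\Delta(\cdot;F,G)$ over $L_2^s(F+G)$ and $\Delta(F,G)$ the minimum. The pair $(F,G)$ satisfies the minimality condition if $F+G$ is invertible almost everywhere and $\int_{-\pi}^{\pi}(F+G)^{-1}d\lambda<\infty$. In that case let, for $k,j\in U$, $$B(k,j)=\tfrac1{2\pi}\!\int(F+G)^{-1}e^{-i(k-j)\lambda}d\lambda,\quad R(k,j)=\tfrac1{2\pi}\!\int F(F+G)^{-1}e^{-i(k+j)\lambda}d\lambda,\quad Q(k,j)=\tfrac1{2\pi}\!\int F(F+G)^{-1}G\,e^{-i(k-j)\lambda}d\lambda,$$ acting on sequences of row vectors: $(\mathbf R\mathbf a)(k)^\top=\sum_j\vec a(j)^\top R(k,j)$, $(\mathbf B\mathbf c)(k)^\top=\sum_{j}\vec c(j)^\top B(k,j)$, $\langle\mathbf Q\mathbf a,\mathbf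 a\rangle=\sum_{k,j}\vec a(k)^\top Q(k,j)\overline{\vec a(j)}$. Here $\mathbf B$ is the closure, in the norm $\langle\mathbf B\mathbf c,\mathbf c\rangle^{1/2}$, of its action on finitely supported sequences: $\mathbf c=\mathbf B^{-1}\mathbf r$ means that there are finitely supported $\mathbf c_n$ on $U$, Cauchy in this norm, with $\mathbf c_n\to\mathbf c$ and $\mathbf B\mathbf c_n\to\mathbf r$ coordinatewise, and $\langle\mathbf r,\mathbf B^{-1}\mathbf r\rangle=\lim_n\langle\mathbf r,\mathbf c_n\rangle$. Let $D_F,D_G$ be sets of spectral densities and $D=D_F\times D_G$. A pair $(F^0,G^0)$ is least favorable in a set of pairs if it belongs to it and maximizes $\Delta(F,G)$ over it. Put $H_D=\bigcap_{(F,G)\in D}L_2^s(F+G)$; a function $h^0\in H_D$ is minimax-robust if $\max_{(F,G)\in D}\Delta(h^0;F,G)$ exists and equals $\min_{h\in H_D}\sup_{(F,G)\in D}\Delta(h;F,G)$. **Lemma 1.** Let $F^0\in D_F$, $G^0\in D_G$ satisfy the minimality condition and let the operators $\mathbf B^0,\mathbf R^0,\mathbf Q^0$ of $(F^0,G^0)$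 solve the problem $$\max\ \langle\mathbf R\mathbf a,\mathbf B^{-1}\mathbf R\mathbf a\rangle+\langle\mathbf Q\mathbf a,\mathbf a\rangle=\langle\mathbf R^0\mathbf a,(\mathbf B^0)^{-1}\mathbf R^0\mathbf a\rangle+\langle\mathbf Q^0\mathbf a,\mathbf a\rangle ,$$ the maximum being over the pairs $(F,G)\in D$ that satisfy the minimality condition. Then: 1. $(F^0,G^0)$ is least favorable in the set of pairs of $D$ that satisfy the minimality condition; if $D_F$ and $D_G$ are convex, it is least favorable in the whole of $D$. 2. The optimal spectral characteristic $h^0=h(F^0,G^0)$ exists and is, up to equality almost everywhere, the function $$(h^0)^\top=A^\top F^0(F^0+G^0)^{-1}-\Big(\sum_{k\in U}\big((\mathbf B^0)^{-1}\mathbf R^0\mathbf a\big)(k)\,e^{ik\lambda}\Big)^{\!\top}(F^0+G^0)^{-1},$$ where the sum denotes the integrable function with this Fourier series. 3. If $D_F$ and $D_G$ are convex and $h^0\in H_D$, then $h^0$ is the minimax-robust spectral characteristic. -/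

import Mathlib

open MeasureTheory Filter Topology Matrix
open scoped ComplexOrder

namespace RobustFilter

noncomputable section

/-! ### Index sets -/

/-- The set `S = ⋃ₗ {-(Mₗ+Nₗ), …, -Mₗ}` of missing observations. -/
def missing {s : ℕ} (M N : Fin s → ℕ) : Set ℤ :=
  ⋃ l, Set.Icc (-((M l : ℤ) + (N l : ℤ))) (-(M l : ℤ))

/-- The set `S⁺ = ⋃ₗ {Mₗ, …, Mₗ+Nₗ}`. -/
def missingPos {s : ℕ} (M N : Fin s → ℕ) : Set ℤ :=
  ⋃ l, Set.Icc (M l : ℤ) ((M l : ℤ) + (N l : ℤ))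

/-- `Z^S = {1, 2, …} \ S⁺`: the indices occurring in the functional `∑ a(j)ᵀ ξ(-j)`. -/
def ZS {s : ℕ} (M N : Fin s → ℕ) : Set ℤ := {j | 1 ≤ j} \ missingPos M N

/-- `ℤ₋ \ S`, `ℤ₋ = {-1, -2, …}`: the times of observation. -/
def observed {s : ℕ} (M N : Fin s → ℕ) : Set ℤ := {j | j ≤ -1} \ missing M N

/-- `U = S ∪ {0, 1, 2, …}`. -/
def unobserved {s : ℕ} (M N : Fin s → ℕ) : Set ℤ := missing M N ∪ {j | 0 ≤ j}

open Classical in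
/-- The coefficient vector: `a(j)` for `j ∈ Z^S` and `0` at all other indices. -/
def coeffVec {s T : ℕ} (M N : Fin s → ℕ) (a : ℤ → Fin T → ℂ) (j : ℤ) : Fin T → ℂ :=
  if j ∈ ZS M N then a j else 0

/-! ### Functions on `[-π, π)` -/

/-- Lebesgue measure on `[-π, π)`. -/
def circ : Measure ℝ := volume.restrict (Set.Ico (-Real.pi) Real.pi)

/-- The character `t ↦ e^{int}`. -/
def expo (n : ℤ) (t : ℝ) : ℂ := Complex.exp (Complex.I * (n : ℂ) * (t : ℂ))

/-- The Hermitian form `vᵀ W v̄`. -/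
def herm {T : ℕ} (W : Matrix (Fin T) (Fin T) ℂ) (v : Fin T → ℂ) : ℝ :=
  (v ⬝ᵥ (W *ᵥ star v)).re

/-- The trigonometric polynomial `∑ₙ x(n) e^{int}`. -/
def trigPoly {T : ℕ} (x : ℤ →₀ (Fin T → ℂ)) (t : ℝ) : Fin T → ℂ :=
  ∑ n ∈ x.support, expo n t • x n

/-- A spectral density: an integrable Hermitian nonnegative matrix function on `[-π, π)`. -/
def IsSpectralDensity {T : ℕ} (F : ℝ → Matrix (Fin T) (Fin T) ℂ) : Prop :=
  (∀ i j, Integrable (fun t => F t i j) circ) ∧ ∀ᵐ t ∂circ, (F t).PosSemidef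

/-- The minimality condition `∫ (F + G)⁻¹ < ∞`. -/
def IsMinimal {T : ℕ} (F G : ℝ → Matrix (Fin T) (Fin T) ℂ) : Prop :=
  (∀ᵐ t ∂circ, IsUnit (F t + G t).det) ∧
    ∀ i j, Integrable (fun t => (F t + G t)⁻¹ i j) circ

/-- Membership in `L₂(W)`: measurable with `∫ hᵀ W h̄ < ∞`. -/
def MemL2 {T : ℕ} (W : ℝ → Matrix (Fin T) (Fin T) ℂ) (h : ℝ → Fin T → ℂ) : Prop :=
  (∀ i, AEStronglyMeasurable (fun t => h t i) circ) ∧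
    Integrable (fun t => herm (W t) (h t)) circ

/-- Membership in `L₂ˢ(W)`: the closed subspace of `L₂(W)` generated by the functions
`e^{int} δₖ`, `n ∈ ℤ₋ \ S`, `k = 1, …, T`. -/
def MemL2s {s T : ℕ} (M N : Fin s → ℕ) (W : ℝ → Matrix (Fin T) (Fin T) ℂ)
    (h : ℝ → Fin T → ℂ) : Prop :=
  MemL2 W h ∧ ∀ ε : ℝ, 0 < ε → ∃ x : ℤ →₀ (Fin T → ℂ),
    (x.support : Set ℤ) ⊆ observed M N ∧
      ∫ t, herm (W t) (h t - trigPoly x t) ∂circ < ε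

/-! ### The filtering problem -/

/-- `A(e^{it}) = ∑_{j ∈ Z^S} a(j) e^{-ijt}`. -/
def Afun {s T : ℕ} (M N : Fin s → ℕ) (a : ℤ → Fin T → ℂ) (t : ℝ) : Fin T → ℂ :=
  ∑' j : ℤ, expo (-j) t • coeffVec M N a j

/-- The mean square error `Δ(h; F, G)` of the linear estimate with spectral characteristic `h`. -/
def mse {s T : ℕ} (M N : Fin s → ℕ) (a : ℤ → Fin T → ℂ) (h : ℝ → Fin T → ℂ)
    (F G : ℝ → Matrix (Fin T) (Fin T) ℂ) : ℝ :=
  1 / (2 * Real.pi) * ∫ t, herm (F t) (Afun M N a t - h t) ∂circ +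
    1 / (2 * Real.pi) * ∫ t, herm (G t) (h t) ∂circ

/-- `h = h(F, G)` is the spectral characteristic of the mean-square optimal linear estimate:
it minimizes `Δ(·; F, G)` over `L₂ˢ(F + G)`. -/
def IsOptimal {s T : ℕ} (M N : Fin s → ℕ) (a : ℤ → Fin T → ℂ)
    (F G : ℝ → Matrix (Fin T) (Fin T) ℂ) (h : ℝ → Fin T → ℂ) : Prop :=
  MemL2s M N (F + G) h ∧ ∀ g, MemL2s M N (F + G) g → mse M N a h F G ≤ mse M N a g F G

/-- The error `Δ(F, G)` of the optimal estimate, `min {Δ(h; F, G) : h ∈ L₂ˢ(F + G)}`. It is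
written as an infimum; it equals `Δ(h; F, G)` whenever `h = h(F, G)` is optimal. -/
def optError {s T : ℕ} (M N : Fin s → ℕ) (a : ℤ → Fin T → ℂ)
    (F G : ℝ → Matrix (Fin T) (Fin T) ℂ) : ℝ :=
  ⨅ h : {h : ℝ → Fin T → ℂ // MemL2s M N (F + G) h}, mse M N a h.1 F G

/-- `(F⁰, G⁰)` is least favorable in a set `D` of pairs of densities:
`Δ(h(F⁰, G⁰); F⁰, G⁰) = max_{(F, G) ∈ D} Δ(h(F, G); F, G)`. -/
def IsLeastFavorable {s T : ℕ} (M N : Fin s → ℕ) (a : ℤ → Fin T → ℂ)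
    (D : Set ((ℝ → Matrix (Fin T) (Fin T) ℂ) × (ℝ → Matrix (Fin T) (Fin T) ℂ)))
    (F0 G0 : ℝ → Matrix (Fin T) (Fin T) ℂ) : Prop :=
  (F0, G0) ∈ D ∧ ∃ h0, IsOptimal M N a F0 G0 h0 ∧
    ∀ P ∈ D, optError M N a P.1 P.2 ≤ mse M N a h0 F0 G0

/-- `H_D = ⋂_{(F, G) ∈ D} L₂ˢ(F + G)`. -/
def HD {s T : ℕ} (M N : Fin s → ℕ)
    (D : Set ((ℝ → Matrix (Fin T) (Fin T) ℂ) × (ℝ → Matrix (Fin T) (Fin T) ℂ))) :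
    Set (ℝ → Fin T → ℂ) :=
  {h | ∀ P ∈ D, MemL2s M N (P.1 + P.2) h}

/-- `h⁰` is a minimax-robust spectral characteristic for `D`: it lies in `H_D`, the maximum of
`Δ(h⁰; F, G)` over `D` is attained, and it is the least of the numbers
`sup_D Δ(h; F, G)`, `h ∈ H_D` (suprema in the extended reals). -/
def IsMinimaxRobust {s T : ℕ} (M N : Fin s → ℕ) (a : ℤ → Fin T → ℂ)
    (D : Set ((ℝ → Matrix (Fin T) (Fin T) ℂ) × (ℝ → Matrix (Fin T) (Fin T) ℂ)))
    (h0 : ℝ → Fin T → ℂ) : Prop :=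
  h0 ∈ HD M N D ∧
    (∃ P ∈ D, ∀ P' ∈ D, mse M N a h0 P'.1 P'.2 ≤ mse M N a h0 P.1 P.2) ∧
    ∀ h ∈ HD M N D,
      (⨆ P ∈ D, (mse M N a h0 P.1 P.2 : EReal)) ≤ ⨆ P ∈ D, (mse M N a h P.1 P.2 : EReal)

/-! ### The matrices `B`, `R`, `Q` -/

/-- The Fourier coefficient `(2π)⁻¹ ∫ Φ(t) e^{-int} dt` of a matrix function. -/
def fourierMat {T : ℕ} (Φ : ℝ → Matrix (Fin T) (Fin T) ℂ) (n : ℤ) :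
    Matrix (Fin T) (Fin T) ℂ :=
  Matrix.of fun i j => 1 / (2 * (Real.pi : ℂ)) * ∫ t, Φ t i j * expo (-n) t ∂circ

/-- `B(k, j) = (2π)⁻¹ ∫ (F + G)⁻¹ e^{-i(k-j)t} dt`. -/
def Bmat {T : ℕ} (F G : ℝ → Matrix (Fin T) (Fin T) ℂ) (k j : ℤ) : Matrix (Fin T) (Fin T) ℂ :=
  fourierMat (fun t => (F t + G t)⁻¹) (k - j)

/-- `R(k, j) = (2π)⁻¹ ∫ F (F + G)⁻¹ e^{-i(k+j)t} dt`. -/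
def Rmat {T : ℕ} (F G : ℝ → Matrix (Fin T) (Fin T) ℂ) (k j : ℤ) : Matrix (Fin T) (Fin T) ℂ :=
  fourierMat (fun t => F t * (F t + G t)⁻¹) (k + j)

/-- `Q(k, j) = (2π)⁻¹ ∫ F (F + G)⁻¹ G e^{-i(k-j)t} dt`. -/
def Qmat {T : ℕ} (F G : ℝ → Matrix (Fin T) (Fin T) ℂ) (k j : ℤ) : Matrix (Fin T) (Fin T) ℂ :=
  fourierMat (fun t => F t * (F t + G t)⁻¹ * G t) (k - j)

/-- The component `(R a)(k) = ∑_j a(j)ᵀ R(k, j)`. -/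
def Ra {s T : ℕ} (M N : Fin s → ℕ) (a : ℤ → Fin T → ℂ)
    (F G : ℝ → Matrix (Fin T) (Fin T) ℂ) (k : ℤ) : Fin T → ℂ :=
  ∑' j : ℤ, coeffVec M N a j ᵥ* Rmat F G k j

/-- The number `⟨Q a, a⟩ = ∑_{k, j} a(k)ᵀ Q(k, j) conj a(j)`. -/
def Qaa {s T : ℕ} (M N : Fin s → ℕ) (a : ℤ → Fin T → ℂ)
    (F G : ℝ → Matrix (Fin T) (Fin T) ℂ) : ℝ :=
  (∑' k : ℤ, ∑' j : ℤ,
    coeffVec M N a k ⬝ᵥ (Qmat F G k j *ᵥ star (coeffVec M N a j))).re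

/-- `(K x)(k) = ∑_j x(j)ᵀ K(k, j)` for a block matrix `K` and a finitely supported `x`. -/
def applyMat {T : ℕ} (K : ℤ → ℤ → Matrix (Fin T) (Fin T) ℂ) (x : ℤ →₀ (Fin T → ℂ)) (k : ℤ) :
    Fin T → ℂ :=
  ∑ j ∈ x.support, x j ᵥ* K k j

/-- `⟨r, x⟩ = ∑_k r(k)ᵀ conj x(k)` for a finitely supported `x`. -/
def pairing {T : ℕ} (r : ℤ → Fin T → ℂ) (x : ℤ →₀ (Fin T → ℂ)) : ℂ :=
  ∑ k ∈ x.support, r k ⬝ᵥ star (x k)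

/-- `c = K⁻¹ r` and `q = ⟨r, K⁻¹ r⟩`, where `K` is the nonnegative operator on sequences indexed
by `V` given by the block matrix `(K(k, j))_{k, j ∈ V}`.

The matrix acts on finitely supported sequences; the operator is its closure with respect to the
energy form `⟨K x, x⟩`. Thus `c` is the coordinatewise limit of finitely supported `xₙ` which are
Cauchy for the energy and satisfy `(K xₙ)(k) → r(k)` for all `k ∈ V`. The pair `(c, q)`
is unique when `K` is the matrix of a density satisfying the minimality condition, and if `K` is
bounded and boundedly invertible in `ℓ₂(V)`, then `c` is the usual `K⁻¹ r ∈ ℓ₂(V)`, `r ∈ ℓ₂(V)`. -/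
def IsInverseApply {T : ℕ} (V : Set ℤ) (K : ℤ → ℤ → Matrix (Fin T) (Fin T) ℂ)
    (r c : ℤ → Fin T → ℂ) (q : ℝ) : Prop :=
  ∃ x : ℕ → ℤ →₀ (Fin T → ℂ),
    (∀ n, ((x n).support : Set ℤ) ⊆ V) ∧
    (∀ ε : ℝ, 0 < ε → ∃ n₀, ∀ m ≥ n₀, ∀ n ≥ n₀,
      (pairing (applyMat K (x m - x n)) (x m - x n)).re < ε) ∧
    (∀ k, Tendsto (fun n => x n k) atTop (𝓝 (c k))) ∧
    (∀ k ∈ V, Tendsto (fun n => applyMat K (x n) k) atTop (𝓝 (r k))) ∧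
    Tendsto (fun n => pairing r (x n)) atTop (𝓝 (q : ℂ))

/-- `v = ⟨R a, B⁻¹ R a⟩ + ⟨Q a, a⟩` for the operators `B, R, Q` of the pair `(F, G)`. -/
def IsValue {s T : ℕ} (M N : Fin s → ℕ) (a : ℤ → Fin T → ℂ)
    (F G : ℝ → Matrix (Fin T) (Fin T) ℂ) (v : ℝ) : Prop :=
  ∃ c q, IsInverseApply (unobserved M N) (Bmat F G) (Ra M N a F G) c q ∧
    v = q + Qaa M N a F G

/-- The operators of `(F⁰, G⁰)` solve the optimization problem: the value
`⟨R a, B⁻¹ R a⟩ + ⟨Q a, a⟩` at `(F⁰, G⁰)` is the maximum of all its values at pairs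
`(F, G) ∈ D_F × D_G` satisfying the minimality condition. -/
def SolvesExtremal {s T : ℕ} (M N : Fin s → ℕ) (a : ℤ → Fin T → ℂ)
    (DF DG : Set (ℝ → Matrix (Fin T) (Fin T) ℂ))
    (F0 G0 : ℝ → Matrix (Fin T) (Fin T) ℂ) : Prop :=
  ∃ v0, IsValue M N a F0 G0 v0 ∧
    ∀ F ∈ DF, ∀ G ∈ DG, IsMinimal F G → ∀ v, IsValue M N a F G v → v ≤ v0

/-- `C(t) = ∑_k c(k) e^{ikt}`, as the Fourier series of the integrable function `C`. -/
def HasFourierSeries {T : ℕ} (C : ℝ → Fin T → ℂ) (c : ℤ → Fin T → ℂ) : Prop :=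
  (∀ i, Integrable (fun t => C t i) circ) ∧
    ∀ k i, 1 / (2 * (Real.pi : ℂ)) * ∫ t, C t i * expo (-k) t ∂circ = c k i

/-- `h` is given by the formula
`hᵀ = Aᵀ F (F + G)⁻¹ - (∑_{k ∈ U} (B⁻¹ R a)(k) e^{ikt})ᵀ (F + G)⁻¹` (almost everywhere). -/
def GivenByFormula {s T : ℕ} (M N : Fin s → ℕ) (a : ℤ → Fin T → ℂ)
    (F G : ℝ → Matrix (Fin T) (Fin T) ℂ) (h : ℝ → Fin T → ℂ) : Prop :=
  ∃ c q C, IsInverseApply (unobserved M N) (Bmat F G) (Ra M N a F G) c q ∧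
    HasFourierSeries C c ∧
    ∀ᵐ t ∂circ, h t = Afun M N a t ᵥ* (F t * (F t + G t)⁻¹) - C t ᵥ* (F t + G t)⁻¹

end

end RobustFilter

namespace RobustFilter

/-! ### Characters on the circle -/

/-! Put `W = F + G`. Pointwise completion of the square (`herm_complete_square`) writes the error
density of an estimate `h` as the `W`-norm of `h - Aᵀ F W⁻¹` plus a term independent of `h`, whose
integral is `⟨Q a, a⟩`. After multiplication by `W^{1/2}` the filtering problem takes place in the
unweighted space `L²(ℂ^T)`: the optimal `h` is the projection of the target `Aᵀ F W^{-1/2}` onto the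
closed span of the observed exponentials, and the error is `‖residual‖² / 2π + ⟨Q a, a⟩`.

The residual is orthogonal to the observations. The decisive duality
(`IsRegular.orthogonal_polyClosure_compl`) says that this orthogonal complement is exactly the
closure of the functions `x(t)ᵀ W^{-1/2}`, `x` a trigonometric polynomial with frequencies in `U`.
Since `B` is the Gram matrix of these functions and `R a` lists the products of the target with
them, the normal equations of the residual read `B c = R a`. Hence `c = B⁻¹ R a` and `⟨R a, B⁻¹ R a⟩
= ‖residual‖² / 2π` (`isInverseApply_iff`). The objective of the extremal problem is therefore the
minimal error itself, and the formula for `h⁰` follows.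

The hard inclusion of the duality concerns an integrable `C` with spectrum in `U` and finite norm
for the merely integrable weight `W⁻¹`; polynomials with frequencies in `U` must approximate it in
that norm. Only finitely many frequencies of `U` are negative, so `C` may be taken analytic. Szegő's
extremal functions `φ` of weights `1 + u/(k+1)`, with `u` dominating both `C` and the trace of the
weight, have `|φ|² (1 + u/(k+1))` constant (`exists_outer`). Two factors `φ` make `φ² C` bounded and
keep it analytic, a third one absorbs the weight, so `φ³ C` can be approximated; a subsequence of
the `φ` tends to `1` almost everywhere, boundedly, and `φ³ C` tends to `C`
(`exists_trigPoly_analytic`).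

For convex classes, mixtures of a pair with `(F⁰, G⁰)` stay minimal (`IsMinimal.mixture`). The
minimal error is the infimum over polynomials `x` of errors that are affine in the pair, hence
concave along the mixture, which extends the maximality to all of `D`. For the saddle point `Δ(h⁰;
F, G) ≤ Δ(h⁰; F⁰, G⁰)` one differentiates at the least favorable end of the segment. As `L₂ˢ`
changes with the pair, the argument is run on polynomials: the excess error of `x` at `(F⁰, G⁰)` is
its squared distance to `h⁰` (`mse_trigPoly_of_isOptimal`), and the possible gain at `(F, G)` is at
most a constant times that distance, up to an arbitrarily small loss (`exists_mse_lower_bound`). A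
small enough mixture then contradicts maximality (`mse_le_of_mixture`). -/

instance : IsFiniteMeasure circ := by unfold circ; infer_instance

theorem circ_univ : circ.real Set.univ = 2 * Real.pi := by
  rw [circ, Measure.real, Measure.restrict_apply_univ, Real.volume_Ico,
    ENNReal.toReal_ofReal (by linarith [Real.pi_pos])]
  ring

@[fun_prop]
theorem continuous_expo (n : ℤ) : Continuous (expo n) := by
  unfold expo; fun_prop

@[simp]
theorem norm_expo (n : ℤ) (t : ℝ) : ‖expo n t‖ = 1 := by
  have : Complex.I * (n : ℂ) * (t : ℂ) = ((n * t : ℝ) : ℂ) * Complex.I := by push_cast; ring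
  rw [expo, this, Complex.norm_exp_ofReal_mul_I]

@[simp]
theorem expo_zero (t : ℝ) : expo 0 t = 1 := by simp [expo]

theorem expo_add (m n : ℤ) (t : ℝ) : expo (m + n) t = expo m t * expo n t := by
  rw [expo, expo, expo, ← Complex.exp_add]; push_cast; ring_nf

theorem star_expo (n : ℤ) (t : ℝ) : star (expo n t) = expo (-n) t := by
  rw [expo, expo, Complex.star_def, ← Complex.exp_conj]
  simp

theorem conj_expo (n : ℤ) (t : ℝ) : (starRingEnd ℂ) (expo n t) = expo (-n) t := star_expo n t

theorem integral_circ (f : ℝ → ℂ) :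
    ∫ t, f t ∂circ = ∫ t in (-Real.pi)..Real.pi, f t := by
  rw [circ, integral_Ico_eq_integral_Ioo, ← integral_Ioc_eq_integral_Ioo,
    intervalIntegral.integral_of_le (by linarith [Real.pi_pos])]

theorem integral_expo (n : ℤ) :
    ∫ t, expo n t ∂circ = if n = 0 then 2 * (Real.pi : ℂ) else 0 := by
  rw [integral_circ]
  split_ifs with h
  · subst h
    simp; ring
  · have hc : Complex.I * (n : ℂ) ≠ 0 := by simp [h]
    have := integral_exp_mul_complex (a := -Real.pi) (b := Real.pi) hc
    unfold expo
    rw [this]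
    rw [div_eq_zero_iff]; left
    rw [sub_eq_zero, Complex.exp_eq_exp_iff_exists_int]
    exact ⟨n, by push_cast; ring⟩

theorem memLp_expo (n : ℤ) (p : ENNReal) (μ : Measure ℝ) [IsFiniteMeasure μ] :
    MemLp (expo n) p μ :=
  MemLp.of_bound (continuous_expo n).aestronglyMeasurable 1 (by simp)

theorem integrable_mul_expo {μ : Measure ℝ} {f : ℝ → ℂ} (hf : Integrable f μ) (n : ℤ) :
    Integrable (fun t => f t * expo n t) μ := by
  refine hf.mul_bdd (c := 1) (continuous_expo n).aestronglyMeasurable ?_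
  simp

/-- An integrable function on the circle is determined by its Fourier coefficients. -/
theorem ae_eq_zero_of_fourier {f : ℝ → ℂ} (hf : Integrable f circ)
    (h : ∀ n : ℤ, ∫ t, f t * expo n t ∂circ = 0) : f =ᵐ[circ] 0 := by
  have hT : Fact (0 < 2 * Real.pi) := ⟨by positivity⟩
  have hint : ∀ g : C(AddCircle (2 * Real.pi), ℂ),
      Integrable (fun t : ℝ => f t * g (t : AddCircle (2 * Real.pi))) circ := by
    intro g
    refine hf.mul_bdd (c := ‖g‖)
      (g.continuous.comp (AddCircle.continuous_mk' _)).aestronglyMeasurable ?_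
    exact ae_of_all _ fun t => g.norm_coe_le_norm _
  let L : C(AddCircle (2 * Real.pi), ℂ) →ₗ[ℂ] ℂ :=
    { toFun := fun g => ∫ t, f t * g (t : AddCircle (2 * Real.pi)) ∂circ
      map_add' := fun g g' => by
        rw [← integral_add (hint g) (hint g')]
        simp [mul_add]
      map_smul' := fun c g => by
        rw [RingHom.id_apply, smul_eq_mul, ← integral_const_mul]
        congr 1; ext t; simp; ring }
  let L' : C(AddCircle (2 * Real.pi), ℂ) →L[ℂ] ℂ := L.mkContinuous (∫ t, ‖f t‖ ∂circ) (by
    intro g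
    change ‖∫ t, f t * g (t : AddCircle (2 * Real.pi)) ∂circ‖ ≤ _
    rw [← integral_mul_const]
    refine norm_integral_le_of_norm_le (hf.norm.mul_const _) (ae_of_all _ fun t => ?_)
    rw [norm_mul]
    gcongr
    exact g.norm_coe_le_norm _)
  -- The kernel of a bounded functional is closed and contains the characters, whose span is dense
  -- in `C(circle)`.
  have hker : LinearMap.ker (L' : C(AddCircle (2 * Real.pi), ℂ) →ₗ[ℂ] ℂ) = ⊤ := by
    rw [eq_top_iff, ← span_fourier_closure_eq_top]
    apply Submodule.topologicalClosure_minimal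
    · rw [Submodule.span_le]
      rintro _ ⟨n, rfl⟩
      change ∫ t, f t * fourier n (t : AddCircle (2 * Real.pi)) ∂circ = 0
      rw [← h n]
      congr 1; ext t
      rw [fourier_coe_apply, expo]
      congr 2
      have : (Real.pi : ℂ) ≠ 0 := by exact_mod_cast Real.pi_ne_zero
      push_cast
      field_simp
    · exact L'.isClosed_ker
  have hzero : ∀ g : C(AddCircle (2 * Real.pi), ℂ),
      ∫ t, f t * g (t : AddCircle (2 * Real.pi)) ∂circ = 0 := by
    intro g
    have : g ∈ LinearMap.ker (L' : C(AddCircle (2 * Real.pi), ℂ) →ₗ[ℂ] ℂ) := by rw [hker]; trivial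
    exact this
  -- A test function supported in the open interval vanishes at both endpoints, so it descends to a
  -- continuous function on the circle, to which `hzero` applies.
  have hae := isOpen_Ioo.ae_eq_zero_of_integral_contDiff_smul_eq_zero (μ := volume)
    (U := Set.Ioo (-Real.pi) Real.pi) (f := f)
    ((show IntegrableOn f (Set.Ico (-Real.pi) Real.pi) volume from hf).mono_set
      Set.Ioo_subset_Ico_self).locallyIntegrableOn (by
      intro g hg _ hsupp
      have hz : ∀ t, t ∉ Set.Ioo (-Real.pi) Real.pi → g t = 0 := fun t ht =>
        image_eq_zero_of_notMem_tsupport fun h => ht (hsupp h)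
      have hcont : Continuous (AddCircle.liftIco (2 * Real.pi) (-Real.pi)
          (fun t => (g t : ℂ))) := by
        apply AddCircle.liftIco_continuous
        · rw [hz _ (by simp), hz _ (by simp; intros; linarith)]
        · exact (Complex.continuous_ofReal.comp hg.continuous).continuousOn
      have := hzero ⟨_, hcont⟩
      rw [circ] at this
      rw [← this, ← setIntegral_eq_integral_of_forall_compl_eq_zero
        (s := Set.Ico (-Real.pi) Real.pi)]
      · refine setIntegral_congr_fun measurableSet_Ico fun t ht => ?_
        simp only [ContinuousMap.coe_mk]
        rw [AddCircle.liftIco_coe_apply (by rwa [show -Real.pi + 2 * Real.pi = Real.pi by ring])]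
        rw [Complex.real_smul, mul_comm]
      · intro t ht
        rw [hz t (fun h => ht (Set.Ioo_subset_Ico_self h)), zero_smul])
  rw [circ, ← Measure.restrict_congr_set Ioo_ae_eq_Ico]
  exact (ae_restrict_iff' measurableSet_Ioo).2 hae

end RobustFilter

namespace RobustFilter

/-! ### Trigonometric polynomials in weighted `L²` spaces -/

/-- The trigonometric polynomials with frequencies in `V`. -/
def trigSpan (V : Set ℤ) : Submodule ℂ (ℝ → ℂ) := Submodule.span ℂ (expo '' V)

/-- The character `e^{int}` as an element of `L²(μ)`. -/
noncomputable def expoLp (μ : Measure ℝ) [IsFiniteMeasure μ] (n : ℤ) : Lp ℂ 2 μ :=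
  (memLp_expo n 2 μ).toLp

/-- The closed span in `L²(μ)` of the characters with frequencies in `V`. -/
noncomputable def expoSpan (μ : Measure ℝ) [IsFiniteMeasure μ] (V : Set ℤ) : Submodule ℂ (Lp ℂ 2 μ) :=
  (Submodule.span ℂ (expoLp μ '' V)).topologicalClosure

instance (μ : Measure ℝ) [IsFiniteMeasure μ] (V : Set ℤ) : CompleteSpace (expoSpan μ V) :=
  (Submodule.isClosed_topologicalClosure _).completeSpace_coe

theorem expoLp_mem_expoSpan (μ : Measure ℝ) [IsFiniteMeasure μ] {V : Set ℤ} {n : ℤ} (hn : n ∈ V) :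
    expoLp μ n ∈ expoSpan μ V :=
  Submodule.le_topologicalClosure _ (Submodule.subset_span ⟨n, hn, rfl⟩)

theorem continuous_of_mem_trigSpan {V : Set ℤ} {p : ℝ → ℂ} (hp : p ∈ trigSpan V) :
    Continuous p := by
  induction hp using Submodule.span_induction with
  | mem x h => obtain ⟨n, -, rfl⟩ := h; exact continuous_expo n
  | zero => exact continuous_zero
  | add x y _ _ hx hy => exact hx.add hy
  | smul a x _ hx => exact hx.const_smul a

theorem bounded_of_mem_trigSpan {V : Set ℤ} {p : ℝ → ℂ} (hp : p ∈ trigSpan V) :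
    ∃ C : ℝ, 0 ≤ C ∧ ∀ t, ‖p t‖ ≤ C := by
  induction hp using Submodule.span_induction with
  | mem x h => obtain ⟨n, -, rfl⟩ := h; exact ⟨1, zero_le_one, by simp⟩
  | zero => exact ⟨0, le_rfl, by simp⟩
  | add x y _ _ hx hy =>
    obtain ⟨C, h0, hC⟩ := hx
    obtain ⟨D, h1, hD⟩ := hy
    exact ⟨C + D, by positivity, fun t => (norm_add_le _ _).trans (add_le_add (hC t) (hD t))⟩
  | smul a x _ hx =>
    obtain ⟨C, h0, hC⟩ := hx
    refine ⟨‖a‖ * C, by positivity, fun t => ?_⟩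
    rw [Pi.smul_apply, norm_smul]
    gcongr
    exact hC t

/-- Nonnegative frequencies are closed under addition. This is the algebra structure behind
"analytic": it is what allows `φ²` to be replaced by `p²`, and `φ³ f` by a product of two
polynomials. -/
theorem mul_mem_trigSpan {p q : ℝ → ℂ} (hp : p ∈ trigSpan {n | 0 ≤ n})
    (hq : q ∈ trigSpan {n | 0 ≤ n}) : p * q ∈ trigSpan {n | 0 ≤ n} := by
  induction hp using Submodule.span_induction with
  | mem x h =>
    obtain ⟨n, hn, rfl⟩ := h
    induction hq using Submodule.span_induction with
    | mem y h =>
      obtain ⟨m, hm, rfl⟩ := h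
      refine Submodule.subset_span ⟨n + m, show (0 : ℤ) ≤ n + m from add_nonneg hn hm, ?_⟩
      ext t
      exact expo_add n m t
    | zero => rw [mul_zero]; exact zero_mem _
    | add x y _ _ hx hy => rw [mul_add]; exact add_mem hx hy
    | smul a x _ hx => rw [mul_smul_comm]; exact Submodule.smul_mem _ _ hx
  | zero => rw [zero_mul]; exact zero_mem _
  | add x y _ _ hx hy => rw [add_mul]; exact add_mem hx hy
  | smul a x _ hx => rw [smul_mul_assoc]; exact Submodule.smul_mem _ _ hx

theorem norm_sq_toLp {μ : Measure ℝ} {E : Type*} [NormedAddCommGroup E] [InnerProductSpace ℂ E]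
    (f : Lp E 2 μ) : ‖f‖ ^ 2 = ∫ t, ‖f t‖ ^ 2 ∂μ := by
  rw [← inner_self_eq_norm_sq (𝕜 := ℂ), L2.inner_def]
  rw [← integral_re]
  · simp only [inner_self_eq_norm_sq]
  · exact L2.integrable_inner f f

theorem exists_trigSpan_of_mem_expoSpan {μ : Measure ℝ} [IsFiniteMeasure μ] {V : Set ℤ}
    {f : Lp ℂ 2 μ} (hf : f ∈ expoSpan μ V) {η : ℝ} (hη : 0 < η) :
    ∃ p ∈ trigSpan V, ∫ t, ‖f t - p t‖ ^ 2 ∂μ < η := by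
  have hf' : f ∈ closure (Submodule.span ℂ (expoLp μ '' V) : Set (Lp ℂ 2 μ)) := hf
  obtain ⟨P, hP, hfP⟩ := Metric.mem_closure_iff.1 hf' (Real.sqrt η) (Real.sqrt_pos.2 hη)
  have key : ∃ p ∈ trigSpan V, P =ᵐ[μ] p := by
    clear hfP
    induction hP using Submodule.span_induction with
    | mem x h =>
      obtain ⟨n, hn, rfl⟩ := h
      exact ⟨expo n, Submodule.subset_span ⟨n, hn, rfl⟩, MemLp.coeFn_toLp _⟩
    | zero => exact ⟨0, zero_mem _, Lp.coeFn_zero _ _ _⟩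
    | add x y _ _ hx hy =>
      obtain ⟨p, hp, hxp⟩ := hx
      obtain ⟨q, hq, hyq⟩ := hy
      exact ⟨p + q, add_mem hp hq, (Lp.coeFn_add _ _).trans (hxp.add hyq)⟩
    | smul a x _ hx =>
      obtain ⟨p, hp, hxp⟩ := hx
      exact ⟨a • p, Submodule.smul_mem _ _ hp,
        (Lp.coeFn_smul _ _).trans (hxp.const_smul a)⟩
  obtain ⟨p, hp, hPp⟩ := key
  refine ⟨p, hp, ?_⟩
  have h1 : ∫ t, ‖f t - p t‖ ^ 2 ∂μ = ‖f - P‖ ^ 2 := by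
    rw [norm_sq_toLp]
    refine integral_congr_ae ?_
    filter_upwards [hPp, Lp.coeFn_sub f P] with t h1 h2
    rw [h2, Pi.sub_apply, h1]
  rw [h1]
  rw [dist_eq_norm] at hfP
  calc ‖f - P‖ ^ 2 < Real.sqrt η ^ 2 := by gcongr
    _ = η := Real.sq_sqrt hη.le

theorem inner_expoLp {μ : Measure ℝ} [IsFiniteMeasure μ] (n : ℤ) (f : Lp ℂ 2 μ) :
    inner ℂ (expoLp μ n) f = ∫ t, f t * expo (-n) t ∂μ := by
  rw [L2.inner_def]
  refine integral_congr_ae ?_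
  filter_upwards [(memLp_expo n 2 μ).coeFn_toLp] with t h
  rw [expoLp, h, RCLike.inner_apply, conj_expo]

/-- A function orthogonal to the characters generates a space orthogonal to it. -/
theorem inner_eq_zero_of_mem_expoSpan {μ : Measure ℝ} [IsFiniteMeasure μ] {V : Set ℤ}
    {f g : Lp ℂ 2 μ} (h : ∀ n ∈ V, inner ℂ g (expoLp μ n) = 0) (hf : f ∈ expoSpan μ V) :
    inner ℂ g f = 0 := by
  have : expoSpan μ V ≤ (ℂ ∙ g)ᗮ := by
    refine Submodule.topologicalClosure_minimal _ ?_ (Submodule.isClosed_orthogonal _)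
    rw [Submodule.span_le]
    rintro _ ⟨n, hn, rfl⟩
    exact Submodule.mem_orthogonal_singleton_iff_inner_right.2 (h n hn)
  exact Submodule.mem_orthogonal_singleton_iff_inner_right.1 (this hf)

/-- A square integrable function with spectrum in `V` lies in the closed span of the characters
with frequencies in `V`. -/
theorem mem_expoSpan_of_fourier {V : Set ℤ} {f : Lp ℂ 2 circ}
    (h : ∀ n ∉ V, ∫ t, f t * expo (-n) t ∂circ = 0) : f ∈ expoSpan circ V := by
  have horth : ∀ m n : ℤ, m ≠ n → inner ℂ (expoLp circ m) (expoLp circ n) = 0 := by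
    intro m n hmn
    rw [inner_expoLp]
    have : ∫ t, expoLp circ n t * expo (-m) t ∂circ = ∫ t, expo (n - m) t ∂circ := by
      refine integral_congr_ae ?_
      filter_upwards [(memLp_expo n 2 circ).coeFn_toLp] with t h
      rw [expoLp, h, ← expo_add, sub_eq_add_neg]
    rw [this, integral_expo, if_neg (by omega)]
  set P : Lp ℂ 2 circ := (expoSpan circ V).starProjection f with hP
  have hPm : P ∈ expoSpan circ V := Submodule.starProjection_apply_mem _ _
  -- For `n ∈ V` this is the projection property; for `n ∉ V` the hypothesis on `f` and the
  -- orthogonality of distinct characters give it for `f` and `P` separately. Completeness of the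
  -- characters then gives `f = P`.
  have hr : ∀ n, inner ℂ (expoLp circ n) (f - P) = 0 := by
    intro n
    by_cases hn : n ∈ V
    · exact (Submodule.sub_starProjection_mem_orthogonal (K := expoSpan circ V) f) _
        (expoLp_mem_expoSpan circ hn)
    · rw [inner_sub_right, inner_expoLp, h n hn, zero_sub, neg_eq_zero]
      exact inner_eq_zero_of_mem_expoSpan
        (fun m hm => horth n m (by rintro rfl; exact hn hm)) hPm
  have hzero : (f - P : Lp ℂ 2 circ) =ᵐ[circ] 0 := by
    refine ae_eq_zero_of_fourier ((Lp.memLp (f - P)).integrable (by norm_num)) fun n => ?_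
    have := hr (-n)
    rwa [inner_expoLp, neg_neg] at this
  have : f - P = 0 := Lp.eq_zero_iff_ae_eq_zero.2 hzero
  rw [sub_eq_zero.1 this]
  exact hPm

end RobustFilter

namespace RobustFilter

/-! ### Outer functions with prescribed modulus -/

/-- The measure `(1 + u) dt` on the circle. -/
noncomputable def weighted (u : ℝ → ℝ) : Measure ℝ :=
  circ.withDensity fun t => ENNReal.ofReal (1 + u t)

theorem isFiniteMeasure_weighted {u : ℝ → ℝ} (hu : Integrable u circ) :
    IsFiniteMeasure (weighted u) :=
  isFiniteMeasure_withDensity_ofReal ((integrable_const (1 : ℝ)).add hu).2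

theorem integral_weighted {u : ℝ → ℝ} (hu : Integrable u circ) (h0 : ∀ t, 0 ≤ u t)
    {E : Type*} [NormedAddCommGroup E] [NormedSpace ℝ E] (f : ℝ → E) :
    ∫ t, f t ∂weighted u = ∫ t, (1 + u t) • f t ∂circ := by
  rw [weighted, integral_withDensity_eq_integral_toReal_smul₀ ?_ (by simp)]
  · congr 1; ext t
    rw [ENNReal.toReal_ofReal (by linarith [h0 t])]
  · exact (hu.aemeasurable.const_add 1).ennreal_ofReal

theorem integrable_weighted {u : ℝ → ℝ} (hu : Integrable u circ) (h0 : ∀ t, 0 ≤ u t)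
    {E : Type*} [NormedAddCommGroup E] [NormedSpace ℝ E] {f : ℝ → E} :
    Integrable f (weighted u) ↔ Integrable (fun t => (1 + u t) • f t) circ := by
  rw [weighted, integrable_withDensity_iff_integrable_smul₀' ?_ (by simp)]
  · refine integrable_congr (ae_of_all _ fun t => ?_)
    simp only []
    rw [ENNReal.toReal_ofReal (by linarith [h0 t])]
  · exact (hu.aemeasurable.const_add 1).ennreal_ofReal

theorem circ_absolutelyContinuous_weighted {u : ℝ → ℝ} (hu : Integrable u circ)
    (h0 : ∀ t, 0 ≤ u t) : circ ≪ weighted u := by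
  refine withDensity_absolutelyContinuous' ?_ (ae_of_all _ fun t => ?_)
  · exact (hu.aemeasurable.const_add 1).ennreal_ofReal
  · simpa using by linarith [h0 t]

theorem weighted_absolutelyContinuous_circ (u : ℝ → ℝ) : weighted u ≪ circ :=
  withDensity_absolutelyContinuous _ _

/-- Szegő's extremal function of the weight `1 + u`: an analytic `φ` with `φ(0) = 1` and
`|φ|² (1 + u)` constant. -/
theorem exists_outer {u : ℝ → ℝ} (hu : Integrable u circ) (h0 : ∀ t, 0 ≤ u t) :
    ∃ (φ : ℝ → ℂ) (c : ℝ), AEStronglyMeasurable φ circ ∧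
      2 * Real.pi * c ≤ 2 * Real.pi + ∫ t, u t ∂circ ∧
      (∀ᵐ t ∂circ, ‖φ t‖ ^ 2 * (1 + u t) = c) ∧
      ∫ t, ‖φ t - 1‖ ^ 2 ∂circ ≤ ∫ t, u t ∂circ ∧
      ∀ η : ℝ, 0 < η → ∃ p ∈ trigSpan {n | 0 ≤ n},
        ∫ t, ‖φ t - p t‖ ^ 2 * (1 + u t) ∂circ < η := by
  have := isFiniteMeasure_weighted hu
  set ν := weighted u with hν
  have hac : circ ≪ ν := circ_absolutelyContinuous_weighted hu h0
  have hωm : AEStronglyMeasurable (fun t => 1 + u t) circ := hu.1.const_add 1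
  set P : Lp ℂ 2 ν := (expoSpan ν {n | 1 ≤ n}).starProjection (expoLp ν 0) with hP
  -- The element of least norm in `1 + span {e^{int} : n ≥ 1}`, closed up in `L²((1 + u) dt)`.
  set Φ : Lp ℂ 2 ν := expoLp ν 0 - P with hΦ
  have hPm : P ∈ expoSpan ν {n | 1 ≤ n} := Submodule.starProjection_apply_mem _ _
  have hsub : expoSpan ν {n | 1 ≤ n} ≤ expoSpan ν {n | 0 ≤ n} :=
    Submodule.topologicalClosure_mono (Submodule.span_mono
      (Set.image_mono fun n (hn : 1 ≤ n) => (by omega : (0 : ℤ) ≤ n)))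
  have hΦm : Φ ∈ expoSpan ν {n | 0 ≤ n} :=
    sub_mem (expoLp_mem_expoSpan ν (le_refl (0 : ℤ))) (hsub hPm)
  have horth : ∀ n : ℤ, 1 ≤ n → inner ℂ Φ (expoLp ν n) = 0 := by
    intro n hn
    rw [← inner_conj_symm]
    rw [(Submodule.sub_starProjection_mem_orthogonal (K := expoSpan ν {n | 1 ≤ n}) (expoLp ν 0)) _
        (expoLp_mem_expoSpan ν hn), map_zero]
  have hΦL := Lp.memLp Φ
  have hΦsq : Integrable (fun t => ‖Φ t‖ ^ 2) ν := hΦL.norm.integrable_sq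
  have hΦmeas : AEStronglyMeasurable Φ circ := (Lp.aestronglyMeasurable Φ).mono_ac hac
  -- the Fourier coefficients of `|φ|²` with respect to the weight
  have hpos : ∀ n : ℤ, 1 ≤ n → ∫ t, ((‖Φ t‖ ^ 2 : ℝ) : ℂ) * expo n t ∂ν = 0 := by
    intro n hn
    have hm : MemLp (fun t => Φ t * expo (-n) t) 2 ν := by
      refine hΦL.of_le ((Lp.aestronglyMeasurable Φ).mul (continuous_expo _).aestronglyMeasurable)
        (ae_of_all _ fun t => ?_)
      simp
    have h1 : inner ℂ hm.toLp Φ = 0 := by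
      refine inner_eq_zero_of_mem_expoSpan (fun m hm' => ?_) hΦm
      rw [← horth (n + m) (by have : (0 : ℤ) ≤ m := hm'; omega), L2.inner_def, L2.inner_def]
      refine integral_congr_ae ?_
      filter_upwards [(memLp_expo m 2 ν).coeFn_toLp, (memLp_expo (n + m) 2 ν).coeFn_toLp,
        hm.coeFn_toLp] with t h1 h2 h3
      rw [expoLp, expoLp, h1, h2, h3]
      simp only [RCLike.inner_apply, map_mul, conj_expo, neg_neg, expo_add]
      ring
    rw [← h1, L2.inner_def]
    refine integral_congr_ae ?_
    filter_upwards [hm.coeFn_toLp] with t h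
    rw [h, RCLike.inner_apply, map_mul, conj_expo, neg_neg, ← mul_assoc, RCLike.mul_conj]
    push_cast
    rfl
  set w : ℝ → ℝ := fun t => (1 + u t) * ‖Φ t‖ ^ 2 with hw
  have hwint : Integrable w circ := (integrable_weighted hu h0).1 hΦsq
  have hwf : ∀ n : ℤ, ∫ t, (w t : ℂ) * expo n t ∂circ =
      ∫ t, ((‖Φ t‖ ^ 2 : ℝ) : ℂ) * expo n t ∂ν := by
    intro n
    rw [integral_weighted hu h0]
    congr 1; ext t
    rw [hw, Complex.real_smul]
    push_cast
    ring
  have hw0 : ∀ n : ℤ, n ≠ 0 → ∫ t, (w t : ℂ) * expo n t ∂circ = 0 := by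
    intro n hn
    rcases lt_or_gt_of_ne hn with h | h
    · have h1 : ∫ t, (w t : ℂ) * expo n t ∂circ
          = (starRingEnd ℂ) (∫ t, (w t : ℂ) * expo (-n) t ∂circ) := by
        rw [← integral_conj]
        congr 1; ext t
        rw [map_mul, conj_expo, neg_neg, Complex.conj_ofReal]
      rw [h1, hwf, hpos (-n) (by omega), map_zero]
    · rw [hwf, hpos n (by omega)]
  set c : ℝ := (2 * Real.pi)⁻¹ * ∫ t, w t ∂circ with hc
  have hc' : 2 * Real.pi * c = ∫ t, w t ∂circ := by
    rw [hc, mul_inv_cancel_left₀ (by positivity)]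
  have hconst : ∀ᵐ t ∂circ, w t = c := by
    have hi : Integrable (fun t => (w t : ℂ) - c) circ := hwint.ofReal.sub (integrable_const _)
    have := ae_eq_zero_of_fourier hi (fun n => by
      have e : ∫ t, ((w t : ℂ) - c) * expo n t ∂circ =
          ∫ t, (w t : ℂ) * expo n t ∂circ - ∫ t, (c : ℂ) * expo n t ∂circ := by
        simp only [sub_mul]
        exact integral_sub (integrable_mul_expo hwint.ofReal n)
          (integrable_mul_expo (integrable_const (c : ℂ)) n)
      rw [e, integral_const_mul, integral_expo]
      split_ifs with h
      · subst h
        simp only [expo_zero, mul_one]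
        rw [integral_complex_ofReal, ← hc']
        push_cast; ring
      · rw [hw0 n h]; simp)
    filter_upwards [this] with t ht
    have : (w t : ℂ) = c := sub_eq_zero.1 ht
    exact_mod_cast this
  have hsqle : ∀ᵐ t ∂circ, ‖Φ t‖ ^ 2 ≤ c := by
    filter_upwards [hconst] with t ht
    rw [← ht, hw]
    nlinarith [h0 t, sq_nonneg ‖Φ t‖, mul_nonneg (h0 t) (sq_nonneg ‖Φ t‖)]
  have hΦ2 : MemLp Φ 2 circ := by
    refine MemLp.of_bound hΦmeas (Real.sqrt c) ?_
    filter_upwards [hsqle] with t ht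
    exact Real.le_sqrt_of_sq_le ht
  -- the normalization
  have hmean : ∫ t, Φ t ∂circ = 2 * Real.pi := by
    have hinv : MemLp (fun t => (((1 + u t)⁻¹ : ℝ) : ℂ)) 2 ν := by
      refine MemLp.of_bound ?_ 1 (ae_of_all _ fun t => ?_)
      · exact (Complex.continuous_ofReal.comp_aestronglyMeasurable
          (hωm.aemeasurable.inv.aestronglyMeasurable)).mono_ac (weighted_absolutelyContinuous_circ u)
      · rw [Complex.norm_real, Real.norm_of_nonneg (by have := h0 t; positivity)]
        exact inv_le_one_of_one_le₀ (by linarith [h0 t])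
    have hfun : ∀ g : Lp ℂ 2 ν, inner ℂ hinv.toLp g = ∫ t, g t ∂circ := by
      intro g
      have h1 : inner ℂ hinv.toLp g = ∫ t, (((1 + u t)⁻¹ : ℝ) : ℂ) * g t ∂ν := by
        rw [L2.inner_def]
        refine integral_congr_ae ?_
        filter_upwards [hinv.coeFn_toLp] with t h
        rw [h, RCLike.inner_apply, Complex.conj_ofReal, mul_comm]
      rw [h1, integral_weighted hu h0]
      congr 1; ext t
      have : (1 + u t) ≠ 0 := by have := h0 t; positivity
      rw [Complex.real_smul, ← mul_assoc, ← Complex.ofReal_mul, mul_inv_cancel₀ this]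
      simp
    have hexp : ∀ n, inner ℂ hinv.toLp (expoLp ν n) = if n = 0 then 2 * (Real.pi : ℂ) else 0 := by
      intro n
      rw [hfun, ← integral_expo]
      exact integral_congr_ae (hac.ae_le (memLp_expo n 2 ν).coeFn_toLp)
    rw [← hfun, hΦ, inner_sub_right, hexp, if_pos rfl,
      inner_eq_zero_of_mem_expoSpan (fun n hn => ?_) hPm, sub_zero]
    rw [hexp, if_neg (by have : (1 : ℤ) ≤ n := hn; omega)]
  have hcle : 2 * Real.pi * c ≤ 2 * Real.pi + ∫ t, u t ∂circ := by
    have h1 : ‖Φ‖ ≤ ‖expoLp ν 0‖ := by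
      have := (expoSpan ν {n | 1 ≤ n})ᗮ.norm_starProjection_apply_le (expoLp ν 0)
      rwa [Submodule.starProjection_orthogonal_val] at this
    have h2 : ‖Φ‖ ^ 2 ≤ ‖expoLp ν 0‖ ^ 2 := by gcongr
    rw [norm_sq_toLp, norm_sq_toLp, integral_weighted hu h0] at h2
    have h3 : ∫ t, ‖expoLp ν 0 t‖ ^ 2 ∂ν = 2 * Real.pi + ∫ t, u t ∂circ := by
      have : ∫ t, ‖expoLp ν 0 t‖ ^ 2 ∂ν = ∫ t, (1 : ℝ) ∂ν := by
        refine integral_congr_ae ?_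
        filter_upwards [(memLp_expo 0 2 ν).coeFn_toLp] with t h
        rw [expoLp, h]; simp
      rw [this, integral_weighted hu h0]
      simp only [smul_eq_mul, mul_one]
      rw [integral_add (integrable_const _) hu, integral_const, circ_univ, smul_eq_mul, mul_one]
    rw [h3] at h2
    rw [hc']
    exact h2
  refine ⟨Φ, c, hΦmeas, hcle, ?_, ?_, ?_⟩
  · filter_upwards [hconst] with t ht
    rw [← ht, hw]; ring
  · have hΦi : Integrable Φ circ := hΦ2.integrable (by norm_num)
    have hΦs : Integrable (fun t => ‖Φ t‖ ^ 2) circ := hΦ2.norm.integrable_sq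
    -- Since `Φ` has mean one, the integral of `|Φ - 1|²` equals that of `|Φ|²` minus `2π`. With
    -- `|Φ|² ≤ c` it is at most `2πc - 2π`, which the bound on `c` turns into the integral of `u`.
    have hexpand : ∀ t, ‖Φ t - 1‖ ^ 2 = ‖Φ t‖ ^ 2 - 2 * (Φ t).re + 1 := by
      intro t
      rw [← Complex.normSq_eq_norm_sq, ← Complex.normSq_eq_norm_sq, Complex.normSq_apply,
        Complex.normSq_apply]
      simp
      ring
    simp only [hexpand]
    have hre : ∫ t, (Φ t).re ∂circ = 2 * Real.pi := by
      have := integral_re hΦi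
      simp only [RCLike.re_to_complex] at this
      rw [this, hmean]
      simp
    have hr : Integrable (fun t => 2 * (Φ t).re) circ := hΦi.re.const_mul 2
    have e : ∫ t, (‖Φ t‖ ^ 2 - 2 * (Φ t).re + 1) ∂circ =
        ∫ t, ‖Φ t‖ ^ 2 ∂circ - ∫ t, 2 * (Φ t).re ∂circ + ∫ _, (1 : ℝ) ∂circ :=
      (integral_add (hΦs.sub hr) (integrable_const (1 : ℝ))).trans (by rw [← integral_sub hΦs hr]; rfl)
    rw [e, integral_const_mul, hre, integral_const, circ_univ]
    have h2 : ∫ t, ‖Φ t‖ ^ 2 ∂circ ≤ 2 * Real.pi * c := by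
      calc ∫ t, ‖Φ t‖ ^ 2 ∂circ ≤ ∫ t, c ∂circ := integral_mono_ae hΦs (integrable_const _) hsqle
        _ = 2 * Real.pi * c := by rw [integral_const, circ_univ, smul_eq_mul]
    rw [smul_eq_mul]
    linarith
  · intro η hη
    obtain ⟨p, hp, hpη⟩ := exists_trigSpan_of_mem_expoSpan hΦm hη
    refine ⟨p, hp, ?_⟩
    rw [integral_weighted hu h0] at hpη
    simpa only [smul_eq_mul, mul_comm] using hpη

end RobustFilter

namespace RobustFilter

/-! ### Hermitian forms and square roots of matrices -/

section Sqrt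

open scoped Matrix.Norms.L2Operator MatrixOrder

variable {T : ℕ}

/-- The nonnegative square root of a nonnegative definite matrix. -/
noncomputable def matSqrt (W : Matrix (Fin T) (Fin T) ℂ) : Matrix (Fin T) (Fin T) ℂ := CFC.sqrt W

theorem matSqrt_mul_self {W : Matrix (Fin T) (Fin T) ℂ} (h : W.PosSemidef) :
    matSqrt W * matSqrt W = W := CFC.sqrt_mul_sqrt_self W h.nonneg

theorem posSemidef_matSqrt (W : Matrix (Fin T) (Fin T) ℂ) : (matSqrt W).PosSemidef :=
  (CFC.sqrt_nonneg W).posSemidef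

theorem matSqrt_self_mul {W : Matrix (Fin T) (Fin T) ℂ} (h : W.PosSemidef) :
    matSqrt (W * W) = W := CFC.sqrt_mul_self W h.nonneg

theorem continuousOn_matSqrt : ContinuousOn (matSqrt (T := T)) {W | W.PosSemidef} := by
  have := CFC.continuousOn_sqrt (A := Matrix (Fin T) (Fin T) ℂ)
  simp only [Matrix.nonneg_iff_posSemidef] at this
  exact this

end Sqrt

variable {T : ℕ}

/-- The matrix square root of a measurable density is measurable. -/
theorem aestronglyMeasurable_matSqrt {μ : Measure ℝ} {W : ℝ → Matrix (Fin T) (Fin T) ℂ}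
    (hW : ∀ i j, AEStronglyMeasurable (fun t => W t i j) μ) (hpos : ∀ᵐ t ∂μ, (W t).PosSemidef)
    (i j : Fin T) : AEStronglyMeasurable (fun t => matSqrt (W t) i j) μ := by
  have hWm : AEStronglyMeasurable (β := Fin T → Fin T → ℂ) W μ :=
    (aemeasurable_pi_iff.2 fun i => aemeasurable_pi_iff.2 fun j =>
      (hW i j).aemeasurable).aestronglyMeasurable
  -- The square root is known to be continuous only on the nonnegative cone. The map sending `M` to
  -- the iterated square root of `Mᴴ M` is continuous everywhere and agrees with it on that cone.
  have h1 : Continuous fun M : Matrix (Fin T) (Fin T) ℂ => matSqrt (Mᴴ * M) :=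
    continuousOn_matSqrt.comp_continuous (by fun_prop)
      fun M => Matrix.posSemidef_conjTranspose_mul_self M
  have h2 : Continuous fun M : Matrix (Fin T) (Fin T) ℂ => matSqrt (matSqrt (Mᴴ * M)) :=
    continuousOn_matSqrt.comp_continuous h1 fun M => posSemidef_matSqrt _
  have h3 : Continuous fun M : Matrix (Fin T) (Fin T) ℂ => matSqrt (matSqrt (Mᴴ * M)) i j := by
    fun_prop
  have h4 : AEStronglyMeasurable (fun t => matSqrt (matSqrt ((W t)ᴴ * W t)) i j) μ :=
    h3.comp_aestronglyMeasurable hWm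
  refine h4.congr ?_
  filter_upwards [hpos] with t ht
  rw [ht.1, matSqrt_self_mul ht]

/-- The squared Euclidean norm. -/
noncomputable def normSqVec (v : Fin T → ℂ) : ℝ := ∑ i, ‖v i‖ ^ 2

theorem normSqVec_nonneg (v : Fin T → ℂ) : 0 ≤ normSqVec v :=
  Finset.sum_nonneg fun _ _ => sq_nonneg _

theorem dotProduct_star_self (v : Fin T → ℂ) : v ⬝ᵥ star v = (normSqVec v : ℂ) := by
  simp only [dotProduct, normSqVec, Pi.star_apply, RCLike.star_def, RCLike.mul_conj]
  push_cast
  rfl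

theorem normSqVec_eq (v : Fin T → ℂ) : normSqVec v = ‖(WithLp.toLp 2 v : EuclideanSpace ℂ (Fin T))‖ ^ 2 := by
  rw [EuclideanSpace.norm_sq_eq]; rfl

theorem normSqVec_add_le (u v : Fin T → ℂ) {δ : ℝ} (hδ : 0 < δ) :
    normSqVec (u + v) ≤ (1 + δ) * normSqVec u + (1 + δ⁻¹) * normSqVec v := by
  simp only [normSqVec, Finset.mul_sum, ← Finset.sum_add_distrib]
  refine Finset.sum_le_sum fun i _ => ?_
  have h1 : ‖(u + v) i‖ ^ 2 ≤ (‖u i‖ + ‖v i‖) ^ 2 := by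
    gcongr; exact norm_add_le _ _
  refine h1.trans ?_
  have h2 : 0 ≤ δ⁻¹ * (δ * ‖u i‖ - ‖v i‖) ^ 2 := by positivity
  have h3 : δ⁻¹ * (δ * ‖u i‖ - ‖v i‖) ^ 2 =
      δ * ‖u i‖ ^ 2 - 2 * ‖u i‖ * ‖v i‖ + δ⁻¹ * ‖v i‖ ^ 2 := by
    field_simp
    ring
  nlinarith

theorem normSqVec_vecMul_le (M : Matrix (Fin T) (Fin T) ℂ) (v : Fin T → ℂ) :
    normSqVec (v ᵥ* M) ≤ (∑ i, ∑ j, ‖M i j‖ ^ 2) * normSqVec v := by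
  rw [Finset.sum_comm, Finset.sum_mul]
  refine Finset.sum_le_sum fun j _ => ?_
  have h1 : ‖(v ᵥ* M) j‖ ≤ ∑ i, ‖v i‖ * ‖M i j‖ := by
    simp only [vecMul, dotProduct]
    refine (norm_sum_le _ _).trans (le_of_eq ?_)
    simp
  calc ‖(v ᵥ* M) j‖ ^ 2 ≤ (∑ i, ‖v i‖ * ‖M i j‖) ^ 2 := by gcongr
    _ ≤ (∑ i, ‖v i‖ ^ 2) * ∑ i, ‖M i j‖ ^ 2 := Finset.sum_mul_sq_le_sq_mul_sq _ _ _
    _ = _ := by rw [mul_comm]; rfl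

theorem herm_mul_conjTranspose (L : Matrix (Fin T) (Fin T) ℂ) (v : Fin T → ℂ) :
    herm (L * Lᴴ) v = normSqVec (v ᵥ* L) := by
  rw [herm, ← mulVec_mulVec, dotProduct_mulVec, ← star_vecMul, dotProduct_star_self,
    Complex.ofReal_re]

theorem herm_eq_normSqVec {W : Matrix (Fin T) (Fin T) ℂ} (hW : W.PosSemidef) (v : Fin T → ℂ) :
    herm W v = normSqVec (v ᵥ* matSqrt W) := by
  rw [← herm_mul_conjTranspose, (posSemidef_matSqrt W).1, matSqrt_mul_self hW]

theorem herm_nonneg {W : Matrix (Fin T) (Fin T) ℂ} (hW : W.PosSemidef) (v : Fin T → ℂ) :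
    0 ≤ herm W v := by
  rw [herm_eq_normSqVec hW]; exact normSqVec_nonneg _

theorem herm_add_le {W : Matrix (Fin T) (Fin T) ℂ} (hW : W.PosSemidef) (u v : Fin T → ℂ) {δ : ℝ}
    (hδ : 0 < δ) : herm W (u + v) ≤ (1 + δ) * herm W u + (1 + δ⁻¹) * herm W v := by
  simp only [herm_eq_normSqVec hW, add_vecMul]
  exact normSqVec_add_le _ _ hδ

theorem herm_smul (W : Matrix (Fin T) (Fin T) ℂ) (z : ℂ) (v : Fin T → ℂ) :
    herm W (z • v) = ‖z‖ ^ 2 * herm W v := by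
  rw [herm, herm, star_smul, mulVec_smul, smul_dotProduct, dotProduct_smul, smul_smul,
    RCLike.star_def, RCLike.mul_conj, smul_eq_mul]
  norm_cast
  exact Complex.re_ofReal_mul _ _

theorem herm_neg (W : Matrix (Fin T) (Fin T) ℂ) (v : Fin T → ℂ) : herm W (-v) = herm W v := by
  have := herm_smul W (-1) v
  simpa using this

theorem herm_add_left (V W : Matrix (Fin T) (Fin T) ℂ) (v : Fin T → ℂ) :
    herm (V + W) v = herm V v + herm W v := by
  simp [herm, add_mulVec, dotProduct_add]

theorem herm_smul_left (r : ℝ) (W : Matrix (Fin T) (Fin T) ℂ) (v : Fin T → ℂ) :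
    herm (r • W) v = r * herm W v := by
  simp [herm, smul_mulVec]

theorem trace_mul_conjTranspose (L : Matrix (Fin T) (Fin T) ℂ) :
    (L * Lᴴ).trace.re = ∑ i, ∑ j, ‖L i j‖ ^ 2 := by
  simp only [trace, diag_apply, mul_apply, conjTranspose_apply, Complex.re_sum]
  refine Finset.sum_congr rfl fun i _ => Finset.sum_congr rfl fun j _ => ?_
  rw [RCLike.star_def, RCLike.mul_conj]
  norm_cast

/-- The trace of `W` is the squared Hilbert–Schmidt norm of its square root. This bounds the form by
a scalar weight that is integrable when the entries of `W` are. -/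
theorem herm_le_trace {W : Matrix (Fin T) (Fin T) ℂ} (hW : W.PosSemidef) (v : Fin T → ℂ) :
    herm W v ≤ W.trace.re * normSqVec v := by
  have h := matSqrt_mul_self hW
  have h' := (posSemidef_matSqrt W).1
  have := trace_mul_conjTranspose (matSqrt W)
  rw [h', h] at this
  rw [this, herm_eq_normSqVec hW]
  exact normSqVec_vecMul_le _ _

theorem trace_re_nonneg {W : Matrix (Fin T) (Fin T) ℂ} (hW : W.PosSemidef) : 0 ≤ W.trace.re :=
  (Complex.le_def.1 hW.trace_nonneg).1

theorem isUnit_matSqrt {W : Matrix (Fin T) (Fin T) ℂ} (hW : W.PosSemidef) (hu : IsUnit W.det) :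
    IsUnit (matSqrt W).det := by
  have h := matSqrt_mul_self hW
  rw [← h, det_mul] at hu
  exact isUnit_of_mul_isUnit_left hu

theorem inv_eq_matSqrt {W : Matrix (Fin T) (Fin T) ℂ} (hW : W.PosSemidef) :
    W⁻¹ = (matSqrt W)⁻¹ * (matSqrt W)⁻¹ := by
  conv_lhs => rw [← matSqrt_mul_self hW, Matrix.mul_inv_rev]

theorem isHermitian_inv_matSqrt (W : Matrix (Fin T) (Fin T) ℂ) : ((matSqrt W)⁻¹).IsHermitian :=
  (posSemidef_matSqrt W).1.inv

theorem herm_inv {W : Matrix (Fin T) (Fin T) ℂ} (hW : W.PosSemidef) (v : Fin T → ℂ) :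
    herm W⁻¹ v = normSqVec (v ᵥ* (matSqrt W)⁻¹) := by
  rw [← herm_mul_conjTranspose, (isHermitian_inv_matSqrt W).eq, ← inv_eq_matSqrt hW]

/-- The Euclidean norm is controlled by a nondegenerate form and the trace of its inverse. -/
theorem normSqVec_le_trace_inv {W : Matrix (Fin T) (Fin T) ℂ} (hW : W.PosSemidef)
    (hu : IsUnit W.det) (v : Fin T → ℂ) : normSqVec v ≤ W⁻¹.trace.re * herm W v := by
  have h1 := herm_le_trace hW.inv (v ᵥ* matSqrt W)
  rwa [herm_inv hW, vecMul_vecMul, mul_nonsing_inv _ (isUnit_matSqrt hW hu), vecMul_one,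
    ← herm_eq_normSqVec hW] at h1

theorem aestronglyMeasurable_herm {μ : Measure ℝ} {W : ℝ → Matrix (Fin T) (Fin T) ℂ}
    {h : ℝ → Fin T → ℂ} (hW : ∀ i j, AEStronglyMeasurable (fun t => W t i j) μ)
    (hh : ∀ i, AEStronglyMeasurable (fun t => h t i) μ) :
    AEStronglyMeasurable (fun t => herm (W t) (h t)) μ := by
  have : ∀ t, herm (W t) (h t) = (∑ i, h t i * ∑ j, W t i j * star (h t j)).re := by
    intro t; simp [herm, dotProduct, mulVec]
  simp only [this]
  refine Complex.continuous_re.comp_aestronglyMeasurable ?_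
  refine Finset.aestronglyMeasurable_fun_sum _ fun i _ => (hh i).mul ?_
  refine Finset.aestronglyMeasurable_fun_sum _ fun j _ => (hW i j).mul ?_
  exact continuous_star.comp_aestronglyMeasurable (hh j)

theorem integrable_trace {μ : Measure ℝ} {W : ℝ → Matrix (Fin T) (Fin T) ℂ}
    (hW : ∀ i j, Integrable (fun t => W t i j) μ) :
    Integrable (fun t => (W t).trace.re) μ := by
  have : Integrable (fun t => ∑ i, W t i i) μ := integrable_finsetSum _ fun i _ => hW i i
  exact this.re

end RobustFilter

namespace RobustFilter

/-! ### Approximation by analytic polynomials in weighted spaces -/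

theorem integrable_mul_of_mem_trigSpan {V : Set ℤ} {q f : ℝ → ℂ} (hq : q ∈ trigSpan V)
    (hf : Integrable f circ) : Integrable (fun t => q t * f t) circ := by
  obtain ⟨C, -, hC⟩ := bounded_of_mem_trigSpan hq
  exact hf.bdd_mul (c := C) (continuous_of_mem_trigSpan hq).aestronglyMeasurable (ae_of_all _ hC)

theorem integral_mul_trigSpan_eq_zero {q f : ℝ → ℂ} (hq : q ∈ trigSpan {n | 0 ≤ n})
    (hf : Integrable f circ) (hs : ∀ n : ℤ, n < 0 → ∫ t, f t * expo (-n) t ∂circ = 0)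
    {n : ℤ} (hn : n < 0) : ∫ t, q t * f t * expo (-n) t ∂circ = 0 := by
  induction hq using Submodule.span_induction with
  | mem x h =>
    obtain ⟨m, hm, rfl⟩ := h
    rw [← hs (n - m) (by have : (0 : ℤ) ≤ m := hm; omega)]
    congr 1; ext t
    rw [show -(n - m) = m + -n by ring, expo_add]
    ring
  | zero => simp
  | add x y hx hy h1 h2 =>
    simp only [Pi.add_apply, add_mul]
    rw [integral_add, h1, h2, add_zero]
    · exact integrable_mul_expo (integrable_mul_of_mem_trigSpan hx hf) _
    · exact integrable_mul_expo (integrable_mul_of_mem_trigSpan hy hf) _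
  | smul a x hx h =>
    simp only [Pi.smul_apply, smul_eq_mul, mul_assoc] at h ⊢
    rw [integral_const_mul, h, mul_zero]

/-! ### Multiplication by outer functions -/

section Outer

variable {u : ℝ → ℝ} {φ : ℝ → ℂ} {c : ℝ}

theorem integrable_normSq_sub_mul (hu : Integrable u circ) (h0 : ∀ t, 0 ≤ u t)
    (hφ : AEStronglyMeasurable φ circ) (hmod : ∀ᵐ t ∂circ, ‖φ t‖ ^ 2 * (1 + u t) = c)
    {V : Set ℤ} {p : ℝ → ℂ} (hp : p ∈ trigSpan V) :
    Integrable (fun t => ‖φ t - p t‖ ^ 2 * (1 + u t)) circ := by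
  obtain ⟨C, hC0, hC⟩ := bounded_of_mem_trigSpan hp
  have hω : Integrable (fun t => 1 + u t) circ := (integrable_const _).add hu
  refine Integrable.mono' ((integrable_const (2 * c)).add (hω.const_mul (2 * C ^ 2)))
    ((((hφ.sub (continuous_of_mem_trigSpan hp).aestronglyMeasurable).norm).pow 2).mul hω.1) ?_
  filter_upwards [hmod] with t ht
  have hpos : 0 ≤ 1 + u t := by linarith [h0 t]
  rw [Real.norm_of_nonneg (by positivity)]
  have h1 : ‖φ t - p t‖ ^ 2 ≤ 2 * ‖φ t‖ ^ 2 + 2 * C ^ 2 := by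
    have h2 : ‖φ t - p t‖ ≤ ‖φ t‖ + C := (norm_sub_le _ _).trans (by gcongr; exact hC t)
    have h3 : ‖φ t - p t‖ ^ 2 ≤ (‖φ t‖ + C) ^ 2 := by gcongr
    nlinarith [sq_nonneg (‖φ t‖ - C)]
  simp only [Pi.add_apply]
  nlinarith [mul_le_mul_of_nonneg_right h1 hpos]

theorem modulus_const_nonneg (h0 : ∀ t, 0 ≤ u t)
    (hmod : ∀ᵐ t ∂circ, ‖φ t‖ ^ 2 * (1 + u t) = c) : 0 ≤ c := by
  have : NeBot (ae circ) := by
    rw [ae_neBot]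
    intro h
    have := circ_univ
    rw [h] at this
    simp [Real.pi_ne_zero] at this
  obtain ⟨t, ht⟩ := hmod.exists
  rw [← ht]
  have := h0 t
  positivity

/-- Multiplication by the square of an outer function makes an analytic function bounded and
keeps it analytic. -/
theorem integral_outer_sq_mul_eq_zero (hu : Integrable u circ) (h0 : ∀ t, 0 ≤ u t)
    (hφ : AEStronglyMeasurable φ circ) (hmod : ∀ᵐ t ∂circ, ‖φ t‖ ^ 2 * (1 + u t) = c)
    (happ : ∀ η : ℝ, 0 < η → ∃ p ∈ trigSpan {n | 0 ≤ n},
        ∫ t, ‖φ t - p t‖ ^ 2 * (1 + u t) ∂circ < η)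
    {f : ℝ → ℂ} (hf : Integrable f circ) {K : ℝ} (hK : 0 ≤ K) (hfK : ∀ᵐ t ∂circ, ‖f t‖ ≤ K * u t)
    (hs : ∀ n : ℤ, n < 0 → ∫ t, f t * expo (-n) t ∂circ = 0) {n : ℤ} (hn : n < 0) :
    ∫ t, φ t ^ 2 * f t * expo (-n) t ∂circ = 0 := by
  have hc := modulus_const_nonneg h0 hmod
  have hbd : ∀ᵐ t ∂circ, ‖φ t ^ 2 * f t * expo (-n) t‖ ≤ K * c := by
    filter_upwards [hmod, hfK] with t h1 h2
    rw [norm_mul, norm_mul, norm_pow, norm_expo, mul_one, ← h1]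
    calc ‖φ t‖ ^ 2 * ‖f t‖ ≤ ‖φ t‖ ^ 2 * (K * u t) := by gcongr
      _ ≤ K * (‖φ t‖ ^ 2 * (1 + u t)) := by nlinarith [mul_nonneg hK (sq_nonneg ‖φ t‖)]
  have hint : Integrable (fun t => φ t ^ 2 * f t * expo (-n) t) circ :=
    Integrable.of_bound (((hφ.pow 2).mul hf.1).mul (continuous_expo _).aestronglyMeasurable) _ hbd
  have hω : Integrable (fun t => 1 + u t) circ := (integrable_const _).add hu
  -- The integral vanishes with `p²` in place of `φ²`. The difference factors as `(φ - p)(2φ - (φ -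
  -- p)) f`, and the cross term is split by `2xy ≤ s x² + y²/s`; tolerance `1/s²` for `p` makes the
  -- total of order `1/s`.
  have key : ∀ s : ℝ, 1 ≤ s → ‖∫ t, φ t ^ 2 * f t * expo (-n) t ∂circ‖ ≤
      K * (2 + 2 * Real.pi * c) / s := by
    intro s hs1
    have hs0 : 0 < s := by linarith
    obtain ⟨p, hp, hpη⟩ := happ (1 / s ^ 2) (by positivity)
    have hpp := integral_mul_trigSpan_eq_zero (mul_mem_trigSpan hp hp) hf hs hn
    have hip : Integrable (fun t => (p * p) t * f t * expo (-n) t) circ :=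
      integrable_mul_expo (integrable_mul_of_mem_trigSpan (mul_mem_trigSpan hp hp) hf) _
    have e : ∫ t, φ t ^ 2 * f t * expo (-n) t ∂circ =
        ∫ t, (φ t ^ 2 * f t * expo (-n) t - (p * p) t * f t * expo (-n) t) ∂circ := by
      rw [integral_sub hint hip, hpp, sub_zero]
    have hd := integrable_normSq_sub_mul hu h0 hφ hmod hp
    rw [e]
    refine (norm_integral_le_of_norm_le (g := fun t => K * ((1 + s) *
      (‖φ t - p t‖ ^ 2 * (1 + u t)) + s⁻¹ * c)) ?_ ?_).trans ?_
    · exact ((hd.const_mul _).add (integrable_const _)).const_mul _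
    · filter_upwards [hmod, hfK] with t h1 h2
      have hpos : 0 ≤ 1 + u t := by linarith [h0 t]
      have h3 : φ t ^ 2 * f t * expo (-n) t - (p * p) t * f t * expo (-n) t =
          (φ t - p t) * (2 * φ t - (φ t - p t)) * f t * expo (-n) t := by
        simp only [Pi.mul_apply]; ring
      rw [h3, norm_mul, norm_mul, norm_mul, norm_expo, mul_one]
      set A := ‖φ t - p t‖ with hA
      have hA0 : 0 ≤ A := norm_nonneg _
      have h4 : ‖2 * φ t - (φ t - p t)‖ ≤ 2 * ‖φ t‖ + A := by
        refine (norm_sub_le _ _).trans ?_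
        simp [hA]
      have h5 : A * ‖2 * φ t - (φ t - p t)‖ ≤ (1 + s) * A ^ 2 + s⁻¹ * ‖φ t‖ ^ 2 := by
        have h6 : 0 ≤ s⁻¹ * (s * A - ‖φ t‖) ^ 2 := by positivity
        have h7 : s⁻¹ * (s * A - ‖φ t‖) ^ 2 = s * A ^ 2 - 2 * A * ‖φ t‖ + s⁻¹ * ‖φ t‖ ^ 2 := by
          field_simp; ring
        nlinarith [mul_le_mul_of_nonneg_left h4 hA0]
      calc A * ‖2 * φ t - (φ t - p t)‖ * ‖f t‖
          ≤ ((1 + s) * A ^ 2 + s⁻¹ * ‖φ t‖ ^ 2) * (K * (1 + u t)) := by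
            gcongr
            exact h2.trans (by gcongr; linarith)
        _ = K * ((1 + s) * (A ^ 2 * (1 + u t)) + s⁻¹ * c) := by rw [← h1]; ring
    · rw [integral_const_mul, integral_add (hd.const_mul _) (integrable_const _),
        integral_const_mul, integral_const, circ_univ, smul_eq_mul, mul_div_assoc]
      refine mul_le_mul_of_nonneg_left ?_ hK
      have h6 : (1 + s) * ∫ t, ‖φ t - p t‖ ^ 2 * (1 + u t) ∂circ ≤ (1 + s) * (1 / s ^ 2) := by
        gcongr
      have h7 : (1 + s) * (1 / s ^ 2) ≤ 2 / s := by
        rw [mul_one_div, div_le_div_iff₀ (by positivity) hs0]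
        nlinarith
      calc _ ≤ 2 / s + 2 * Real.pi * (s⁻¹ * c) := by linarith
        _ = _ := by field_simp
  by_contra hne
  have hpos := norm_pos_iff.2 hne
  set B := ‖∫ t, φ t ^ 2 * f t * expo (-n) t ∂circ‖ with hB
  set D := K * (2 + 2 * Real.pi * c) with hD
  have hD0 : 0 ≤ D := by positivity
  -- With this `s` the bound reads `B + D ≤ D`, impossible for `B > 0`.
  have := key (1 + D / B) (by have : 0 ≤ D / B := by positivity
                              linarith)
  rw [le_div_iff₀ (by positivity), mul_add, mul_one, mul_div_cancel₀ _ hpos.ne'] at this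
  linarith

/-- The product of an analytic function with the cube of an outer function is approximated by
analytic polynomials in the weighted space. -/
theorem exists_trigSpan_outer_cube (hu : Integrable u circ) (h0 : ∀ t, 0 ≤ u t)
    (hφ : AEStronglyMeasurable φ circ) (hmod : ∀ᵐ t ∂circ, ‖φ t‖ ^ 2 * (1 + u t) = c)
    (happ : ∀ η : ℝ, 0 < η → ∃ p ∈ trigSpan {n | 0 ≤ n},
        ∫ t, ‖φ t - p t‖ ^ 2 * (1 + u t) ∂circ < η)
    {f : ℝ → ℂ} (hf : Integrable f circ) {K : ℝ} (hK : 0 ≤ K) (hfK : ∀ᵐ t ∂circ, ‖f t‖ ≤ K * u t)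
    (hs : ∀ n : ℤ, n < 0 → ∫ t, f t * expo (-n) t ∂circ = 0) {η : ℝ} (hη : 0 < η) :
    ∃ p ∈ trigSpan {n | 0 ≤ n}, Integrable (fun t => ‖φ t ^ 3 * f t - p t‖ ^ 2 * (1 + u t)) circ ∧
      ∫ t, ‖φ t ^ 3 * f t - p t‖ ^ 2 * (1 + u t) ∂circ < η := by
  have hc := modulus_const_nonneg h0 hmod
  have hω : Integrable (fun t => 1 + u t) circ := (integrable_const _).add hu
  have hbd : ∀ᵐ t ∂circ, ‖φ t ^ 2 * f t‖ ≤ K * c := by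
    filter_upwards [hmod, hfK] with t h1 h2
    rw [norm_mul, norm_pow, ← h1]
    calc ‖φ t‖ ^ 2 * ‖f t‖ ≤ ‖φ t‖ ^ 2 * (K * u t) := by gcongr
      _ ≤ K * (‖φ t‖ ^ 2 * (1 + u t)) := by nlinarith [mul_nonneg hK (sq_nonneg ‖φ t‖)]
  have hψ : MemLp (fun t => φ t ^ 2 * f t) 2 circ :=
    MemLp.of_bound ((hφ.pow 2).mul hf.1) _ hbd
  have hmem : hψ.toLp ∈ expoSpan circ {n | 0 ≤ n} := by
    refine mem_expoSpan_of_fourier fun n hn => ?_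
    rw [← integral_outer_sq_mul_eq_zero hu h0 hφ hmod happ hf hK hfK hs (n := n)
      (by simpa using hn)]
    refine integral_congr_ae ?_
    filter_upwards [hψ.coeFn_toLp] with t ht
    rw [ht]
  -- `φ² f` is bounded and analytic, so it is approximated by `s` in the unweighted space. Only
  -- afterwards is `p ≈ φ` chosen, since its tolerance depends on the sup bound `S` of `s`.
  obtain ⟨s, hsV, hsη⟩ := exists_trigSpan_of_mem_expoSpan hmem (η := η / (4 * (c + 1)))
    (by positivity)
  obtain ⟨S, hS0, hS⟩ := bounded_of_mem_trigSpan hsV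
  obtain ⟨p, hp, hpη⟩ := happ (η / (4 * (S ^ 2 + 1))) (by positivity)
  have hd := integrable_normSq_sub_mul hu h0 hφ hmod hp
  have hs2 : Integrable (fun t => ‖φ t ^ 2 * f t - s t‖ ^ 2) circ := by
    have : MemLp (fun t => φ t ^ 2 * f t - s t) 2 circ := hψ.sub
      (MemLp.of_bound (continuous_of_mem_trigSpan hsV).aestronglyMeasurable S (ae_of_all _ hS))
    exact this.norm.integrable_sq
  have hs3 : ∫ t, ‖φ t ^ 2 * f t - s t‖ ^ 2 ∂circ < η / (4 * (c + 1)) := by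
    refine lt_of_eq_of_lt (integral_congr_ae ?_) hsη
    filter_upwards [hψ.coeFn_toLp] with t ht
    rw [ht]
  have hbound : ∀ᵐ t ∂circ, ‖φ t ^ 3 * f t - (p * s) t‖ ^ 2 * (1 + u t) ≤
      2 * c * ‖φ t ^ 2 * f t - s t‖ ^ 2 + 2 * S ^ 2 * (‖φ t - p t‖ ^ 2 * (1 + u t)) := by
    filter_upwards [hmod] with t h1
    have hpos : 0 ≤ 1 + u t := by linarith [h0 t]
    -- In the first summand `|φ|²` cancels the weight up to the constant `c`; the second uses that
    -- `p` approximates `φ` in the weighted norm.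
    have h2 : φ t ^ 3 * f t - (p * s) t =
        φ t * (φ t ^ 2 * f t - s t) + (φ t - p t) * s t := by
      simp only [Pi.mul_apply]; ring
    have h3 : ‖φ t ^ 3 * f t - (p * s) t‖ ≤
        ‖φ t‖ * ‖φ t ^ 2 * f t - s t‖ + ‖φ t - p t‖ * S := by
      rw [h2]
      refine (norm_add_le _ _).trans ?_
      rw [norm_mul, norm_mul]
      gcongr
      exact hS t
    have h4 : ‖φ t ^ 3 * f t - (p * s) t‖ ^ 2 ≤
        2 * (‖φ t‖ ^ 2 * ‖φ t ^ 2 * f t - s t‖ ^ 2) + 2 * (‖φ t - p t‖ ^ 2 * S ^ 2) := by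
      have h5 : ‖φ t ^ 3 * f t - (p * s) t‖ ^ 2 ≤
        (‖φ t‖ * ‖φ t ^ 2 * f t - s t‖ + ‖φ t - p t‖ * S) ^ 2 := by gcongr
      refine h5.trans ?_
      nlinarith [sq_nonneg (‖φ t‖ * ‖φ t ^ 2 * f t - s t‖ - ‖φ t - p t‖ * S)]
    refine (mul_le_mul_of_nonneg_right h4 hpos).trans (le_of_eq ?_)
    rw [← h1]; ring
  have hmaj : Integrable (fun t => 2 * c * ‖φ t ^ 2 * f t - s t‖ ^ 2 +
      2 * S ^ 2 * (‖φ t - p t‖ ^ 2 * (1 + u t))) circ :=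
    (hs2.const_mul _).add (hd.const_mul _)
  have hps := mul_mem_trigSpan hp hsV
  have hint : Integrable (fun t => ‖φ t ^ 3 * f t - (p * s) t‖ ^ 2 * (1 + u t)) circ := by
    refine hmaj.mono' (((((hφ.pow 3).mul hf.1).sub
      (continuous_of_mem_trigSpan hps).aestronglyMeasurable).norm.pow 2).mul hω.1) ?_
    filter_upwards [hbound] with t ht
    have hpos : 0 ≤ 1 + u t := by linarith [h0 t]
    rwa [Real.norm_of_nonneg (by positivity)]
  refine ⟨p * s, hps, hint, ?_⟩
  calc ∫ t, ‖φ t ^ 3 * f t - (p * s) t‖ ^ 2 * (1 + u t) ∂circ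
      ≤ ∫ t, (2 * c * ‖φ t ^ 2 * f t - s t‖ ^ 2 +
          2 * S ^ 2 * (‖φ t - p t‖ ^ 2 * (1 + u t))) ∂circ := integral_mono_ae hint hmaj hbound
    _ = 2 * c * ∫ t, ‖φ t ^ 2 * f t - s t‖ ^ 2 ∂circ +
          2 * S ^ 2 * ∫ t, ‖φ t - p t‖ ^ 2 * (1 + u t) ∂circ := by
        rw [integral_add (hs2.const_mul _) (hd.const_mul _), integral_const_mul,
          integral_const_mul]
    _ ≤ 2 * c * (η / (4 * (c + 1))) + 2 * S ^ 2 * (η / (4 * (S ^ 2 + 1))) := by gcongr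
    _ < η := by
        have h1 : 2 * c * (η / (4 * (c + 1))) < η / 2 := by
          rw [mul_div_assoc', div_lt_div_iff₀ (by positivity) (by positivity)]
          nlinarith
        have h2 : 2 * S ^ 2 * (η / (4 * (S ^ 2 + 1))) < η / 2 := by
          rw [mul_div_assoc', div_lt_div_iff₀ (by positivity) (by positivity)]
          nlinarith
        linarith

end Outer

end RobustFilter

namespace RobustFilter

variable {T : ℕ}

/-! ### Vector trigonometric polynomials -/

theorem trigPoly_eq_sum (x : ℤ →₀ (Fin T → ℂ)) (t : ℝ) :
    trigPoly x t = x.sum fun n v => expo n t • v := rfl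

@[simp]
theorem trigPoly_zero (t : ℝ) : trigPoly (0 : ℤ →₀ (Fin T → ℂ)) t = 0 := by simp [trigPoly]

theorem trigPoly_add (x y : ℤ →₀ (Fin T → ℂ)) (t : ℝ) :
    trigPoly (x + y) t = trigPoly x t + trigPoly y t := by
  simp only [trigPoly_eq_sum]
  exact Finsupp.sum_add_index' (by simp) (by simp)

theorem trigPoly_smul (z : ℂ) (x : ℤ →₀ (Fin T → ℂ)) (t : ℝ) :
    trigPoly (z • x) t = z • trigPoly x t := by
  simp only [trigPoly_eq_sum]
  rw [Finsupp.sum_smul_index' (by simp), Finsupp.smul_sum]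
  simp only [smul_comm z]

theorem trigPoly_single (n : ℤ) (v : Fin T → ℂ) (t : ℝ) :
    trigPoly (Finsupp.single n v) t = expo n t • v := by
  rw [trigPoly_eq_sum, Finsupp.sum_single_index (by simp)]

theorem continuous_trigPoly (x : ℤ →₀ (Fin T → ℂ)) : Continuous (trigPoly x) := by
  unfold trigPoly
  fun_prop

theorem support_add_subset {V : Set ℤ} {x y : ℤ →₀ (Fin T → ℂ)} (hx : (x.support : Set ℤ) ⊆ V)
    (hy : (y.support : Set ℤ) ⊆ V) : ((x + y).support : Set ℤ) ⊆ V := by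
  intro n hn
  rcases Finset.mem_union.1 (Finsupp.support_add hn) with h | h
  exacts [hx h, hy h]

theorem support_smul_subset {V : Set ℤ} {x : ℤ →₀ (Fin T → ℂ)} (z : ℂ)
    (hx : (x.support : Set ℤ) ⊆ V) : ((z • x).support : Set ℤ) ⊆ V :=
  fun _ hn => hx (Finsupp.support_smul hn)

theorem support_single_subset {V : Set ℤ} {n : ℤ} (hn : n ∈ V) (v : Fin T → ℂ) :
    ((Finsupp.single n v).support : Set ℤ) ⊆ V := by
  intro m hm
  have := Finsupp.support_single_subset hm
  rw [Finset.mem_singleton] at this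
  exact this ▸ hn

theorem exists_trigPoly_single {V : Set ℤ} {p : ℝ → ℂ} (hp : p ∈ trigSpan V) (i : Fin T) :
    ∃ x : ℤ →₀ (Fin T → ℂ), (x.support : Set ℤ) ⊆ V ∧ ∀ t, trigPoly x t = Pi.single i (p t) := by
  induction hp using Submodule.span_induction with
  | mem q h =>
    obtain ⟨n, hn, rfl⟩ := h
    refine ⟨Finsupp.single n (Pi.single i 1), support_single_subset hn _, fun t => ?_⟩
    rw [trigPoly_single, ← Pi.single_smul]; simp
  | zero => exact ⟨0, by simp, by simp⟩
  | add p q _ _ hp hq =>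
    obtain ⟨x, hx, hx'⟩ := hp
    obtain ⟨y, hy, hy'⟩ := hq
    refine ⟨x + y, support_add_subset hx hy, fun t => ?_⟩
    rw [trigPoly_add, hx', hy', Pi.add_apply, Pi.single_add]
  | smul a p _ hp =>
    obtain ⟨x, hx, hx'⟩ := hp
    refine ⟨a • x, support_smul_subset a hx, fun t => ?_⟩
    rw [trigPoly_smul, hx', Pi.smul_apply, Pi.single_smul]

theorem exists_trigPoly_of_trigSpan {V : Set ℤ} {p : Fin T → ℝ → ℂ} (hp : ∀ i, p i ∈ trigSpan V) :
    ∃ x : ℤ →₀ (Fin T → ℂ), (x.support : Set ℤ) ⊆ V ∧ ∀ t i, trigPoly x t i = p i t := by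
  have key : ∀ s : Finset (Fin T), ∃ x : ℤ →₀ (Fin T → ℂ), (x.support : Set ℤ) ⊆ V ∧
      ∀ t, trigPoly x t = ∑ i ∈ s, Pi.single i (p i t) := by
    intro s
    induction s using Finset.induction_on with
    | empty => exact ⟨0, by simp, by simp⟩
    | insert i s hi ih =>
      obtain ⟨x, hx, hx'⟩ := ih
      obtain ⟨y, hy, hy'⟩ := exists_trigPoly_single (hp i) i
      refine ⟨y + x, support_add_subset hy hx, fun t => ?_⟩
      rw [trigPoly_add, hx', hy', Finset.sum_insert hi]
  obtain ⟨x, hx, hx'⟩ := key Finset.univ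
  refine ⟨x, hx, fun t i => ?_⟩
  rw [hx', Finset.univ_sum_single (fun i => p i t)]

/-! ### Density of analytic polynomials -/

theorem exists_subseq_tendsto_ae {μ : Measure ℝ} {g : ℕ → ℝ → ℝ} (hg : ∀ k, Integrable (g k) μ)
    (h0 : ∀ k t, 0 ≤ g k t) (hlim : Tendsto (fun k => ∫ t, g k t ∂μ) atTop (𝓝 0)) :
    ∃ ns : ℕ → ℕ, StrictMono ns ∧ ∀ᵐ t ∂μ, Tendsto (fun k => g (ns k) t) atTop (𝓝 0) := by
  have h1 : TendstoInMeasure μ g atTop 0 := by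
    refine tendstoInMeasure_of_tendsto_eLpNorm (p := 1) one_ne_zero (fun k => (hg k).1)
      aestronglyMeasurable_zero ?_
    have h2 : ∀ k, eLpNorm (g k - 0) 1 μ = ENNReal.ofReal (∫ t, g k t ∂μ) := by
      intro k
      rw [sub_zero, eLpNorm_one_eq_lintegral_enorm, ofReal_integral_eq_lintegral_ofReal (hg k)
        (ae_of_all _ (h0 k))]
      congr 1; ext t
      rw [Real.enorm_eq_ofReal (h0 k t)]
    simp only [h2]
    simpa using ENNReal.tendsto_ofReal hlim
  exact h1.exists_seq_tendsto_ae

/-- An integrable analytic function with finite norm in a weighted space with integrable weight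
is a limit of analytic polynomials. -/
theorem exists_trigPoly_analytic {w : ℝ → Matrix (Fin T) (Fin T) ℂ}
    (hw : ∀ i j, Integrable (fun t => w t i j) circ) (hpos : ∀ᵐ t ∂circ, (w t).PosSemidef)
    {C : ℝ → Fin T → ℂ} (hC : ∀ i, Integrable (fun t => C t i) circ)
    (hCw : Integrable (fun t => herm (w t) (C t)) circ)
    (hs : ∀ i, ∀ n : ℤ, n < 0 → ∫ t, C t i * expo (-n) t ∂circ = 0) {η : ℝ} (hη : 0 < η) :
    ∃ x : ℤ →₀ (Fin T → ℂ), (x.support : Set ℤ) ⊆ {n | 0 ≤ n} ∧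
      ∫ t, herm (w t) (C t - trigPoly x t) ∂circ < η := by
  -- One scalar function controls both the size of `C` and the trace of the weight. Dividing it by
  -- `k + 1` makes the perturbation `1 + uk` of the constant weight tend to `1`, at the price of
  -- constants `k + 1` that are harmless once `k` is fixed.
  set u : ℝ → ℝ := fun t => ∑ i, ‖C t i‖ + |(w t).trace.re| with hu
  have hu0 : ∀ t, 0 ≤ u t := fun t =>
    add_nonneg (Finset.sum_nonneg fun _ _ => norm_nonneg _) (abs_nonneg _)
  have hui : Integrable u circ :=
    (integrable_finsetSum _ fun i _ => (hC i).norm).add (integrable_trace hw).abs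
  set uk : ℕ → ℝ → ℝ := fun k t => ((k : ℝ) + 1)⁻¹ * u t with huk
  have huki : ∀ k, Integrable (uk k) circ := fun k => hui.const_mul _
  have huk0 : ∀ k t, 0 ≤ uk k t := fun k t => mul_nonneg (by positivity) (hu0 t)
  have hu_uk : ∀ (k : ℕ) (t : ℝ), u t = ((k : ℝ) + 1) * uk k t := fun k t => by
    simp only [huk]
    rw [mul_inv_cancel_left₀ (by positivity)]
  choose φ c hφm hcle hmod hφ1 happ using fun k => exists_outer (huki k) (huk0 k)
  set D : ℝ := 1 + ∫ t, u t ∂circ with hD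
  have hI0 : 0 ≤ ∫ t, u t ∂circ := integral_nonneg hu0
  have hcD : ∀ k, c k ≤ D := by
    intro k
    have h1 : ∫ t, uk k t ∂circ ≤ ∫ t, u t ∂circ := by
      refine integral_mono (huki k) hui fun t => ?_
      simp only [huk]
      exact mul_le_of_le_one_left (hu0 t)
        (inv_le_one_of_one_le₀ (by linarith [(Nat.cast_nonneg k : (0 : ℝ) ≤ k)]))
    have h2 := hcle k
    -- Only `2π ≥ 1` is needed: it gives `c k ≤ 1 + (2π)⁻¹ ∫ u ≤ D`.
    have h3 := Real.pi_gt_three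
    have h4 : 2 * Real.pi * c k ≤ 2 * Real.pi * D := by
      rw [hD]; nlinarith
    exact le_of_mul_le_mul_left h4 (by positivity)
  have hφb : ∀ k, ∀ᵐ t ∂circ, ‖φ k t‖ ≤ D := by
    intro k
    filter_upwards [hmod k] with t ht
    have h1 : ‖φ k t‖ ^ 2 ≤ D ^ 2 := by
      calc ‖φ k t‖ ^ 2 ≤ ‖φ k t‖ ^ 2 * (1 + uk k t) :=
            le_mul_of_one_le_right (sq_nonneg _) (by linarith [huk0 k t])
        _ ≤ D := ht ▸ hcD k
        _ ≤ D ^ 2 := by nlinarith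
    exact (sq_le_sq₀ (norm_nonneg _) (by positivity)).1 h1
  have hφsq : ∀ k, Integrable (fun t => ‖φ k t - 1‖ ^ 2) circ := by
    intro k
    have : MemLp (fun t => φ k t - 1) 2 circ :=
      (MemLp.of_bound (hφm k) D (hφb k)).sub (memLp_const 1)
    exact this.norm.integrable_sq
  obtain ⟨ns, -, hns⟩ := exists_subseq_tendsto_ae hφsq (fun k t => sq_nonneg _) (by
    refine squeeze_zero (fun k => integral_nonneg fun t => sq_nonneg _) hφ1 ?_
    simp only [huk, integral_const_mul]
    simpa using (tendsto_one_div_add_atTop_nhds_zero_nat (𝕜 := ℝ)).mul_const (∫ t, u t ∂circ))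
  -- convergence of the regularized functions
  have hlim : Tendsto (fun k => ∫ t, ‖1 - φ (ns k) t ^ 3‖ ^ 2 * herm (w t) (C t) ∂circ) atTop
      (𝓝 (∫ _, (0 : ℝ) ∂circ)) := by
    refine tendsto_integral_of_dominated_convergence
      (fun t => (1 + D ^ 3) ^ 2 * herm (w t) (C t)) (fun k => ?_) (hCw.const_mul _)
      (fun k => ?_) ?_
    · exact (((aestronglyMeasurable_const.sub ((hφm _).pow 3)).norm).pow 2).mul hCw.1
    · filter_upwards [hφb (ns k), hpos] with t h1 h2
      rw [Real.norm_of_nonneg (mul_nonneg (sq_nonneg _) (herm_nonneg h2 _))]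
      refine mul_le_mul_of_nonneg_right ?_ (herm_nonneg h2 _)
      gcongr
      refine (norm_sub_le _ _).trans ?_
      rw [norm_one, norm_pow]
      gcongr
    · filter_upwards [hns] with t ht
      have h1 : Tendsto (fun k => φ (ns k) t) atTop (𝓝 1) := by
        rw [tendsto_iff_norm_sub_tendsto_zero]
        have := ht.sqrt
        simpa [Real.sqrt_sq (norm_nonneg _)] using this
      have h2 : Tendsto (fun k => ‖1 - φ (ns k) t ^ 3‖ ^ 2 * herm (w t) (C t)) atTop
          (𝓝 (‖1 - (1 : ℂ) ^ 3‖ ^ 2 * herm (w t) (C t))) :=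
        ((((h1.pow 3).const_sub 1).norm).pow 2).mul_const _
      simpa using h2
  rw [integral_zero] at hlim
  obtain ⟨m, hm⟩ := ((tendsto_order.1 hlim).2 (η / 4) (by positivity)).exists
  set k := ns m with hk
  have hCu : ∀ i, ∀ᵐ t ∂circ, ‖C t i‖ ≤ ((k : ℝ) + 1) * uk k t := by
    intro i
    refine ae_of_all _ fun t => ?_
    rw [← hu_uk]
    have := Finset.single_le_sum (f := fun i => ‖C t i‖) (fun i _ => norm_nonneg _)
      (Finset.mem_univ i)
    simp only [hu]
    linarith [abs_nonneg (w t).trace.re]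
  choose p hp hpi hpη using fun i => exists_trigSpan_outer_cube (huki k) (huk0 k) (hφm k) (hmod k)
    (happ k) (hC i) (by positivity) (hCu i) (hs i)
    (η := η / (4 * ((k : ℝ) + 1) * (T + 1))) (by positivity)
  obtain ⟨x, hx, hxp⟩ := exists_trigPoly_of_trigSpan hp
  refine ⟨x, hx, ?_⟩
  have hxm : ∀ i, AEStronglyMeasurable (fun t => trigPoly x t i) circ := fun i =>
    ((continuous_apply i).comp (continuous_trigPoly x)).aestronglyMeasurable
  have hbound : ∀ᵐ t ∂circ, herm (w t) (C t - trigPoly x t) ≤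
      2 * (‖1 - φ k t ^ 3‖ ^ 2 * herm (w t) (C t)) +
      2 * (((k : ℝ) + 1) * ∑ i, ‖φ k t ^ 3 * C t i - p i t‖ ^ 2 * (1 + uk k t)) := by
    filter_upwards [hpos] with t ht
    have e : C t - trigPoly x t = (1 - φ k t ^ 3) • C t + (φ k t ^ 3 • C t - trigPoly x t) := by
      rw [sub_smul, one_smul]; abel
    rw [e]
    refine (herm_add_le ht _ _ one_pos).trans ?_
    rw [herm_smul]
    have h1 := herm_le_trace ht (φ k t ^ 3 • C t - trigPoly x t)
    have h2 : (w t).trace.re ≤ ((k : ℝ) + 1) * (1 + uk k t) := by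
      have h3 : (w t).trace.re ≤ u t :=
        (le_abs_self _).trans (le_add_of_nonneg_left (Finset.sum_nonneg fun _ _ => norm_nonneg _))
      rw [hu_uk k] at h3
      have : (0 : ℝ) ≤ (k : ℝ) + 1 := by positivity
      nlinarith
    have h4 : normSqVec (φ k t ^ 3 • C t - trigPoly x t) = ∑ i, ‖φ k t ^ 3 * C t i - p i t‖ ^ 2 := by
      simp [normSqVec, hxp]
    have h5 := h1.trans (mul_le_mul_of_nonneg_right h2 (normSqVec_nonneg _))
    rw [h4] at h5
    rw [← Finset.sum_mul]
    have h6 : ((k : ℝ) + 1) * (1 + uk k t) * ∑ i, ‖φ k t ^ 3 * C t i - p i t‖ ^ 2 =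
      ((k : ℝ) + 1) * ((∑ i, ‖φ k t ^ 3 * C t i - p i t‖ ^ 2) * (1 + uk k t)) := by ring
    norm_num
    linarith
  have hi1 : Integrable (fun t => ‖1 - φ k t ^ 3‖ ^ 2 * herm (w t) (C t)) circ := by
    refine hCw.bdd_mul (c := (1 + D ^ 3) ^ 2)
      (((aestronglyMeasurable_const.sub ((hφm _).pow 3)).norm).pow 2) ?_
    filter_upwards [hφb k] with t h1
    rw [Real.norm_of_nonneg (sq_nonneg _)]
    gcongr
    refine (norm_sub_le _ _).trans ?_
    rw [norm_one, norm_pow]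
    gcongr
  have hi2 : Integrable (fun t => ∑ i, ‖φ k t ^ 3 * C t i - p i t‖ ^ 2 * (1 + uk k t)) circ :=
    integrable_finsetSum _ fun i _ => hpi i
  have hi3 : Integrable (fun t => 2 * (‖1 - φ k t ^ 3‖ ^ 2 * herm (w t) (C t)) +
      2 * (((k : ℝ) + 1) * ∑ i, ‖φ k t ^ 3 * C t i - p i t‖ ^ 2 * (1 + uk k t))) circ :=
    (hi1.const_mul 2).add ((hi2.const_mul _).const_mul 2)
  have hi4 : Integrable (fun t => herm (w t) (C t - trigPoly x t)) circ := by
    refine hi3.mono' (aestronglyMeasurable_herm (fun i j => (hw i j).1)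
      fun i => (hC i).1.sub (hxm i)) ?_
    filter_upwards [hbound, hpos] with t h1 h2
    rwa [Real.norm_of_nonneg (herm_nonneg h2 _)]
  calc ∫ t, herm (w t) (C t - trigPoly x t) ∂circ ≤ _ := integral_mono_ae hi4 hi3 hbound
    _ = 2 * ∫ t, ‖1 - φ k t ^ 3‖ ^ 2 * herm (w t) (C t) ∂circ +
        2 * (((k : ℝ) + 1) * ∑ i, ∫ t, ‖φ k t ^ 3 * C t i - p i t‖ ^ 2 * (1 + uk k t) ∂circ) := by
      rw [integral_add (hi1.const_mul 2) ((hi2.const_mul _).const_mul 2), integral_const_mul,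
        integral_const_mul, integral_const_mul, integral_finsetSum _ fun i _ => hpi i]
    _ ≤ 2 * ∫ t, ‖1 - φ k t ^ 3‖ ^ 2 * herm (w t) (C t) ∂circ +
        2 * (((k : ℝ) + 1) * ∑ _i : Fin T, η / (4 * ((k : ℝ) + 1) * (T + 1))) := by
      gcongr with i
      exact (hpη i).le
    _ < η := by
      rw [Finset.sum_const, Finset.card_univ, Fintype.card_fin, nsmul_eq_mul]
      have h1 : ((k : ℝ) + 1) * (T * (η / (4 * ((k : ℝ) + 1) * (T + 1)))) ≤ η / 4 := by
        have hk0 : (0 : ℝ) < (k : ℝ) + 1 := by positivity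
        have : ((k : ℝ) + 1) * (T * (η / (4 * ((k : ℝ) + 1) * (T + 1)))) =
            η / 4 * (T / (T + 1)) := by
          field_simp
        rw [this]
        refine mul_le_of_le_one_right (by positivity) ?_
        rw [div_le_one (by positivity)]
        linarith
      linarith

end RobustFilter

namespace RobustFilter

variable {T : ℕ}

/-! ### Fourier coefficients of vector functions -/

/-- The Fourier coefficient `(2π)⁻¹ ∫ Y(t) e^{-int} dt` of a vector function. -/
noncomputable def fourierVec (Y : ℝ → Fin T → ℂ) (n : ℤ) : Fin T → ℂ := fun i =>
  1 / (2 * (Real.pi : ℂ)) * ∫ t, Y t i * expo (-n) t ∂circ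

theorem two_pi_ne_zero : (2 * (Real.pi : ℂ)) ≠ 0 := by simp [Real.pi_ne_zero]

theorem fourierVec_eq_zero_iff {Y : ℝ → Fin T → ℂ} {n : ℤ} {i : Fin T} :
    fourierVec Y n i = 0 ↔ ∫ t, Y t i * expo (-n) t ∂circ = 0 := by
  simp [fourierVec, Real.pi_ne_zero]

theorem fourierVec_congr {Y Z : ℝ → Fin T → ℂ} (h : Y =ᵐ[circ] Z) : fourierVec Y = fourierVec Z := by
  ext n i
  rw [fourierVec, fourierVec, integral_congr_ae]
  filter_upwards [h] with t ht
  rw [ht]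

theorem fourierVec_sub {Y Z : ℝ → Fin T → ℂ} (hY : ∀ i, Integrable (fun t => Y t i) circ)
    (hZ : ∀ i, Integrable (fun t => Z t i) circ) :
    fourierVec (fun t => Y t - Z t) = fourierVec Y - fourierVec Z := by
  ext n i
  simp only [fourierVec, Pi.sub_apply, sub_mul]
  rw [integral_sub (integrable_mul_expo (hY i) _) (integrable_mul_expo (hZ i) _), mul_sub]

theorem ae_eq_of_fourierVec_eq {Y Z : ℝ → Fin T → ℂ} (hY : ∀ i, Integrable (fun t => Y t i) circ)
    (hZ : ∀ i, Integrable (fun t => Z t i) circ) (h : fourierVec Y = fourierVec Z) :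
    Y =ᵐ[circ] Z := by
  have h1 : ∀ i, ∀ᵐ t ∂circ, Y t i - Z t i = 0 := by
    intro i
    refine ae_eq_zero_of_fourier ((hY i).sub (hZ i)) fun n => ?_
    have h2 : fourierVec (fun t => Y t - Z t) (-n) i = 0 := by
      rw [fourierVec_sub hY hZ, h, sub_self]; rfl
    rw [fourierVec_eq_zero_iff, neg_neg] at h2
    exact h2
  filter_upwards [ae_all_iff.2 h1] with t ht
  ext i
  exact sub_eq_zero.1 (ht i)

theorem trigPoly_apply (x : ℤ →₀ (Fin T → ℂ)) (t : ℝ) (i : Fin T) :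
    trigPoly x t i = ∑ n ∈ x.support, x n i * expo n t := by
  simp [trigPoly, mul_comm]

theorem integrable_trigPoly (x : ℤ →₀ (Fin T → ℂ)) (i : Fin T) :
    Integrable (fun t => trigPoly x t i) circ := by
  simp only [trigPoly_apply]
  exact integrable_finsetSum _ fun n _ =>
    ((memLp_expo n 1 circ).integrable le_rfl).const_mul _

theorem fourierVec_trigPoly (x : ℤ →₀ (Fin T → ℂ)) : fourierVec (trigPoly x) = x := by
  ext n i
  simp only [fourierVec, trigPoly_apply, Finset.sum_mul, mul_assoc, ← expo_add]
  rw [integral_finsetSum _ fun m _ =>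
    (((memLp_expo (m + -n) 1 circ).integrable le_rfl).const_mul _)]
  simp only [integral_const_mul, integral_expo]
  rw [Finset.sum_eq_single n]
  · rw [if_pos (by ring)]
    field_simp [two_pi_ne_zero]
  · intro m _ hm
    rw [if_neg (by omega), mul_zero]
  · intro hn
    rw [Finsupp.notMem_support_iff.1 hn]; simp

theorem exists_bound_trigPoly (x : ℤ →₀ (Fin T → ℂ)) : ∃ B, ∀ t, normSqVec (trigPoly x t) ≤ B := by
  refine ⟨∑ i, (∑ n ∈ x.support, ‖x n i‖) ^ 2, fun t => Finset.sum_le_sum fun i _ => ?_⟩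
  gcongr
  rw [trigPoly_apply]
  refine (norm_sum_le _ _).trans (le_of_eq ?_)
  simp

theorem integrable_herm_of_bounded {w : ℝ → Matrix (Fin T) (Fin T) ℂ}
    (hw : ∀ i j, Integrable (fun t => w t i j) circ) (hpos : ∀ᵐ t ∂circ, (w t).PosSemidef)
    {h : ℝ → Fin T → ℂ} (hh : ∀ i, AEStronglyMeasurable (fun t => h t i) circ) {B : ℝ}
    (hB : ∀ t, normSqVec (h t) ≤ B) : Integrable (fun t => herm (w t) (h t)) circ := by
  refine ((integrable_trace hw).mul_const B).mono'
    (aestronglyMeasurable_herm (fun i j => (hw i j).1) hh) ?_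
  filter_upwards [hpos] with t ht
  rw [Real.norm_of_nonneg (herm_nonneg ht _)]
  exact (herm_le_trace ht _).trans (mul_le_mul_of_nonneg_left (hB t) (trace_re_nonneg ht))

theorem aestronglyMeasurable_trigPoly (x : ℤ →₀ (Fin T → ℂ)) (i : Fin T) :
    AEStronglyMeasurable (fun t => trigPoly x t i) circ := (integrable_trigPoly x i).1

theorem integrable_herm_trigPoly {w : ℝ → Matrix (Fin T) (Fin T) ℂ}
    (hw : ∀ i j, Integrable (fun t => w t i j) circ) (hpos : ∀ᵐ t ∂circ, (w t).PosSemidef)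
    (x : ℤ →₀ (Fin T → ℂ)) : Integrable (fun t => herm (w t) (trigPoly x t)) circ := by
  obtain ⟨B, hB⟩ := exists_bound_trigPoly x
  exact integrable_herm_of_bounded hw hpos (aestronglyMeasurable_trigPoly x) hB

theorem integrable_herm_sub {w : ℝ → Matrix (Fin T) (Fin T) ℂ}
    (hw : ∀ i j, AEStronglyMeasurable (fun t => w t i j) circ)
    (hpos : ∀ᵐ t ∂circ, (w t).PosSemidef)
    {g h : ℝ → Fin T → ℂ} (hg : ∀ i, AEStronglyMeasurable (fun t => g t i) circ)
    (hh : ∀ i, AEStronglyMeasurable (fun t => h t i) circ)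
    (hgi : Integrable (fun t => herm (w t) (g t)) circ)
    (hhi : Integrable (fun t => herm (w t) (h t)) circ) :
    Integrable (fun t => herm (w t) (g t - h t)) circ := by
  refine ((hgi.const_mul 2).add (hhi.const_mul 2)).mono'
    (aestronglyMeasurable_herm hw fun i => (hg i).sub (hh i)) ?_
  filter_upwards [hpos] with t ht
  rw [Real.norm_of_nonneg (herm_nonneg ht _), sub_eq_add_neg]
  refine (herm_add_le ht _ _ one_pos).trans (le_of_eq ?_)
  rw [herm_neg, Pi.add_apply]
  norm_num

/-- An integrable function whose spectrum lies in a set of frequencies that contains all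
nonnegative and only finitely many negative ones, and which has a finite norm in a weighted space
with integrable weight, is a limit of trigonometric polynomials with these frequencies. -/
theorem exists_trigPoly_of_spectrum {w : ℝ → Matrix (Fin T) (Fin T) ℂ}
    (hw : ∀ i j, Integrable (fun t => w t i j) circ) (hpos : ∀ᵐ t ∂circ, (w t).PosSemidef)
    {V : Set ℤ} (hV : {n : ℤ | 0 ≤ n} ⊆ V) (hfin : (V ∩ {n | n < 0}).Finite)
    {C : ℝ → Fin T → ℂ} (hC : ∀ i, Integrable (fun t => C t i) circ)
    (hCw : Integrable (fun t => herm (w t) (C t)) circ)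
    (hs : ∀ n ∉ V, fourierVec C n = 0) {η : ℝ} (hη : 0 < η) :
    ∃ x : ℤ →₀ (Fin T → ℂ), (x.support : Set ℤ) ⊆ V ∧
      ∫ t, herm (w t) (C t - trigPoly x t) ∂circ < η := by
  classical
  -- The finitely many terms of negative frequency; subtracting them from `C` leaves an analytic
  -- function.
  set x₀ : ℤ →₀ (Fin T → ℂ) := Finsupp.onFinset hfin.toFinset
    (fun n => if n ∈ V ∧ n < 0 then fourierVec C n else 0)
    (fun n hn => by
      rw [Set.Finite.mem_toFinset]
      by_contra h
      exact hn (if_neg h)) with hx₀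
  have hx₀V : (x₀.support : Set ℤ) ⊆ V := by
    intro n hn
    by_contra h
    rw [Finset.mem_coe, Finsupp.mem_support_iff] at hn
    exact hn (if_neg fun h' => h h'.1)
  obtain ⟨y, hy, hyη⟩ := exists_trigPoly_analytic hw hpos (C := fun t => C t - trigPoly x₀ t)
    (fun i => (hC i).sub (integrable_trigPoly x₀ i))
    (integrable_herm_sub (fun i j => (hw i j).1) hpos (fun i => (hC i).1)
      (aestronglyMeasurable_trigPoly x₀) hCw (integrable_herm_trigPoly hw hpos x₀))
    (fun i n hn => by
      rw [← fourierVec_eq_zero_iff (Y := fun t => C t - trigPoly x₀ t),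
        fourierVec_sub hC (integrable_trigPoly x₀), fourierVec_trigPoly]
      simp only [Pi.sub_apply]
      rw [sub_eq_zero]
      by_cases h : n ∈ V
      · rw [hx₀, Finsupp.onFinset_apply, if_pos ⟨h, hn⟩]
      · rw [hx₀, Finsupp.onFinset_apply, if_neg fun h' => h h'.1, hs n h]) hη
  refine ⟨x₀ + y, support_add_subset hx₀V (hy.trans hV), ?_⟩
  simpa only [trigPoly_add, sub_sub] using hyη

/-! ### Square integrable vector functions -/

/-- Square integrable vector functions. -/
def MemVec (y : ℝ → Fin T → ℂ) : Prop :=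
  (∀ i, AEStronglyMeasurable (fun t => y t i) circ) ∧ Integrable (fun t => normSqVec (y t)) circ

/-- The Hilbert space of square integrable vector functions. -/
noncomputable abbrev VecLp (T : ℕ) := Lp (EuclideanSpace ℂ (Fin T)) 2 circ

theorem MemVec.memLp {y : ℝ → Fin T → ℂ} (hy : MemVec y) :
    MemLp (fun t => (WithLp.toLp 2 (y t) : EuclideanSpace ℂ (Fin T))) 2 circ := by
  have hm : AEStronglyMeasurable
      (fun t => (WithLp.toLp 2 (y t) : EuclideanSpace ℂ (Fin T))) circ := by
    have h1 : AEStronglyMeasurable y circ :=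
      (aemeasurable_pi_iff.2 fun i => (hy.1 i).aemeasurable).aestronglyMeasurable
    exact (PiLp.continuous_toLp 2 _).comp_aestronglyMeasurable h1
  rw [memLp_two_iff_integrable_sq_norm hm]
  simpa only [← normSqVec_eq] using hy.2

theorem MemVec.sub {y z : ℝ → Fin T → ℂ} (hy : MemVec y) (hz : MemVec z) :
    MemVec fun t => y t - z t := by
  refine ⟨fun i => (hy.1 i).sub (hz.1 i), ?_⟩
  have := (hy.memLp.sub hz.memLp).norm.integrable_sq
  simp only [normSqVec_eq]
  exact this

/-- The class in `L²` of a square integrable vector function. -/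
noncomputable def MemVec.toH {y : ℝ → Fin T → ℂ} (hy : MemVec y) : VecLp T := hy.memLp.toLp

theorem memVec_coe (f : VecLp T) : MemVec fun t => (f t).ofLp := by
  refine ⟨fun i => ?_, ?_⟩
  · exact ((PiLp.continuous_apply 2 _ i)).comp_aestronglyMeasurable (Lp.aestronglyMeasurable f)
  · have := (Lp.memLp f).norm.integrable_sq
    simp only [normSqVec_eq]
    exact this

theorem toH_coe (f : VecLp T) : (memVec_coe f).toH = f := by
  refine Lp.ext ?_
  filter_upwards [(memVec_coe f).memLp.coeFn_toLp] with t ht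
  rw [MemVec.toH, ht]

theorem MemVec.toH_eq_iff {y z : ℝ → Fin T → ℂ} (hy : MemVec y) (hz : MemVec z) :
    hy.toH = hz.toH ↔ y =ᵐ[circ] z := by
  rw [MemVec.toH, MemVec.toH, MemLp.toLp_eq_toLp_iff]
  constructor
  · intro h
    filter_upwards [h] with t ht
    exact (WithLp.toLp_injective 2) ht
  · intro h
    filter_upwards [h] with t ht
    rw [ht]

theorem MemVec.toH_sub {y z : ℝ → Fin T → ℂ} (hy : MemVec y) (hz : MemVec z) :
    (hy.sub hz).toH = hy.toH - hz.toH := by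
  rw [MemVec.toH, MemVec.toH, MemVec.toH, ← MemLp.toLp_sub]
  rfl

theorem MemVec.norm_sq {y : ℝ → Fin T → ℂ} (hy : MemVec y) :
    ‖hy.toH‖ ^ 2 = ∫ t, normSqVec (y t) ∂circ := by
  rw [norm_sq_toLp]
  refine integral_congr_ae ?_
  filter_upwards [hy.memLp.coeFn_toLp] with t ht
  rw [MemVec.toH, ht, normSqVec_eq]

theorem MemVec.inner_eq {y z : ℝ → Fin T → ℂ} (hy : MemVec y) (hz : MemVec z) :
    inner ℂ hy.toH hz.toH = ∫ t, z t ⬝ᵥ star (y t) ∂circ := by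
  rw [L2.inner_def]
  refine integral_congr_ae ?_
  filter_upwards [hy.memLp.coeFn_toLp, hz.memLp.coeFn_toLp] with t h1 h2
  rw [MemVec.toH, MemVec.toH, h1, h2, EuclideanSpace.inner_toLp_toLp]

theorem MemVec.memLp_apply {y : ℝ → Fin T → ℂ} (hy : MemVec y) (i : Fin T) :
    MemLp (fun t => y t i) 2 circ := by
  rw [memLp_two_iff_integrable_sq_norm (hy.1 i)]
  refine hy.2.mono' ((hy.1 i).norm.pow 2) (ae_of_all _ fun t => ?_)
  rw [Real.norm_of_nonneg (sq_nonneg _)]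
  exact Finset.single_le_sum (f := fun i => ‖y t i‖ ^ 2) (fun i _ => sq_nonneg _)
    (Finset.mem_univ i)

theorem MemVec.integrable_vecMul {y : ℝ → Fin T → ℂ} (hy : MemVec y)
    {A : ℝ → Matrix (Fin T) (Fin T) ℂ} (hA : ∀ i j, MemLp (fun t => A t i j) 2 circ) (j : Fin T) :
    Integrable (fun t => (y t ᵥ* A t) j) circ := by
  simp only [vecMul, dotProduct]
  exact integrable_finsetSum _ fun i _ => (hy.memLp_apply i).integrable_mul (hA i j)

/-! ### Closed spans of weighted polynomials -/

section Poly

variable {A : ℝ → Matrix (Fin T) (Fin T) ℂ}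

theorem memVec_poly (hA : ∀ i j, MemLp (fun t => A t i j) 2 circ) (x : ℤ →₀ (Fin T → ℂ)) :
    MemVec fun t => trigPoly x t ᵥ* A t := by
  have hm : ∀ j, AEStronglyMeasurable (fun t => (trigPoly x t ᵥ* A t) j) circ := fun j => by
    simp only [vecMul, dotProduct]
    exact Finset.aestronglyMeasurable_fun_sum _ fun i _ =>
      (aestronglyMeasurable_trigPoly x i).mul (hA i j).1
  refine ⟨hm, ?_⟩
  obtain ⟨B, hB⟩ := exists_bound_trigPoly x
  have hi : Integrable (fun t => (∑ i, ∑ j, ‖A t i j‖ ^ 2) * B) circ :=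
    (integrable_finsetSum _ fun i _ => integrable_finsetSum _ fun j _ =>
      (hA i j).norm.integrable_sq).mul_const B
  refine hi.mono' ?_ (ae_of_all _ fun t => ?_)
  · unfold normSqVec
    exact Finset.aestronglyMeasurable_fun_sum _ fun i _ => (hm i).norm.pow 2
  · rw [Real.norm_of_nonneg (normSqVec_nonneg _)]
    refine (normSqVec_vecMul_le _ _).trans (mul_le_mul_of_nonneg_left (hB t) ?_)
    exact Finset.sum_nonneg fun i _ => Finset.sum_nonneg fun j _ => sq_nonneg _

/-- The map `x ↦ (∑ x(n) e^{int})ᵀ A(t)` to the Hilbert space of square integrable functions. -/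
noncomputable def polyLp (hA : ∀ i j, MemLp (fun t => A t i j) 2 circ) :
    (ℤ →₀ (Fin T → ℂ)) →ₗ[ℂ] VecLp T where
  toFun x := (memVec_poly hA x).toH
  map_add' x y := by
    rw [MemVec.toH, MemVec.toH, MemVec.toH, ← MemLp.toLp_add]
    congr 1; ext t i
    simp [trigPoly_add, add_vecMul]
  map_smul' z x := by
    rw [MemVec.toH, MemVec.toH, RingHom.id_apply, ← MemLp.toLp_const_smul]
    congr 1; ext t i
    simp [trigPoly_smul, smul_vecMul]

/-- The closed span of the functions `e^{int} δₖ A(t)`, `n ∈ V`. -/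
noncomputable def polyClosure (hA : ∀ i j, MemLp (fun t => A t i j) 2 circ) (V : Set ℤ) :
    Submodule ℂ (VecLp T) :=
  ((Finsupp.supported (Fin T → ℂ) ℂ V).map (polyLp hA)).topologicalClosure

instance (hA : ∀ i j, MemLp (fun t => A t i j) 2 circ) (V : Set ℤ) :
    CompleteSpace (polyClosure hA V) :=
  (Submodule.isClosed_topologicalClosure _).completeSpace_coe

theorem polyLp_mem (hA : ∀ i j, MemLp (fun t => A t i j) 2 circ) {V : Set ℤ}
    {x : ℤ →₀ (Fin T → ℂ)} (hx : (x.support : Set ℤ) ⊆ V) : polyLp hA x ∈ polyClosure hA V :=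
  Submodule.le_topologicalClosure _ ⟨x, hx, rfl⟩

theorem mem_polyClosure_iff (hA : ∀ i j, MemLp (fun t => A t i j) 2 circ) {V : Set ℤ}
    {f : VecLp T} : f ∈ polyClosure hA V ↔
      ∀ ε : ℝ, 0 < ε → ∃ x : ℤ →₀ (Fin T → ℂ), (x.support : Set ℤ) ⊆ V ∧
        ‖f - polyLp hA x‖ ^ 2 < ε := by
  have : f ∈ polyClosure hA V ↔
      f ∈ closure ((Finsupp.supported (Fin T → ℂ) ℂ V).map (polyLp hA) : Set (VecLp T)) := Iff.rfl
  rw [this, Metric.mem_closure_iff]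
  constructor
  · intro h ε hε
    obtain ⟨_, ⟨x, hx, rfl⟩, hd⟩ := h (Real.sqrt ε) (Real.sqrt_pos.2 hε)
    refine ⟨x, hx, ?_⟩
    rw [dist_eq_norm] at hd
    exact (Real.lt_sqrt (norm_nonneg _)).1 hd
  · intro h ε hε
    obtain ⟨x, hx, hd⟩ := h (ε ^ 2) (by positivity)
    refine ⟨_, ⟨x, hx, rfl⟩, ?_⟩
    rw [dist_eq_norm]
    exact lt_of_pow_lt_pow_left₀ 2 hε.le hd

/-- Moving `A` to the other side of the inner product leaves finitely many Fourier coefficients of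
`yᵀ Aᴴ`; the factor `2π` is their normalization. All operators on sequences are read off from this
identity. -/
theorem inner_polyLp (hA : ∀ i j, MemLp (fun t => A t i j) 2 circ) {y : ℝ → Fin T → ℂ}
    (hy : MemVec y) (x : ℤ →₀ (Fin T → ℂ)) :
    inner ℂ (polyLp hA x) hy.toH =
      2 * Real.pi * pairing (fourierVec fun t => y t ᵥ* (A t)ᴴ) x := by
  have hA' : ∀ i j, MemLp (fun t => (A t)ᴴ i j) 2 circ := fun i j => (hA j i).star
  have hY := hy.integrable_vecMul hA'
  change inner ℂ (memVec_poly hA x).toH hy.toH = _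
  rw [MemVec.inner_eq]
  have e : ∀ t, y t ⬝ᵥ star (trigPoly x t ᵥ* A t) =
      ∑ n ∈ x.support, ∑ i, (y t ᵥ* (A t)ᴴ) i * expo (-n) t * star (x n i) := by
    intro t
    rw [star_vecMul, dotProduct_mulVec, Finset.sum_comm]
    simp only [dotProduct, Pi.star_apply, trigPoly_apply, star_sum, star_mul', star_expo,
      Finset.mul_sum]
    refine Finset.sum_congr rfl fun i _ => Finset.sum_congr rfl fun n _ => ?_
    ring
  simp only [e]
  rw [integral_finsetSum _ fun n _ => integrable_finsetSum _ fun i _ =>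
    (integrable_mul_expo (hY i) _).mul_const _, pairing, Finset.mul_sum]
  refine Finset.sum_congr rfl fun n _ => ?_
  rw [integral_finsetSum _ fun i _ => (integrable_mul_expo (hY i) _).mul_const _, dotProduct,
    Finset.mul_sum]
  refine Finset.sum_congr rfl fun i _ => ?_
  rw [integral_mul_const, fourierVec, Pi.star_apply]
  field_simp [two_pi_ne_zero]

theorem pairing_single (r : ℤ → Fin T → ℂ) (n : ℤ) (v : Fin T → ℂ) :
    pairing r (Finsupp.single n v) = r n ⬝ᵥ star v := by
  by_cases hv : v = 0
  · subst hv; simp [pairing]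
  · rw [pairing, Finsupp.support_single _ hv]; simp

theorem mem_polyClosure_orthogonal_iff (hA : ∀ i j, MemLp (fun t => A t i j) 2 circ) {V : Set ℤ}
    {y : ℝ → Fin T → ℂ} (hy : MemVec y) : hy.toH ∈ (polyClosure hA V)ᗮ ↔
      ∀ n ∈ V, fourierVec (fun t => y t ᵥ* (A t)ᴴ) n = 0 := by
  rw [polyClosure, Submodule.orthogonal_closure, Submodule.mem_orthogonal]
  constructor
  · intro h n hn
    ext i
    have := h (polyLp hA (Finsupp.single n (Pi.single i 1)))
      ⟨_, support_single_subset hn _, rfl⟩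
    rw [inner_polyLp, pairing_single, mul_eq_zero, or_iff_right two_pi_ne_zero] at this
    rw [← Pi.single_star, star_one, dotProduct_single, mul_one] at this
    exact this
  · rintro h _ ⟨x, hx, rfl⟩
    rw [inner_polyLp, mul_eq_zero]
    right
    exact Finset.sum_eq_zero fun n hn => by rw [h n (hx hn), zero_dotProduct]

end Poly

end RobustFilter

namespace RobustFilter

variable {T : ℕ}

/-! ### The index sets -/

theorem finite_missing {s : ℕ} (M N : Fin s → ℕ) : (missing M N).Finite :=
  Set.finite_iUnion fun _ => Set.finite_Icc _ _

theorem nonneg_subset_unobserved {s : ℕ} (M N : Fin s → ℕ) :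
    {n : ℤ | 0 ≤ n} ⊆ unobserved M N := Set.subset_union_right

theorem finite_unobserved_neg {s : ℕ} (M N : Fin s → ℕ) :
    (unobserved M N ∩ {n | n < 0}).Finite := by
  refine (finite_missing M N).subset ?_
  rintro n ⟨h | h, hn⟩
  · exact h
  · exact absurd (show n < 0 from hn) (not_lt.2 h)

theorem observed_eq_compl {s : ℕ} (M N : Fin s → ℕ) : observed M N = (unobserved M N)ᶜ := by
  ext n
  simp only [observed, unobserved, Set.mem_sdiff, Set.mem_ofPred_eq, Set.mem_compl_iff,
    Set.mem_union, not_or, not_le]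
  constructor
  · rintro ⟨h1, h2⟩; exact ⟨h2, by omega⟩
  · rintro ⟨h1, h2⟩; exact ⟨by omega, h1⟩

/-! ### Regular weights -/

/-- A density that is invertible almost everywhere and has an integrable inverse. -/
structure IsRegular (W : ℝ → Matrix (Fin T) (Fin T) ℂ) : Prop where
  density : IsSpectralDensity W
  isUnit : ∀ᵐ t ∂circ, IsUnit (W t).det
  inv : IsSpectralDensity fun t => (W t)⁻¹

theorem IsSpectralDensity.add {F G : ℝ → Matrix (Fin T) (Fin T) ℂ} (hF : IsSpectralDensity F)
    (hG : IsSpectralDensity G) : IsSpectralDensity (F + G) := by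
  refine ⟨fun i j => (hF.1 i j).add (hG.1 i j), ?_⟩
  filter_upwards [hF.2, hG.2] with t h1 h2
  exact h1.add h2

theorem IsMinimal.isRegular {F G : ℝ → Matrix (Fin T) (Fin T) ℂ} (hF : IsSpectralDensity F)
    (hG : IsSpectralDensity G) (h : IsMinimal F G) : IsRegular (F + G) := by
  refine ⟨hF.add hG, h.1, h.2, ?_⟩
  filter_upwards [(hF.add hG).2] with t ht
  exact ht.inv

theorem matSqrt_inv {W : Matrix (Fin T) (Fin T) ℂ} (hW : W.PosSemidef) :
    matSqrt W⁻¹ = (matSqrt W)⁻¹ := hW.inv_sqrt.symm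

theorem memLp_matSqrt {W : ℝ → Matrix (Fin T) (Fin T) ℂ} (hW : IsSpectralDensity W) (i j : Fin T) :
    MemLp (fun t => matSqrt (W t) i j) 2 circ := by
  have hm := aestronglyMeasurable_matSqrt (fun i j => (hW.1 i j).1) hW.2
  rw [memLp_two_iff_integrable_sq_norm (hm i j)]
  refine (integrable_trace hW.1).mono' ((hm i j).norm.pow 2) ?_
  filter_upwards [hW.2] with t ht
  rw [Real.norm_of_nonneg (sq_nonneg _)]
  have h1 := trace_mul_conjTranspose (matSqrt (W t))
  rw [(posSemidef_matSqrt (W t)).1, matSqrt_mul_self ht] at h1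
  rw [h1]
  calc ‖matSqrt (W t) i j‖ ^ 2 ≤ ∑ j, ‖matSqrt (W t) i j‖ ^ 2 :=
        Finset.single_le_sum (f := fun j => ‖matSqrt (W t) i j‖ ^ 2) (fun _ _ => sq_nonneg _)
          (Finset.mem_univ j)
    _ ≤ _ := Finset.single_le_sum (f := fun i => ∑ j, ‖matSqrt (W t) i j‖ ^ 2)
          (fun _ _ => Finset.sum_nonneg fun _ _ => sq_nonneg _) (Finset.mem_univ i)

theorem aestronglyMeasurable_vecMul {h : ℝ → Fin T → ℂ} {A : ℝ → Matrix (Fin T) (Fin T) ℂ}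
    (hh : ∀ i, AEStronglyMeasurable (fun t => h t i) circ)
    (hA : ∀ i j, AEStronglyMeasurable (fun t => A t i j) circ) (j : Fin T) :
    AEStronglyMeasurable (fun t => (h t ᵥ* A t) j) circ := by
  simp only [vecMul, dotProduct]
  exact Finset.aestronglyMeasurable_fun_sum _ fun i _ => (hh i).mul (hA i j)

theorem MemL2.memVec {W : ℝ → Matrix (Fin T) (Fin T) ℂ} (hW : IsSpectralDensity W)
    {h : ℝ → Fin T → ℂ} (hh : MemL2 W h) : MemVec fun t => h t ᵥ* matSqrt (W t) := by
  refine ⟨aestronglyMeasurable_vecMul hh.1 fun i j => (memLp_matSqrt hW i j).1, ?_⟩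
  refine hh.2.congr ?_
  filter_upwards [hW.2] with t ht
  rw [herm_eq_normSqVec ht]

theorem memL2_trigPoly {W : ℝ → Matrix (Fin T) (Fin T) ℂ} (hW : IsSpectralDensity W)
    (x : ℤ →₀ (Fin T → ℂ)) : MemL2 W (trigPoly x) :=
  ⟨aestronglyMeasurable_trigPoly x, integrable_herm_trigPoly hW.1 hW.2 x⟩

theorem MemL2.sub {W : ℝ → Matrix (Fin T) (Fin T) ℂ} (hW : IsSpectralDensity W)
    {g h : ℝ → Fin T → ℂ} (hg : MemL2 W g) (hh : MemL2 W h) : MemL2 W fun t => g t - h t :=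
  ⟨fun i => (hg.1 i).sub (hh.1 i),
    integrable_herm_sub (fun i j => (hW.1 i j).1) hW.2 hg.1 hh.1 hg.2 hh.2⟩

theorem norm_sq_sub_polyLp {W : ℝ → Matrix (Fin T) (Fin T) ℂ} (hW : IsSpectralDensity W)
    {h : ℝ → Fin T → ℂ} (hh : MemL2 W h) (x : ℤ →₀ (Fin T → ℂ)) :
    ‖(hh.memVec hW).toH - polyLp (memLp_matSqrt hW) x‖ ^ 2 =
      ∫ t, herm (W t) (h t - trigPoly x t) ∂circ := by
  change ‖(hh.memVec hW).toH - (memVec_poly (memLp_matSqrt hW) x).toH‖ ^ 2 = _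
  rw [← MemVec.toH_sub, MemVec.norm_sq]
  refine integral_congr_ae ?_
  filter_upwards [hW.2] with t ht
  rw [herm_eq_normSqVec ht, sub_vecMul]

theorem mem_polyClosure_matSqrt_iff {W : ℝ → Matrix (Fin T) (Fin T) ℂ} (hW : IsSpectralDensity W)
    {h : ℝ → Fin T → ℂ} (hh : MemL2 W h) {V : Set ℤ} :
    (hh.memVec hW).toH ∈ polyClosure (memLp_matSqrt hW) V ↔
      ∀ ε : ℝ, 0 < ε → ∃ x : ℤ →₀ (Fin T → ℂ), (x.support : Set ℤ) ⊆ V ∧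
        ∫ t, herm (W t) (h t - trigPoly x t) ∂circ < ε := by
  rw [mem_polyClosure_iff]
  simp only [norm_sq_sub_polyLp hW hh]

theorem memL2s_iff {s : ℕ} {M N : Fin s → ℕ} {W : ℝ → Matrix (Fin T) (Fin T) ℂ}
    (hW : IsSpectralDensity W) {h : ℝ → Fin T → ℂ} (hh : MemL2 W h) :
    MemL2s M N W h ↔ (hh.memVec hW).toH ∈ polyClosure (memLp_matSqrt hW) (observed M N) := by
  rw [mem_polyClosure_matSqrt_iff hW hh]
  exact ⟨fun h => h.2, fun h => ⟨hh, h⟩⟩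

/-! ### Duality between a weight and its inverse -/

namespace IsRegular

variable {W : ℝ → Matrix (Fin T) (Fin T) ℂ}

theorem sqrt_mul_sqrt_inv (hW : IsRegular W) :
    ∀ᵐ t ∂circ, matSqrt (W t) * matSqrt (W t)⁻¹ = 1 := by
  filter_upwards [hW.density.2, hW.isUnit] with t h1 h2
  rw [matSqrt_inv h1, mul_nonsing_inv _ (isUnit_matSqrt h1 h2)]

theorem sqrt_inv_mul_sqrt (hW : IsRegular W) :
    ∀ᵐ t ∂circ, matSqrt (W t)⁻¹ * matSqrt (W t) = 1 := by
  filter_upwards [hW.sqrt_mul_sqrt_inv] with t ht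
  exact mul_eq_one_comm.1 ht

theorem sqrt_inv_mul_self (hW : IsRegular W) :
    ∀ᵐ t ∂circ, matSqrt (W t)⁻¹ * matSqrt (W t)⁻¹ = (W t)⁻¹ := by
  filter_upwards [hW.inv.2] with t ht
  exact matSqrt_mul_self ht

theorem memL2_of_memVec (hW : IsRegular W) {y : ℝ → Fin T → ℂ} (hy : MemVec y) :
    MemL2 W fun t => y t ᵥ* matSqrt (W t)⁻¹ := by
  refine ⟨aestronglyMeasurable_vecMul hy.1 fun i j => (memLp_matSqrt hW.inv i j).1, ?_⟩
  refine hy.2.congr ?_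
  filter_upwards [hW.density.2, hW.sqrt_inv_mul_sqrt] with t h1 h2
  rw [herm_eq_normSqVec h1, vecMul_vecMul, h2, vecMul_one]

/-- The orthogonal complement of the exponentials with frequencies outside `V` in `L₂(W)` is,
after the identification of `L₂(W)` with `L₂(W⁻¹)`, the closed span of the exponentials with
frequencies in `V`. -/
theorem orthogonal_polyClosure_compl (hW : IsRegular W) {V : Set ℤ} (hV : {n : ℤ | 0 ≤ n} ⊆ V)
    (hfin : (V ∩ {n | n < 0}).Finite) :
    (polyClosure (memLp_matSqrt hW.density) Vᶜ)ᗮ = polyClosure (memLp_matSqrt hW.inv) V := by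
  apply le_antisymm
  · intro f hf
    rw [← toH_coe f] at hf ⊢
    set y : ℝ → Fin T → ℂ := fun t => (f t).ofLp with hy
    have hyV : MemVec y := memVec_coe f
    rw [mem_polyClosure_orthogonal_iff] at hf
    set C : ℝ → Fin T → ℂ := fun t => y t ᵥ* matSqrt (W t) with hC
    have hCi := hyV.integrable_vecMul (memLp_matSqrt hW.density)
    have hCy : ∀ᵐ t ∂circ, C t ᵥ* matSqrt (W t)⁻¹ = y t := by
      filter_upwards [hW.sqrt_mul_sqrt_inv] with t ht
      rw [hC, vecMul_vecMul, ht, vecMul_one]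
    -- Orthogonality to the exponentials outside `V` says precisely that `C = yᵀ W^{1/2}` has its
    -- spectrum in `V`. Its norm for the weight `W⁻¹` is that of `y`, so the approximation theorem
    -- applies.
    have hs : ∀ n ∉ V, fourierVec C n = 0 := by
      intro n hn
      rw [← hf n hn]
      refine congrFun (fourierVec_congr (ae_of_all _ fun t => ?_)) n
      rw [(posSemidef_matSqrt (W t)).1.eq]
    have hCw : Integrable (fun t => herm (W t)⁻¹ (C t)) circ := by
      refine hyV.2.congr ?_
      filter_upwards [hW.inv.2, hCy] with t h1 h2
      rw [herm_eq_normSqVec h1, h2]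
    rw [mem_polyClosure_iff]
    intro ε hε
    obtain ⟨x, hx, hxε⟩ := exists_trigPoly_of_spectrum hW.inv.1 hW.inv.2 hV hfin hCi hCw hs hε
    refine ⟨x, hx, lt_of_eq_of_lt ?_ hxε⟩
    change ‖hyV.toH - (memVec_poly (memLp_matSqrt hW.inv) x).toH‖ ^ 2 = _
    rw [← MemVec.toH_sub, MemVec.norm_sq]
    refine integral_congr_ae ?_
    filter_upwards [hW.inv.2, hCy] with t h1 h2
    rw [herm_eq_normSqVec h1, sub_vecMul, h2]
  -- Conversely the two square roots cancel, and a polynomial has no frequencies but its own.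
  · refine Submodule.topologicalClosure_minimal _ ?_ (Submodule.isClosed_orthogonal _)
    rintro _ ⟨x, hx, rfl⟩
    change (memVec_poly (memLp_matSqrt hW.inv) x).toH ∈ _
    rw [mem_polyClosure_orthogonal_iff]
    intro n hn
    have : (fun t => (trigPoly x t ᵥ* matSqrt (W t)⁻¹) ᵥ* (matSqrt (W t))ᴴ) =ᵐ[circ]
        trigPoly x := by
      filter_upwards [hW.sqrt_inv_mul_sqrt] with t ht
      rw [(posSemidef_matSqrt (W t)).1.eq, vecMul_vecMul, ht, vecMul_one]
    rw [fourierVec_congr this, fourierVec_trigPoly]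
    exact Finsupp.notMem_support_iff.1 fun h => hn (hx h)

end IsRegular

end RobustFilter

namespace RobustFilter

variable {s T : ℕ} {M N : Fin s → ℕ} {a : ℤ → Fin T → ℂ}

/-! ### The function `A` -/

theorem summable_coeffVec (ha : Summable fun j : ZS M N => ∑ k, ‖a j k‖) (i : Fin T) :
    Summable fun j => ‖coeffVec M N a j i‖ := by
  classical
  have h1 : Summable (Set.indicator (ZS M N) fun j => ∑ k, ‖a j k‖) :=
    summable_subtype_iff_indicator.1 ha
  refine h1.of_nonneg_of_le (fun _ => norm_nonneg _) fun j => ?_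
  by_cases hj : j ∈ ZS M N
  · rw [Set.indicator_of_mem hj, coeffVec, if_pos hj]
    exact Finset.single_le_sum (f := fun k => ‖a j k‖) (fun _ _ => norm_nonneg _)
      (Finset.mem_univ i)
  · rw [Set.indicator_of_notMem hj, coeffVec, if_neg hj]; simp

theorem hasSum_Afun (ha : Summable fun j : ZS M N => ∑ k, ‖a j k‖) (t : ℝ) (i : Fin T) :
    HasSum (fun j => coeffVec M N a j i * expo (-j) t) (Afun M N a t i) := by
  have h1 : ∀ i, Summable fun j => (expo (-j) t • coeffVec M N a j) i := fun i => by
    refine Summable.of_norm ?_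
    simpa using summable_coeffVec ha i
  have h2 : HasSum (fun j => expo (-j) t • coeffVec M N a j) (Afun M N a t) :=
    (Pi.summable.2 h1).hasSum
  have h3 := Pi.hasSum.1 h2 i
  simpa [mul_comm] using h3

theorem continuous_Afun (ha : Summable fun j : ZS M N => ∑ k, ‖a j k‖) (i : Fin T) :
    Continuous fun t => Afun M N a t i := by
  have : (fun t => Afun M N a t i) = fun t => ∑' j, coeffVec M N a j i * expo (-j) t := by
    ext t; exact (hasSum_Afun ha t i).tsum_eq.symm
  rw [this]
  exact continuous_tsum (fun j => by fun_prop) (summable_coeffVec ha i) (by simp)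

theorem exists_bound_Afun (ha : Summable fun j : ZS M N => ∑ k, ‖a j k‖) :
    ∃ B, ∀ t, normSqVec (Afun M N a t) ≤ B := by
  refine ⟨∑ i, (∑' j, ‖coeffVec M N a j i‖) ^ 2, fun t => Finset.sum_le_sum fun i _ => ?_⟩
  gcongr
  rw [← (hasSum_Afun ha t i).tsum_eq]
  refine (norm_tsum_le_tsum_norm ?_).trans (le_of_eq ?_)
  · simpa using summable_coeffVec ha i
  · simp

theorem aestronglyMeasurable_Afun (ha : Summable fun j : ZS M N => ∑ k, ‖a j k‖) (i : Fin T) :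
    AEStronglyMeasurable (fun t => Afun M N a t i) circ :=
  (continuous_Afun ha i).aestronglyMeasurable

theorem memL2_Afun (ha : Summable fun j : ZS M N => ∑ k, ‖a j k‖)
    {W : ℝ → Matrix (Fin T) (Fin T) ℂ} (hW : IsSpectralDensity W) : MemL2 W (Afun M N a) := by
  obtain ⟨B, hB⟩ := exists_bound_Afun ha
  exact ⟨aestronglyMeasurable_Afun ha,
    integrable_herm_of_bounded hW.1 hW.2 (aestronglyMeasurable_Afun ha) hB⟩

theorem hasSum_of_eq {ι : Type*} {f g : ι → ℂ} {x y : ℂ} (h : HasSum f x) (hf : ∀ j, g j = f j)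
    (hx : y = x) : HasSum g y := by
  rw [hx, funext hf]
  exact h

/-- Absolute summability of `b` justifies termwise integration. The frequencies `e j` are arbitrary
so that one lemma serves the indices `k + j` of `R` and `k - j` of `Q`. -/
theorem hasSum_mul_integral_expo {Φ : ℝ → ℂ} (hΦ : Integrable Φ circ) {b : ℤ → ℂ}
    (hb : Summable fun j => ‖b j‖) (e : ℤ → ℤ) :
    HasSum (fun j => b j * ∫ t, Φ t * expo (e j) t ∂circ)
      (∫ t, Φ t * ∑' j, b j * expo (e j) t ∂circ) := by
  have h1 := hasSum_integral_of_summable_integral_norm (μ := circ)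
    (F := fun j t => b j * (Φ t * expo (e j) t))
    (fun j => (integrable_mul_expo hΦ _).const_mul _) (by
      simp only [norm_mul, norm_expo, mul_one, integral_const_mul]
      exact hb.mul_right _)
  simp only [integral_const_mul] at h1
  refine hasSum_of_eq h1 (fun _ => rfl) ?_
  congr 1; ext t
  rw [← tsum_mul_left]
  congr 1; ext j; ring

theorem Afun_mul_expo (ha : Summable fun j : ZS M N => ∑ k, ‖a j k‖) (t : ℝ) (i : Fin T) (k : ℤ) :
    ∑' j, coeffVec M N a j i * expo (-(k + j)) t = Afun M N a t i * expo (-k) t := by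
  rw [← (hasSum_Afun ha t i).tsum_eq, ← tsum_mul_right]
  congr 1; ext j
  rw [neg_add_rev, expo_add, mul_assoc]

theorem star_Afun_mul_expo (ha : Summable fun j : ZS M N => ∑ k, ‖a j k‖) (t : ℝ) (i : Fin T)
    (k : ℤ) : ∑' j, star (coeffVec M N a j i) * expo (-(k - j)) t =
      star (Afun M N a t i) * expo (-k) t := by
  rw [← (hasSum_Afun ha t i).tsum_eq, RCLike.star_def, Complex.conj_tsum, ← tsum_mul_right]
  congr 1; ext j
  rw [map_mul, conj_expo, neg_neg, neg_sub, sub_eq_add_neg, expo_add, mul_assoc]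

/-- The index `k + j` of `R` matches the frequencies `-j` of `A`: summing over `j` reassembles `A`
under the integral. -/
theorem Ra_eq_fourierVec (ha : Summable fun j : ZS M N => ∑ k, ‖a j k‖)
    {F G : ℝ → Matrix (Fin T) (Fin T) ℂ}
    (hΦ : ∀ i j, Integrable (fun t => (F t * (F t + G t)⁻¹) i j) circ) (k : ℤ) :
    Ra M N a F G k = fourierVec (fun t => Afun M N a t ᵥ* (F t * (F t + G t)⁻¹)) k := by
  refine HasSum.tsum_eq (Pi.hasSum.2 fun l => ?_)
  have h1 : ∀ i, HasSum (fun j => coeffVec M N a j i * Rmat F G k j i l)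
      (1 / (2 * (Real.pi : ℂ)) * ∫ t, (F t * (F t + G t)⁻¹) i l *
        (Afun M N a t i * expo (-k) t) ∂circ) := by
    intro i
    have h2 := (hasSum_mul_integral_expo (hΦ i l) (summable_coeffVec ha i)
      (fun j => -(k + j))).mul_left (1 / (2 * (Real.pi : ℂ)))
    simp only [Afun_mul_expo ha] at h2
    refine hasSum_of_eq h2 (fun j => ?_) rfl
    simp only [Rmat, fourierMat, of_apply]
    ring
  have h3 := hasSum_sum (s := Finset.univ) fun i _ => h1 i
  refine hasSum_of_eq h3 (fun _ => rfl) ?_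
  rw [fourierVec, ← Finset.mul_sum, ← integral_finsetSum]
  · congr 2; ext t
    simp only [vecMul, dotProduct, Finset.sum_mul]
    refine Finset.sum_congr rfl fun i _ => ?_
    ring
  · intro i _
    obtain ⟨B, hB⟩ := exists_bound_Afun ha
    refine (hΦ i l).mul_bdd (c := Real.sqrt B)
      ((continuous_Afun ha i).mul (continuous_expo _)).aestronglyMeasurable (ae_of_all _ fun t => ?_)
    rw [norm_mul, norm_expo, mul_one]
    refine Real.le_sqrt_of_sq_le (le_trans ?_ (hB t))
    exact Finset.single_le_sum (f := fun i => ‖Afun M N a t i‖ ^ 2) (fun _ _ => sq_nonneg _)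
      (Finset.mem_univ i)

theorem integrable_mul_Afun (ha : Summable fun j : ZS M N => ∑ k, ‖a j k‖) {Φ : ℝ → ℂ}
    (hΦ : Integrable Φ circ) (i : Fin T) :
    Integrable (fun t => Φ t * Afun M N a t i) circ := by
  obtain ⟨B, hB⟩ := exists_bound_Afun ha
  refine hΦ.mul_bdd (c := Real.sqrt B) (continuous_Afun ha i).aestronglyMeasurable
    (ae_of_all _ fun t => Real.le_sqrt_of_sq_le (le_trans ?_ (hB t)))
  exact Finset.single_le_sum (f := fun i => ‖Afun M N a t i‖ ^ 2) (fun _ _ => sq_nonneg _)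
    (Finset.mem_univ i)

theorem integrable_mul_star_Afun (ha : Summable fun j : ZS M N => ∑ k, ‖a j k‖) {Φ : ℝ → ℂ}
    (hΦ : Integrable Φ circ) (i : Fin T) :
    Integrable (fun t => Φ t * star (Afun M N a t i)) circ := by
  have h := integrable_mul_Afun ha (Φ := fun t => star (Φ t)) (by
    rw [← integrable_norm_iff (continuous_star.comp_aestronglyMeasurable hΦ.1)]
    simpa using hΦ.norm) i
  have h2 : AEStronglyMeasurable (fun t => Φ t * star (Afun M N a t i)) circ :=
    hΦ.1.mul (continuous_star.comp_aestronglyMeasurable (aestronglyMeasurable_Afun ha i))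
  rw [← integrable_norm_iff h2]
  simpa using h.norm

/-- The number `⟨Q a, a⟩` as an integral. -/
theorem Qaa_eq_integral (ha : Summable fun j : ZS M N => ∑ k, ‖a j k‖)
    {F G : ℝ → Matrix (Fin T) (Fin T) ℂ}
    (hΨ : ∀ i j, Integrable (fun t => (F t * (F t + G t)⁻¹ * G t) i j) circ) :
    Qaa M N a F G = 1 / (2 * Real.pi) *
      ∫ t, herm (F t * (F t + G t)⁻¹ * G t) (Afun M N a t) ∂circ := by
  set Ψ : ℝ → Matrix (Fin T) (Fin T) ℂ := fun t => F t * (F t + G t)⁻¹ * G t with hΨdef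
  set A := Afun M N a with hA
  have hΨA : ∀ i, Integrable (fun t => (Ψ t *ᵥ star (A t)) i) circ := fun i => by
    simp only [mulVec, dotProduct, Pi.star_apply]
    exact integrable_finsetSum _ fun l _ => integrable_mul_star_Afun ha (hΨ i l) l
  -- The iterated sum is evaluated from the inside: summation over `j` produces the conjugate of
  -- `A`, summation over `k` then produces `A`.
  have h1 : ∀ k, ∑' j : ℤ, coeffVec M N a k ⬝ᵥ (Qmat F G k j *ᵥ star (coeffVec M N a j)) =
      ∑ i, coeffVec M N a k i * (1 / (2 * (Real.pi : ℂ)) *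
        ∫ t, (Ψ t *ᵥ star (A t)) i * expo (-k) t ∂circ) := by
    intro k
    refine HasSum.tsum_eq ?_
    simp only [dotProduct]
    refine hasSum_sum fun i _ => HasSum.mul_left _ ?_
    have h2 : ∀ l, HasSum (fun j => Qmat F G k j i l * star (coeffVec M N a j l))
        (1 / (2 * (Real.pi : ℂ)) * ∫ t, Ψ t i l * (star (A t l) * expo (-k) t) ∂circ) := by
      intro l
      have h3 := (hasSum_mul_integral_expo (hΨ i l) (b := fun j => star (coeffVec M N a j l))
        (by simpa using summable_coeffVec ha l) (fun j => -(k - j))).mul_left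
          (1 / (2 * (Real.pi : ℂ)))
      simp only [star_Afun_mul_expo ha] at h3
      refine hasSum_of_eq h3 (fun j => ?_) rfl
      simp only [Qmat, fourierMat, of_apply]
      ring
    have h4 := hasSum_sum (s := Finset.univ) fun l _ => h2 l
    refine hasSum_of_eq h4 (fun _ => rfl) ?_
    rw [← Finset.mul_sum, ← integral_finsetSum]
    · congr 2; ext t
      simp only [mulVec, dotProduct, Finset.sum_mul, Pi.star_apply, mul_assoc]
    · intro l _
      have := integrable_mul_expo (integrable_mul_star_Afun ha (hΨ i l) l) (-k)
      exact this.congr (ae_of_all _ fun t => mul_assoc _ _ _)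
  have h5 : ∑' k : ℤ, ∑ i, coeffVec M N a k i * (1 / (2 * (Real.pi : ℂ)) *
        ∫ t, (Ψ t *ᵥ star (A t)) i * expo (-k) t ∂circ) =
      1 / (2 * (Real.pi : ℂ)) * ∫ t, A t ⬝ᵥ (Ψ t *ᵥ star (A t)) ∂circ := by
    refine HasSum.tsum_eq ?_
    have h6 : ∀ i, HasSum (fun k => coeffVec M N a k i * (1 / (2 * (Real.pi : ℂ)) *
        ∫ t, (Ψ t *ᵥ star (A t)) i * expo (-k) t ∂circ))
        (1 / (2 * (Real.pi : ℂ)) * ∫ t, (Ψ t *ᵥ star (A t)) i * A t i ∂circ) := by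
      intro i
      have h7 := (hasSum_mul_integral_expo (hΨA i) (summable_coeffVec ha i)
        (fun j => -j)).mul_left (1 / (2 * (Real.pi : ℂ)))
      simp only [(hasSum_Afun ha _ i).tsum_eq] at h7
      exact hasSum_of_eq h7 (fun k => by ring) rfl
    have h8 := hasSum_sum (s := Finset.univ) fun i _ => h6 i
    refine hasSum_of_eq h8 (fun _ => rfl) ?_
    rw [← Finset.mul_sum, ← integral_finsetSum _ fun i _ => integrable_mul_Afun ha (hΨA i) i]
    congr 2; ext t
    simp only [dotProduct]
    exact Finset.sum_congr rfl fun i _ => mul_comm _ _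
  have hint : Integrable (fun t => A t ⬝ᵥ (Ψ t *ᵥ star (A t))) circ := by
    simp only [dotProduct]
    refine integrable_finsetSum _ fun i _ => ?_
    simpa only [mul_comm] using integrable_mul_Afun ha (hΨA i) i
  rw [Qaa]
  simp only [h1]
  rw [h5]
  have h9 : (1 / (2 * (Real.pi : ℂ))) = ((1 / (2 * Real.pi) : ℝ) : ℂ) := by push_cast; rfl
  rw [h9, Complex.re_ofReal_mul]
  congr 1
  exact (integral_re hint).symm

end RobustFilter

namespace RobustFilter

variable {s T : ℕ} {M N : Fin s → ℕ} {a : ℤ → Fin T → ℂ}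

/-! ### Completing the square -/

/-- The quadratic function of `h` has its vertex at `k = vᵀ F W⁻¹`, the estimate with all
observations available, because `kᵀ W = vᵀ F`. The constant left over is the parallel sum `F W⁻¹ G =
F - F W⁻¹ F`. -/
theorem herm_complete_square {F G : Matrix (Fin T) (Fin T) ℂ} (hF : F.PosSemidef)
    (hG : G.PosSemidef) (hu : IsUnit (F + G).det) (v h : Fin T → ℂ) :
    herm F (v - h) + herm G h =
      herm (F + G) (h - v ᵥ* (F * (F + G)⁻¹)) + herm (F * (F + G)⁻¹ * G) v := by
  set W := F + G with hW
  have hWH : W.IsHermitian := hF.1.add hG.1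
  set k := v ᵥ* (F * W⁻¹) with hk
  have h1 : k ᵥ* W = v ᵥ* F := by
    rw [hk, vecMul_vecMul, Matrix.mul_assoc, nonsing_inv_mul _ hu, Matrix.mul_one]
  have h2 : W *ᵥ star k = F *ᵥ star v := by
    have := congrArg star h1
    rwa [star_vecMul W k, star_vecMul F v, hWH.eq, hF.1.eq] at this
  have h3 : F * W⁻¹ * G = F - F * W⁻¹ * F := by
    have : G = W - F := by rw [hW]; abel
    rw [this, Matrix.mul_sub, Matrix.mul_assoc, nonsing_inv_mul _ hu, Matrix.mul_one]
  have h4 : G = W - F := by rw [hW]; abel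
  have h5 : k ⬝ᵥ (W *ᵥ star h) = v ⬝ᵥ (F *ᵥ star h) := by
    rw [dotProduct_mulVec, h1, ← dotProduct_mulVec]
  have h6 : k ⬝ᵥ (F *ᵥ star v) = v ⬝ᵥ ((F * W⁻¹ * F) *ᵥ star v) := by
    rw [hk, ← dotProduct_mulVec, mulVec_mulVec]
  simp only [herm]
  rw [h3, ← Complex.add_re, ← Complex.add_re]
  congr 1
  rw [star_sub, star_sub, mulVec_sub, mulVec_sub, h2, h4, sub_mulVec, sub_mulVec]
  simp only [sub_dotProduct, dotProduct_sub, h5, h6]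
  ring

/-- Completing the square at `h = 0` and at the vertex shows that the two sides differ by the
minimum value, a sum of two nonnegative forms. -/
theorem herm_vecMul_le {F G : Matrix (Fin T) (Fin T) ℂ} (hF : F.PosSemidef)
    (hG : G.PosSemidef) (hu : IsUnit (F + G).det) (v : Fin T → ℂ) :
    herm (F + G)⁻¹ (v ᵥ* F) ≤ herm F v := by
  have hW : (F + G).PosSemidef := hF.add hG
  have h0 := herm_complete_square hF hG hu v 0
  have h1 := herm_complete_square hF hG hu v (v ᵥ* (F * (F + G)⁻¹))
  have h2 : herm (F + G) (-(v ᵥ* (F * (F + G)⁻¹))) = herm (F + G)⁻¹ (v ᵥ* F) := by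
    rw [herm_neg, herm_inv hW, herm_eq_normSqVec hW, ← vecMul_vecMul, vecMul_vecMul (v ᵥ* F),
      inv_eq_matSqrt hW, Matrix.mul_assoc, nonsing_inv_mul _ (isUnit_matSqrt hW hu),
      Matrix.mul_one]
  have h3 : herm (F + G) (0 : Fin T → ℂ) = 0 := by simp [herm]
  have h4 : herm G (0 : Fin T → ℂ) = 0 := by simp [herm]
  rw [sub_self, h3, zero_add] at h1
  rw [sub_zero, h4, add_zero, zero_sub, h2, ← h1] at h0
  rw [h0]
  have := herm_nonneg hF (v - v ᵥ* (F * (F + G)⁻¹))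
  have := herm_nonneg hG (v ᵥ* (F * (F + G)⁻¹))
  linarith

variable {F G : ℝ → Matrix (Fin T) (Fin T) ℂ}

/-- This makes the target square integrable: its norm is dominated by the `F`-norm of `v`, although
`F (F + G)⁻¹` need not be bounded. -/
theorem memVec_vecMul (hF : IsSpectralDensity F) (hG : IsSpectralDensity G)
    (hR : IsRegular (F + G)) {v : ℝ → Fin T → ℂ} (hv : MemL2 F v) :
    MemVec fun t => (v t ᵥ* F t) ᵥ* matSqrt (F t + G t)⁻¹ := by
  have hm := aestronglyMeasurable_vecMul
    (aestronglyMeasurable_vecMul hv.1 fun i j => (hF.1 i j).1)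
    (fun i j => (memLp_matSqrt hR.inv i j).1)
  refine ⟨hm, hv.2.mono' ?_ ?_⟩
  · unfold normSqVec
    exact Finset.aestronglyMeasurable_fun_sum _ fun i _ => (hm i).norm.pow 2
  · filter_upwards [hF.2, hG.2, hR.isUnit] with t h1 h2 h3
    rw [Real.norm_of_nonneg (normSqVec_nonneg _), matSqrt_inv (h1.add h2),
      ← herm_inv (h1.add h2)]
    exact herm_vecMul_le h1 h2 h3 _

theorem memL2_const (hF : IsSpectralDensity F) (v : Fin T → ℂ) : MemL2 F fun _ => v :=
  ⟨fun _ => aestronglyMeasurable_const, integrable_herm_of_bounded hF.1 hF.2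
    (fun _ => aestronglyMeasurable_const) (B := normSqVec v) fun _ => le_rfl⟩

theorem single_vecMul_apply (A : Matrix (Fin T) (Fin T) ℂ) (i j : Fin T) :
    (Pi.single i 1 ᵥ* A) j = A i j := by
  rw [single_one_vecMul]; rfl

/-- `F W⁻¹` is the product of the square integrable matrix functions `F W^{-1/2}` and `W^{-1/2}`. -/
theorem integrable_mul_inv (hF : IsSpectralDensity F) (hG : IsSpectralDensity G)
    (hR : IsRegular (F + G)) (i j : Fin T) :
    Integrable (fun t => (F t * (F t + G t)⁻¹) i j) circ := by
  have h := (memVec_vecMul hF hG hR (memL2_const hF (Pi.single i 1))).integrable_vecMul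
    (memLp_matSqrt hR.inv) j
  refine h.congr ?_
  filter_upwards [hR.sqrt_inv_mul_self] with t ht
  change matSqrt (F t + G t)⁻¹ * matSqrt (F t + G t)⁻¹ = (F t + G t)⁻¹ at ht
  rw [vecMul_vecMul, Pi.add_apply, ht, vecMul_vecMul, single_vecMul_apply]

/-- `F W⁻¹ G = F - F W⁻¹ F`, and the entries of `F W⁻¹ F` are inner products of square integrable
rows of `F W^{-1/2}`. -/
theorem integrable_mul_inv_mul (hF : IsSpectralDensity F) (hG : IsSpectralDensity G)
    (hR : IsRegular (F + G)) (i j : Fin T) :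
    Integrable (fun t => (F t * (F t + G t)⁻¹ * G t) i j) circ := by
  have h1 := memVec_vecMul hF hG hR (memL2_const hF (Pi.single i 1))
  have h2 := memVec_vecMul hF hG hR (memL2_const hF (Pi.single j 1))
  have h3 : Integrable (fun t => F t i j -
      ((Pi.single i 1 ᵥ* F t) ᵥ* matSqrt (F t + G t)⁻¹) ⬝ᵥ
        star ((Pi.single j 1 ᵥ* F t) ᵥ* matSqrt (F t + G t)⁻¹)) circ := by
    refine (hF.1 i j).sub ?_
    simp only [dotProduct]
    exact integrable_finsetSum _ fun k _ =>
      (h1.memLp_apply k).integrable_mul (h2.memLp_apply k).star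
  refine h3.congr ?_
  filter_upwards [hR.sqrt_inv_mul_self, hF.2, hR.isUnit] with t ht hFt hu
  change matSqrt (F t + G t)⁻¹ * matSqrt (F t + G t)⁻¹ = (F t + G t)⁻¹ at ht
  change IsUnit (F t + G t).det at hu
  have e : F t * (F t + G t)⁻¹ * G t = F t - F t * (F t + G t)⁻¹ * F t := by
    calc F t * (F t + G t)⁻¹ * G t = F t * (F t + G t)⁻¹ * ((F t + G t) - F t) := by
          rw [add_sub_cancel_left]
      _ = _ := by
          rw [Matrix.mul_sub, Matrix.mul_assoc (F t) _ (F t + G t), nonsing_inv_mul _ hu,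
            Matrix.mul_one]
  rw [e, Matrix.sub_apply, star_vecMul, star_vecMul, (posSemidef_matSqrt _).1.eq, hFt.1.eq,
    ← dotProduct_mulVec, mulVec_mulVec, mulVec_mulVec, ht, dotProduct_mulVec,
    vecMul_vecMul, ← Matrix.mul_assoc, ← Pi.single_star, star_one, dotProduct_single, mul_one,
    single_vecMul_apply]

theorem MemL2.left (hF : IsSpectralDensity F) (hG : IsSpectralDensity G) {h : ℝ → Fin T → ℂ}
    (hh : MemL2 (F + G) h) : MemL2 F h := by
  refine ⟨hh.1, hh.2.mono' (aestronglyMeasurable_herm (fun i j => (hF.1 i j).1) hh.1) ?_⟩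
  filter_upwards [hF.2, hG.2] with t h1 h2
  rw [Real.norm_of_nonneg (herm_nonneg h1 _), Pi.add_apply, herm_add_left]
  linarith [herm_nonneg h2 (h t)]

theorem MemL2.right (hF : IsSpectralDensity F) (hG : IsSpectralDensity G) {h : ℝ → Fin T → ℂ}
    (hh : MemL2 (F + G) h) : MemL2 G h := by
  rw [add_comm] at hh
  exact hh.left hG hF

theorem mse_eq_integral (ha : Summable fun j : ZS M N => ∑ k, ‖a j k‖)
    (hF : IsSpectralDensity F) (hG : IsSpectralDensity G) {h : ℝ → Fin T → ℂ} (hh : MemL2 (F + G) h) :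
    mse M N a h F G = 1 / (2 * Real.pi) *
      ∫ t, (herm (F t) (Afun M N a t - h t) + herm (G t) (h t)) ∂circ := by
  rw [mse, integral_add, mul_add]
  · exact ((memL2_Afun ha hF).sub hF (hh.left hF hG)).2
  · exact (hh.right hF hG).2

/-! ### The error as a distance in Hilbert space -/

section Model

variable (ha : Summable fun j : ZS M N => ∑ k, ‖a j k‖) (hF : IsSpectralDensity F)
  (hG : IsSpectralDensity G) (hR : IsRegular (F + G))

/-- The function `Aᵀ F (F + G)^{-1/2}`, which represents the optimal estimate from all
observations. -/
noncomputable def target : VecLp T := (memVec_vecMul hF hG hR (memL2_Afun ha hF)).toH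

theorem integral_complete_square {h : ℝ → Fin T → ℂ} (hh : MemL2 (F + G) h) :
    ∫ t, (herm (F t) (Afun M N a t - h t) + herm (G t) (h t)) ∂circ =
      ‖(hh.memVec hR.density).toH - target ha hF hG hR‖ ^ 2 +
        ∫ t, herm (F t * (F t + G t)⁻¹ * G t) (Afun M N a t) ∂circ := by
  rw [target, ← MemVec.toH_sub, MemVec.norm_sq, ← integral_add]
  · refine integral_congr_ae ?_
    filter_upwards [hF.2, hG.2, hR.isUnit, hR.sqrt_inv_mul_self, hR.sqrt_inv_mul_sqrt]
      with t h1 h2 h3 h4 h5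
    change IsUnit (F t + G t).det at h3
    change matSqrt (F t + G t)⁻¹ * matSqrt (F t + G t)⁻¹ = (F t + G t)⁻¹ at h4
    change matSqrt (F t + G t)⁻¹ * matSqrt (F t + G t) = 1 at h5
    have h6 : (F t + G t)⁻¹ * matSqrt (F t + G t) = matSqrt (F t + G t)⁻¹ := by
      calc _ = matSqrt (F t + G t)⁻¹ * matSqrt (F t + G t)⁻¹ * matSqrt (F t + G t) := by rw [h4]
        _ = _ := by rw [Matrix.mul_assoc, h5, Matrix.mul_one]
    rw [herm_complete_square h1 h2 h3, herm_eq_normSqVec (h1.add h2), sub_vecMul,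
      vecMul_vecMul _ _ (matSqrt (F t + G t)), Matrix.mul_assoc, h6, ← vecMul_vecMul]
    rfl
  · exact ((hh.memVec hR.density).sub (memVec_vecMul hF hG hR (memL2_Afun ha hF))).2
  · obtain ⟨B, hB⟩ := exists_bound_Afun ha
    refine Integrable.congr (f := fun t => (∑ i, ∑ j, Afun M N a t i *
      ((F t * (F t + G t)⁻¹ * G t) i j * star (Afun M N a t j))).re) ?_
      (ae_of_all _ fun t => by simp [herm, dotProduct, mulVec, Finset.mul_sum])
    refine Integrable.re (𝕜 := ℂ) (integrable_finsetSum _ fun i _ =>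
      integrable_finsetSum _ fun j _ => ?_)
    simp only [mul_comm (Afun M N a _ i)]
    exact integrable_mul_Afun ha
      (integrable_mul_star_Afun ha (integrable_mul_inv_mul hF hG hR i j) j) i

/-- The mean square error of an estimate. -/
theorem mse_eq {h : ℝ → Fin T → ℂ} (hh : MemL2 (F + G) h) :
    mse M N a h F G = 1 / (2 * Real.pi) *
      ‖(hh.memVec hR.density).toH - target ha hF hG hR‖ ^ 2 + Qaa M N a F G := by
  rw [mse_eq_integral ha hF hG hh, integral_complete_square ha hF hG hR hh, mul_add,
    Qaa_eq_integral ha (integrable_mul_inv_mul hF hG hR)]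

/-- The part of the target that is orthogonal to the observations. -/
noncomputable def residual : VecLp T := target ha hF hG hR -
  (polyClosure (memLp_matSqrt hR.density) (observed M N)).starProjection (target ha hF hG hR)

theorem target_sub_residual_mem : target ha hF hG hR - residual ha hF hG hR ∈
    polyClosure (memLp_matSqrt hR.density) (observed M N) := by
  rw [residual, sub_sub_cancel]
  exact Submodule.starProjection_apply_mem _ _

/-- The duality enters here: orthogonality to the observations becomes approximability by unobserved
exponentials, without which `B⁻¹ R a` would not be reached by finitely supported sequences. -/
theorem residual_mem : residual ha hF hG hR ∈
    polyClosure (memLp_matSqrt hR.inv) (unobserved M N) := by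
  rw [← hR.orthogonal_polyClosure_compl (nonneg_subset_unobserved M N)
    (finite_unobserved_neg M N), ← observed_eq_compl]
  exact Submodule.sub_starProjection_mem_orthogonal _

theorem inner_eq_zero_of_observed {f g : VecLp T}
    (hf : f ∈ polyClosure (memLp_matSqrt hR.density) (observed M N))
    (hg : g ∈ polyClosure (memLp_matSqrt hR.inv) (unobserved M N)) : inner ℂ f g = 0 := by
  rw [← hR.orthogonal_polyClosure_compl (nonneg_subset_unobserved M N)
    (finite_unobserved_neg M N), ← observed_eq_compl] at hg
  exact hg f hf

/-- Pythagoras: the residual is orthogonal to every difference of observed elements. -/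
theorem norm_sq_sub_target {f : VecLp T}
    (hf : f ∈ polyClosure (memLp_matSqrt hR.density) (observed M N)) :
    ‖f - target ha hF hG hR‖ ^ 2 =
      ‖f - (target ha hF hG hR - residual ha hF hG hR)‖ ^ 2 + ‖residual ha hF hG hR‖ ^ 2 := by
  have h1 := inner_eq_zero_of_observed hR
    (sub_mem hf (target_sub_residual_mem ha hF hG hR)) (residual_mem ha hF hG hR)
  have h2 : f - target ha hF hG hR = (f - (target ha hF hG hR - residual ha hF hG hR)) -
      residual ha hF hG hR := by abel
  rw [h2, @norm_sub_sq ℂ, h1]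
  simp

/-- The residual is also the projection of the target onto the dual span. This form is the one that
translates into the equations `B c = R a` on `U`. -/
theorem residual_eq_iff {f : VecLp T} :
    f = residual ha hF hG hR ↔
      f ∈ polyClosure (memLp_matSqrt hR.inv) (unobserved M N) ∧
      target ha hF hG hR - f ∈ (polyClosure (memLp_matSqrt hR.inv) (unobserved M N))ᗮ := by
  constructor
  · rintro rfl
    refine ⟨residual_mem ha hF hG hR, ?_⟩
    rw [Submodule.mem_orthogonal']
    exact fun g hg => inner_eq_zero_of_observed hR (target_sub_residual_mem ha hF hG hR) hg
  · rintro ⟨h1, h2⟩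
    have h3 := sub_mem h1 (residual_mem ha hF hG hR)
    have h4 : inner ℂ (f - residual ha hF hG hR) (f - residual ha hF hG hR) = 0 := by
      have h5 : f - residual ha hF hG hR =
        (target ha hF hG hR - residual ha hF hG hR) - (target ha hF hG hR - f) := by abel
      nth_rewrite 1 [h5]
      rw [inner_sub_left, inner_eq_zero_of_observed hR (target_sub_residual_mem ha hF hG hR) h3,
        (Submodule.mem_orthogonal' _ _).1 h2 _ h3, sub_zero]
    exact sub_eq_zero.1 (inner_self_eq_zero.1 h4)

theorem IsRegular.exists_memL2_toH_eq {W : ℝ → Matrix (Fin T) (Fin T) ℂ} (hW : IsRegular W)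
    (f : VecLp T) : ∃ (h : ℝ → Fin T → ℂ) (hh : MemL2 W h), (hh.memVec hW.density).toH = f := by
  refine ⟨_, hW.memL2_of_memVec (memVec_coe f), ?_⟩
  refine ((MemVec.toH_eq_iff _ (memVec_coe f)).2 ?_).trans (toH_coe f)
  filter_upwards [hW.sqrt_inv_mul_sqrt] with t ht
  rw [vecMul_vecMul, ht, vecMul_one]

/-- The optimal estimates are those represented by the projection of the target. -/
theorem isOptimal_iff {h : ℝ → Fin T → ℂ} (hh : MemL2 (F + G) h) :
    IsOptimal M N a F G h ↔
      (hh.memVec hR.density).toH = target ha hF hG hR - residual ha hF hG hR := by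
  have hpi : 0 < 1 / (2 * Real.pi) := by positivity
  constructor
  · rintro ⟨hs, hopt⟩
    obtain ⟨g, hP, hPe⟩ := hR.exists_memL2_toH_eq (target ha hF hG hR - residual ha hF hG hR)
    have h1 := hopt _ ((memL2s_iff hR.density hP).2
      (hPe.symm ▸ target_sub_residual_mem ha hF hG hR))
    rw [mse_eq ha hF hG hR hh, mse_eq ha hF hG hR hP, hPe, add_le_add_iff_right,
      mul_le_mul_iff_right₀ hpi, norm_sq_sub_target ha hF hG hR
      ((memL2s_iff hR.density hh).1 hs), norm_sq_sub_target ha hF hG hR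
      (target_sub_residual_mem ha hF hG hR), sub_self, norm_zero] at h1
    rw [← sub_eq_zero, ← norm_eq_zero]
    nlinarith [norm_nonneg ((hh.memVec hR.density).toH -
      (target ha hF hG hR - residual ha hF hG hR))]
  · intro he
    refine ⟨(memL2s_iff hR.density hh).2 (he.symm ▸ target_sub_residual_mem ha hF hG hR), ?_⟩
    intro g hg
    rw [mse_eq ha hF hG hR hh, mse_eq ha hF hG hR hg.1, add_le_add_iff_right,
      mul_le_mul_iff_right₀ hpi, he, norm_sq_sub_target ha hF hG hR
      ((memL2s_iff hR.density hg.1).1 hg), norm_sq_sub_target ha hF hG hR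
      (target_sub_residual_mem ha hF hG hR), sub_self, norm_zero]
    nlinarith [sq_nonneg ‖(hg.1.memVec hR.density).toH -
      (target ha hF hG hR - residual ha hF hG hR)‖]

theorem mse_eq_of_isOptimal {h : ℝ → Fin T → ℂ} (ho : IsOptimal M N a F G h) :
    mse M N a h F G = 1 / (2 * Real.pi) * ‖residual ha hF hG hR‖ ^ 2 + Qaa M N a F G := by
  rw [mse_eq ha hF hG hR ho.1.1, (isOptimal_iff ha hF hG hR ho.1.1).1 ho,
    norm_sq_sub_target ha hF hG hR (target_sub_residual_mem ha hF hG hR), sub_self, norm_zero]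
  ring

/-- By Pythagoras the excess over the minimal error is exactly the squared distance to the optimum.
This quadratic growth compensates the loss at another pair in `mse_le_of_mixture`. -/
theorem mse_trigPoly_of_isOptimal (ha : Summable fun j : ZS M N => ∑ k, ‖a j k‖)
    (hF : IsSpectralDensity F) (hG : IsSpectralDensity G) (hR : IsRegular (F + G))
    {h : ℝ → Fin T → ℂ} (ho : IsOptimal M N a F G h)
    {x : ℤ →₀ (Fin T → ℂ)} (hx : (x.support : Set ℤ) ⊆ observed M N) :
    mse M N a (trigPoly x) F G = mse M N a h F G +
      1 / (2 * Real.pi) * ∫ t, herm (F t + G t) (trigPoly x t - h t) ∂circ := by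
  have hxL := memL2_trigPoly hR.density x
  have hxm : (hxL.memVec hR.density).toH ∈
    polyClosure (memLp_matSqrt hR.density) (observed M N) := polyLp_mem _ hx
  rw [mse_eq_of_isOptimal ha hF hG hR ho, mse_eq ha hF hG hR hxL,
    norm_sq_sub_target ha hF hG hR hxm, ← (isOptimal_iff ha hF hG hR ho.1.1).1 ho,
    ← MemVec.toH_sub, MemVec.norm_sq]
  have : ∫ t, normSqVec (trigPoly x t ᵥ* matSqrt ((F + G) t) - h t ᵥ* matSqrt ((F + G) t)) ∂circ =
      ∫ t, herm (F t + G t) (trigPoly x t - h t) ∂circ := by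
    refine integral_congr_ae ?_
    filter_upwards [hR.density.2] with t ht
    rw [← sub_vecMul, ← herm_eq_normSqVec ht, Pi.add_apply]
  rw [this]
  ring

theorem exists_isOptimal (ha : Summable fun j : ZS M N => ∑ k, ‖a j k‖)
    (hF : IsSpectralDensity F) (hG : IsSpectralDensity G) (hR : IsRegular (F + G)) :
    ∃ h, IsOptimal M N a F G h := by
  obtain ⟨h, hh, he⟩ := hR.exists_memL2_toH_eq (target ha hF hG hR - residual ha hF hG hR)
  exact ⟨h, (isOptimal_iff ha hF hG hR hh).2 he⟩

end Model

theorem mse_nonneg (hF : IsSpectralDensity F) (hG : IsSpectralDensity G) (h : ℝ → Fin T → ℂ) :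
    0 ≤ mse M N a h F G := by
  have h1 : 0 ≤ ∫ t, herm (F t) (Afun M N a t - h t) ∂circ := by
    refine integral_nonneg_of_ae ?_
    filter_upwards [hF.2] with t ht using herm_nonneg ht _
  have h2 : 0 ≤ ∫ t, herm (G t) (h t) ∂circ := by
    refine integral_nonneg_of_ae ?_
    filter_upwards [hG.2] with t ht using herm_nonneg ht _
  rw [mse]
  positivity

theorem bddBelow_mse (hF : IsSpectralDensity F) (hG : IsSpectralDensity G) :
    BddBelow (Set.range fun h : {h : ℝ → Fin T → ℂ // MemL2s M N (F + G) h} =>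
      mse M N a h.1 F G) :=
  ⟨0, by rintro _ ⟨h, rfl⟩; exact mse_nonneg hF hG _⟩

theorem optError_eq_of_isOptimal (hF : IsSpectralDensity F) (hG : IsSpectralDensity G)
    {h : ℝ → Fin T → ℂ} (ho : IsOptimal M N a F G h) :
    optError M N a F G = mse M N a h F G := by
  have : Nonempty {h : ℝ → Fin T → ℂ // MemL2s M N (F + G) h} := ⟨⟨h, ho.1⟩⟩
  exact le_antisymm (ciInf_le (bddBelow_mse hF hG) ⟨h, ho.1⟩) (le_ciInf fun g => ho.2 g.1 g.2)

end RobustFilter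

namespace RobustFilter

variable {s T : ℕ} {M N : Fin s → ℕ} {a : ℤ → Fin T → ℂ}

/-! ### The inverse of `B` -/

/-- The Fourier coefficients of `yᵀ A(t)ᴴ`, as functionals on the Hilbert space. -/
noncomputable def fcoef {A : ℝ → Matrix (Fin T) (Fin T) ℂ}
    (hA : ∀ i j, MemLp (fun t => A t i j) 2 circ) (f : VecLp T) (k : ℤ) : Fin T → ℂ := fun i =>
  1 / (2 * (Real.pi : ℂ)) * inner ℂ (polyLp hA (Finsupp.single k (Pi.single i 1))) f

section

variable {A : ℝ → Matrix (Fin T) (Fin T) ℂ} (hA : ∀ i j, MemLp (fun t => A t i j) 2 circ)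

theorem fcoef_toH {y : ℝ → Fin T → ℂ} (hy : MemVec y) :
    fcoef hA hy.toH = fourierVec fun t => y t ᵥ* (A t)ᴴ := by
  ext k i
  rw [fcoef, inner_polyLp, pairing_single, ← Pi.single_star, star_one, dotProduct_single, mul_one]
  field_simp [two_pi_ne_zero]

theorem fcoef_sub (f g : VecLp T) (k : ℤ) : fcoef hA (f - g) k = fcoef hA f k - fcoef hA g k := by
  ext i
  simp only [fcoef, inner_sub_right, Pi.sub_apply]
  ring

theorem tendsto_fcoef {f : ℕ → VecLp T} {g : VecLp T} (h : Tendsto f atTop (𝓝 g)) (k : ℤ) :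
    Tendsto (fun n => fcoef hA (f n) k) atTop (𝓝 (fcoef hA g k)) :=
  tendsto_pi_nhds.2 fun _ => (tendsto_const_nhds.inner h).const_mul _

theorem inner_polyLp_eq_fcoef (x : ℤ →₀ (Fin T → ℂ)) (f : VecLp T) :
    inner ℂ (polyLp hA x) f = 2 * Real.pi * pairing (fcoef hA f) x := by
  rw [← toH_coe f, inner_polyLp, fcoef_toH]

theorem mem_orthogonal_iff_fcoef {V : Set ℤ} (f : VecLp T) :
    f ∈ (polyClosure hA V)ᗮ ↔ ∀ n ∈ V, fcoef hA f n = 0 := by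
  rw [← toH_coe f, mem_polyClosure_orthogonal_iff, fcoef_toH]

end

/-- Because `W^{-1/2} W^{1/2} = 1`, the coefficients of a polynomial are continuous functionals of
its image in the Hilbert space. Hence convergence in energy forces coordinatewise convergence, and
the limit `c` is unique. -/
theorem fcoef_polyLp_inv {W : ℝ → Matrix (Fin T) (Fin T) ℂ} (hW : IsRegular W)
    (x : ℤ →₀ (Fin T → ℂ)) (k : ℤ) :
    fcoef (memLp_matSqrt hW.density) (polyLp (memLp_matSqrt hW.inv) x) k = x k := by
  change fcoef (memLp_matSqrt hW.density) (memVec_poly (memLp_matSqrt hW.inv) x).toH k = _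
  rw [fcoef_toH, ← fourierVec_trigPoly x]
  refine congrFun (fourierVec_congr ?_) k
  filter_upwards [hW.sqrt_inv_mul_sqrt] with t ht
  rw [(posSemidef_matSqrt _).1.eq, vecMul_vecMul, ht, vecMul_one]

variable {F G : ℝ → Matrix (Fin T) (Fin T) ℂ}

/-- `W^{-1/2} W^{-1/2} = W⁻¹`, so up to the factor `2π` the matrix `B` is the Gram matrix of the
exponentials multiplied by `W^{-1/2}`. -/
theorem applyMat_Bmat (hR : IsRegular (F + G)) (x : ℤ →₀ (Fin T → ℂ)) (k : ℤ) :
    applyMat (Bmat F G) x k = fcoef (memLp_matSqrt hR.inv) (polyLp (memLp_matSqrt hR.inv) x) k := by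
  change _ = fcoef (memLp_matSqrt hR.inv) (memVec_poly (memLp_matSqrt hR.inv) x).toH k
  have h1 : (fun t => (trigPoly x t ᵥ* matSqrt ((F + G) t)⁻¹) ᵥ* (matSqrt ((F + G) t)⁻¹)ᴴ)
      =ᵐ[circ] fun t => trigPoly x t ᵥ* (F t + G t)⁻¹ := by
    filter_upwards [hR.sqrt_inv_mul_self] with t ht
    rw [(posSemidef_matSqrt _).1.eq, vecMul_vecMul, ht, Pi.add_apply]
  rw [fcoef_toH, fourierVec_congr h1]
  ext l
  have hi : ∀ i, Integrable (fun t => (F t + G t)⁻¹ i l) circ := fun i => hR.inv.1 i l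
  have h2 : ∀ t, (trigPoly x t ᵥ* (F t + G t)⁻¹) l * expo (-k) t =
      ∑ j ∈ x.support, ∑ i, x j i * ((F t + G t)⁻¹ i l * expo (-(k - j)) t) := by
    intro t
    simp only [vecMul, dotProduct, trigPoly_apply, Finset.sum_mul]
    rw [Finset.sum_comm]
    refine Finset.sum_congr rfl fun j _ => Finset.sum_congr rfl fun i _ => ?_
    rw [show -(k - j) = j + -k by ring, expo_add]
    ring
  simp only [fourierVec, h2]
  rw [integral_finsetSum _ fun j _ => integrable_finsetSum _ fun i _ =>
    (integrable_mul_expo (hi i) _).const_mul _, Finset.mul_sum, applyMat, Finset.sum_apply]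
  refine Finset.sum_congr rfl fun j _ => ?_
  rw [integral_finsetSum _ fun i _ => (integrable_mul_expo (hi i) _).const_mul _, Finset.mul_sum]
  simp only [vecMul, dotProduct]
  refine Finset.sum_congr rfl fun i _ => ?_
  rw [integral_const_mul, Bmat, fourierMat, of_apply]
  ring

theorem fcoef_target (ha : Summable fun j : ZS M N => ∑ k, ‖a j k‖) (hF : IsSpectralDensity F)
    (hG : IsSpectralDensity G) (hR : IsRegular (F + G)) (k : ℤ) :
    fcoef (memLp_matSqrt hR.inv) (target ha hF hG hR) k = Ra M N a F G k := by
  rw [Ra_eq_fourierVec ha (integrable_mul_inv hF hG hR), target, fcoef_toH]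
  refine congrFun (fourierVec_congr ?_) k
  filter_upwards [hR.sqrt_inv_mul_self] with t ht
  change matSqrt (F t + G t)⁻¹ * matSqrt (F t + G t)⁻¹ = (F t + G t)⁻¹ at ht
  rw [Pi.add_apply, (posSemidef_matSqrt _).1.eq, vecMul_vecMul, ht, vecMul_vecMul]

/-- The rest of the target is orthogonal to the residual. -/
theorem inner_residual_target (ha : Summable fun j : ZS M N => ∑ k, ‖a j k‖)
    (hF : IsSpectralDensity F) (hG : IsSpectralDensity G) (hR : IsRegular (F + G)) :
    inner ℂ (residual ha hF hG hR) (target ha hF hG hR) =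
      ((‖residual ha hF hG hR‖ ^ 2 : ℝ) : ℂ) := by
  have h := inner_eq_zero_of_observed hR (target_sub_residual_mem ha hF hG hR)
    (residual_mem ha hF hG hR)
  have h2 : target ha hF hG hR =
    (target ha hF hG hR - residual ha hF hG hR) + residual ha hF hG hR := by abel
  rw [h2, inner_add_right, ← inner_conj_symm, h, map_zero, zero_add, inner_self_eq_norm_sq_to_K]
  push_cast
  rfl

/-- The sequence `B⁻¹ R a` and the number `⟨R a, B⁻¹ R a⟩`. -/
theorem isInverseApply_iff (ha : Summable fun j : ZS M N => ∑ k, ‖a j k‖)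
    (hF : IsSpectralDensity F) (hG : IsSpectralDensity G) (hR : IsRegular (F + G))
    {c : ℤ → Fin T → ℂ} {q : ℝ} :
    IsInverseApply (unobserved M N) (Bmat F G) (Ra M N a F G) c q ↔
      c = fcoef (memLp_matSqrt hR.density) (residual ha hF hG hR) ∧
      q = 1 / (2 * Real.pi) * ‖residual ha hF hG hR‖ ^ 2 := by
  set hL := memLp_matSqrt hR.inv with hLdef
  set e := residual ha hF hG hR with he
  have hRa : Ra M N a F G = fcoef hL (target ha hF hG hR) :=
    funext fun k => (fcoef_target ha hF hG hR k).symm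
  have hpair : ∀ x, pairing (Ra M N a F G) x =
      1 / (2 * (Real.pi : ℂ)) * inner ℂ (polyLp hL x) (target ha hF hG hR) := by
    intro x
    rw [hRa, inner_polyLp_eq_fcoef]
    field_simp [two_pi_ne_zero]
  -- The energy form of `B` is the Hilbert norm, so Cauchy in energy means that the images converge.
  have hen : ∀ x, (pairing (applyMat (Bmat F G) x) x).re =
      1 / (2 * Real.pi) * ‖polyLp hL x‖ ^ 2 := by
    intro x
    have h1 := inner_polyLp_eq_fcoef hL x (polyLp hL x)
    rw [← funext (applyMat_Bmat hR x), inner_self_eq_norm_sq_to_K] at h1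
    have h2 : pairing (applyMat (Bmat F G) x) x =
        ((1 / (2 * Real.pi) * ‖polyLp hL x‖ ^ 2 : ℝ) : ℂ) := by
      have h3 : ((‖polyLp hL x‖ ^ 2 : ℝ) : ℂ) =
          2 * Real.pi * pairing (applyMat (Bmat F G) x) x := by
        rw [← h1]; push_cast; rfl
      rw [Complex.ofReal_mul, h3]
      push_cast
      field_simp [two_pi_ne_zero]
    rw [h2, Complex.ofReal_re]
  have hq : ((1 / (2 * Real.pi) * ‖e‖ ^ 2 : ℝ) : ℂ) =
      1 / (2 * (Real.pi : ℂ)) * inner ℂ e (target ha hF hG hR) := by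
    rw [he, inner_residual_target]
    push_cast
    rfl
  have hpi : (0 : ℝ) < 2 * Real.pi := by positivity
  have hconv : ∀ x : ℕ → ℤ →₀ (Fin T → ℂ), Tendsto (fun n => polyLp hL (x n)) atTop (𝓝 e) →
      (∀ k, Tendsto (fun n => x n k) atTop (𝓝 (fcoef (memLp_matSqrt hR.density) e k))) ∧
      Tendsto (fun n => pairing (Ra M N a F G) (x n)) atTop
        (𝓝 ((1 / (2 * Real.pi) * ‖e‖ ^ 2 : ℝ) : ℂ)) := by
    intro x hx
    constructor
    · intro k
      have := tendsto_fcoef (memLp_matSqrt hR.density) hx k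
      simpa only [hLdef, fcoef_polyLp_inv hR] using this
    · rw [hq]
      simp only [hpair]
      exact (hx.inner tendsto_const_nhds).const_mul _
  constructor
  · rintro ⟨x, hxV, hcau, hxc, hxB, hxq⟩
    have hC : CauchySeq fun n => polyLp hL (x n) := by
      rw [Metric.cauchySeq_iff]
      intro ε hε
      obtain ⟨n₀, hn₀⟩ := hcau (1 / (2 * Real.pi) * ε ^ 2) (by positivity)
      refine ⟨n₀, fun m hm n hn => ?_⟩
      have h1 := hn₀ m hm n hn
      rw [hen, map_sub, mul_lt_mul_iff_right₀ (by positivity)] at h1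
      rw [dist_eq_norm]
      exact lt_of_pow_lt_pow_left₀ 2 hε.le h1
    obtain ⟨f, hf⟩ := cauchySeq_tendsto_of_complete hC
    -- The limit lies in the dual span, and `B xₙ → R a` on `U` makes its difference from the target
    -- orthogonal to that span; these two properties characterize the residual.
    have hfe : f = e := by
      rw [he, residual_eq_iff]
      refine ⟨(Submodule.isClosed_topologicalClosure _).mem_of_tendsto hf
        (Eventually.of_forall fun n => polyLp_mem hL (hxV n)), ?_⟩
      rw [mem_orthogonal_iff_fcoef]
      intro n hn
      rw [fcoef_sub, sub_eq_zero, fcoef_target]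
      have h1 := tendsto_fcoef hL hf n
      simp only [← applyMat_Bmat hR] at h1
      exact tendsto_nhds_unique (hxB n hn) h1
    rw [hfe] at hf
    obtain ⟨h1, h2⟩ := hconv x hf
    refine ⟨funext fun k => tendsto_nhds_unique (hxc k) (h1 k), ?_⟩
    have := tendsto_nhds_unique hxq h2
    exact_mod_cast this
  · rintro ⟨rfl, rfl⟩
    have hmem := (mem_polyClosure_iff hL).1 (residual_mem ha hF hG hR)
    choose x hxV hx using fun n : ℕ => hmem (1 / ((n : ℝ) + 1)) (by positivity)
    have hlim : Tendsto (fun n => polyLp hL (x n)) atTop (𝓝 e) := by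
      rw [tendsto_iff_norm_sub_tendsto_zero]
      have h1 : Tendsto (fun n => ‖e - polyLp hL (x n)‖ ^ 2) atTop (𝓝 0) :=
        squeeze_zero (fun n => sq_nonneg _) (fun n => (hx n).le)
          tendsto_one_div_add_atTop_nhds_zero_nat
      have h2 := h1.sqrt
      simpa [Real.sqrt_sq (norm_nonneg _), norm_sub_rev] using h2
    obtain ⟨h1, h2⟩ := hconv x hlim
    refine ⟨x, hxV, ?_, h1, ?_, h2⟩
    · intro ε hε
      obtain ⟨n₀, hn₀⟩ := Metric.cauchySeq_iff.1 hlim.cauchySeq (Real.sqrt (2 * Real.pi * ε))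
        (Real.sqrt_pos.2 (by positivity))
      refine ⟨n₀, fun m hm n hn => ?_⟩
      have h3 := hn₀ m hm n hn
      rw [dist_eq_norm, Real.lt_sqrt (norm_nonneg _)] at h3
      rw [hen, map_sub, one_div, inv_mul_lt_iff₀ hpi]
      exact h3
    · intro k hk
      have h3 := tendsto_fcoef hL hlim k
      simp only [← applyMat_Bmat hR] at h3
      have h4 : fcoef hL e k = Ra M N a F G k := by
        have h5 := (residual_eq_iff ha hF hG hR).1 rfl
        rw [mem_orthogonal_iff_fcoef] at h5
        have h6 := h5.2 k hk
        rw [fcoef_sub, sub_eq_zero, fcoef_target] at h6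
        exact h6.symm
      rwa [h4] at h3

/-- The right side is the minimal error found in `mse_eq_of_isOptimal`. Every minimal pair thus has
exactly one value, so the extremal problem ranges over all minimal pairs. -/
theorem isValue_iff (ha : Summable fun j : ZS M N => ∑ k, ‖a j k‖)
    (hF : IsSpectralDensity F) (hG : IsSpectralDensity G) (hR : IsRegular (F + G)) {v : ℝ} :
    IsValue M N a F G v ↔
      v = 1 / (2 * Real.pi) * ‖residual ha hF hG hR‖ ^ 2 + Qaa M N a F G := by
  constructor
  · rintro ⟨c, q, h, rfl⟩
    rw [((isInverseApply_iff ha hF hG hR).1 h).2]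
  · rintro rfl
    exact ⟨_, _, (isInverseApply_iff ha hF hG hR).2 ⟨rfl, rfl⟩, rfl⟩

theorem MemL2.congr {W : ℝ → Matrix (Fin T) (Fin T) ℂ} {g h : ℝ → Fin T → ℂ} (hg : MemL2 W g)
    (he : g =ᵐ[circ] h) : MemL2 W h := by
  refine ⟨fun i => (hg.1 i).congr ?_, hg.2.congr ?_⟩
  · filter_upwards [he] with t ht
    rw [ht]
  · filter_upwards [he] with t ht
    rw [ht]

/-- The optimal spectral characteristic is given by the formula. -/
theorem isOptimal_iff_givenByFormula (ha : Summable fun j : ZS M N => ∑ k, ‖a j k‖)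
    (hF : IsSpectralDensity F) (hG : IsSpectralDensity G) (hR : IsRegular (F + G))
    (h : ℝ → Fin T → ℂ) : IsOptimal M N a F G h ↔ GivenByFormula M N a F G h := by
  set e := residual ha hF hG hR with he
  set y : ℝ → Fin T → ℂ := fun t => (e t).ofLp with hy
  have hyV : MemVec y := memVec_coe e
  have hye : hyV.toH = e := toH_coe e
  set z : ℝ → Fin T → ℂ := fun t => (Afun M N a t ᵥ* F t) ᵥ* matSqrt (F t + G t)⁻¹ with hz
  have hzV : MemVec z := memVec_vecMul hF hG hR (memL2_Afun ha hF)
  have htar : target ha hF hG hR = hzV.toH := rfl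
  have hCi := hyV.integrable_vecMul (memLp_matSqrt hR.density)
  have hcoef : fcoef (memLp_matSqrt hR.density) e =
      fourierVec fun t => y t ᵥ* matSqrt ((F + G) t) := by
    rw [← hye, fcoef_toH]
    simp only [(posSemidef_matSqrt _).1.eq]
  have hform : ∀ᵐ t ∂circ, Afun M N a t ᵥ* (F t * (F t + G t)⁻¹) -
      (y t ᵥ* matSqrt ((F + G) t)) ᵥ* (F t + G t)⁻¹ = (z t - y t) ᵥ* matSqrt ((F + G) t)⁻¹ := by
    filter_upwards [hR.sqrt_inv_mul_self, hR.sqrt_mul_sqrt_inv] with t h1 h2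
    have h3 : matSqrt ((F + G) t) * (F t + G t)⁻¹ = matSqrt ((F + G) t)⁻¹ := by
      calc _ = matSqrt ((F + G) t) * (matSqrt ((F + G) t)⁻¹ * matSqrt ((F + G) t)⁻¹) := by
            rw [h1]; rfl
        _ = _ := by rw [← Matrix.mul_assoc, h2, Matrix.one_mul]
    have h4 : z t ᵥ* matSqrt ((F + G) t)⁻¹ = Afun M N a t ᵥ* (F t * (F t + G t)⁻¹) := by
      rw [hz]
      change ((Afun M N a t ᵥ* F t) ᵥ* matSqrt ((F + G) t)⁻¹) ᵥ* matSqrt ((F + G) t)⁻¹ = _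
      rw [vecMul_vecMul, h1, vecMul_vecMul]; rfl
    rw [vecMul_vecMul, h3, sub_vecMul, h4]
  constructor
  · intro ho
    have h1 := (isOptimal_iff ha hF hG hR ho.1.1).1 ho
    rw [htar, ← he, ← hye, ← MemVec.toH_sub, MemVec.toH_eq_iff] at h1
    refine ⟨_, _, fun t => y t ᵥ* matSqrt ((F + G) t),
      (isInverseApply_iff ha hF hG hR).2 ⟨rfl, rfl⟩, ⟨hCi, fun k i => ?_⟩, ?_⟩
    · rw [← he, hcoef]; rfl
    · filter_upwards [hform, h1, hR.sqrt_mul_sqrt_inv] with t h2 h3 h4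
      rw [h2, ← h3, vecMul_vecMul, h4, vecMul_one]
  · rintro ⟨c, q, C, hinv, ⟨hCint, hCc⟩, hh⟩
    have hc := ((isInverseApply_iff ha hF hG hR).1 hinv).1
    -- The series in the formula is known only through its coefficients; uniqueness of Fourier
    -- series identifies its sum with the residual times `W^{1/2}`.
    have hCy : C =ᵐ[circ] fun t => y t ᵥ* matSqrt ((F + G) t) := by
      refine ae_eq_of_fourierVec_eq hCint hCi ?_
      rw [← hcoef, he, ← hc]
      ext k i
      exact hCc k i
    have hheq : (fun t => (z t - y t) ᵥ* matSqrt ((F + G) t)⁻¹) =ᵐ[circ] h := by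
      filter_upwards [hform, hCy, hh] with t h1 h2 h3
      rw [h3, h2, h1]
    have hhL := (hR.memL2_of_memVec (hzV.sub hyV)).congr hheq
    rw [isOptimal_iff ha hF hG hR hhL, htar, ← he, ← hye, ← MemVec.toH_sub, MemVec.toH_eq_iff]
    filter_upwards [hheq, hR.sqrt_inv_mul_sqrt] with t h1 h2
    rw [← h1, vecMul_vecMul, h2, vecMul_one]

end RobustFilter

namespace RobustFilter

variable {s T : ℕ} {M N : Fin s → ℕ} {a : ℤ → Fin T → ℂ}

/-! ### The minimal error as an infimum over trigonometric polynomials -/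

section

variable {F G : ℝ → Matrix (Fin T) (Fin T) ℂ}

theorem memL2s_trigPoly {W : ℝ → Matrix (Fin T) (Fin T) ℂ} (hW : IsSpectralDensity W)
    {x : ℤ →₀ (Fin T → ℂ)} (hx : (x.support : Set ℤ) ⊆ observed M N) :
    MemL2s M N W (trigPoly x) := by
  refine ⟨memL2_trigPoly hW x, fun ε hε => ⟨x, hx, ?_⟩⟩
  simpa [herm] using hε

theorem optError_le_trigPoly (hF : IsSpectralDensity F) (hG : IsSpectralDensity G)
    {x : ℤ →₀ (Fin T → ℂ)} (hx : (x.support : Set ℤ) ⊆ observed M N) :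
    optError M N a F G ≤ mse M N a (trigPoly x) F G :=
  ciInf_le (bddBelow_mse hF hG) ⟨_, memL2s_trigPoly (hF.add hG) hx⟩

theorem herm_sub_comm (W : Matrix (Fin T) (Fin T) ℂ) (u v : Fin T → ℂ) :
    herm W (u - v) = herm W (v - u) := by
  rw [← herm_neg, neg_sub]

theorem integrable_mse (ha : Summable fun j : ZS M N => ∑ k, ‖a j k‖) (hF : IsSpectralDensity F)
    (hG : IsSpectralDensity G) {h : ℝ → Fin T → ℂ} (hh : MemL2 (F + G) h) :
    Integrable (fun t => herm (F t) (Afun M N a t - h t) + herm (G t) (h t)) circ :=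
  ((memL2_Afun ha hF).sub hF (hh.left hF hG)).2.add (hh.right hF hG).2

/-- The mean square errors of two estimates are compared by means of their distance. -/
theorem integrand_le {F G : Matrix (Fin T) (Fin T) ℂ} (hF : F.PosSemidef) (hG : G.PosSemidef)
    (v g h : Fin T → ℂ) {δ : ℝ} (hδ : 0 < δ) :
    herm F (v - g) + herm G g ≤
      (1 + δ) * (herm F (v - h) + herm G h) + (1 + δ⁻¹) * herm (F + G) (h - g) := by
  have h1 := herm_add_le hF (v - h) (h - g) hδ
  have h2 := herm_add_le hG h (g - h) hδ
  rw [sub_add_sub_cancel] at h1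
  rw [add_sub_cancel, herm_sub_comm] at h2
  rw [herm_add_left]
  linarith

/-- A lower bound of the errors of all estimates that use finitely many observations is a lower
bound of the minimal error. -/
theorem le_optError (ha : Summable fun j : ZS M N => ∑ k, ‖a j k‖) (hF : IsSpectralDensity F)
    (hG : IsSpectralDensity G) {b : ℝ}
    (hb : ∀ x : ℤ →₀ (Fin T → ℂ), (x.support : Set ℤ) ⊆ observed M N →
      b ≤ mse M N a (trigPoly x) F G) : b ≤ optError M N a F G := by
  have hne : Nonempty {h : ℝ → Fin T → ℂ // MemL2s M N (F + G) h} :=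
    ⟨⟨_, memL2s_trigPoly (hF.add hG) (x := 0) (by simp)⟩⟩
  refine le_ciInf fun ⟨g, hg⟩ => ?_
  -- Approximate `g` by an admissible polynomial: one `δ` comes from the factor in the quadratic
  -- triangle inequality, the other from the approximation error.
  have key : ∀ δ : ℝ, 0 < δ → b ≤ (1 + δ) * mse M N a g F G + δ := by
    intro δ hδ
    obtain ⟨x, hx, hxδ⟩ := hg.2 (2 * Real.pi * (δ / (1 + δ⁻¹))) (by positivity)
    refine (hb x hx).trans ?_
    have hxL := memL2_trigPoly (hF.add hG) x
    rw [mse_eq_integral ha hF hG hg.1, mse_eq_integral ha hF hG hxL]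
    have h1 := integrable_mse ha hF hG hg.1
    have h2 := (hg.1.sub (hF.add hG) hxL).2
    have h3 : ∫ t, (herm (F t) (Afun M N a t - trigPoly x t) + herm (G t) (trigPoly x t)) ∂circ ≤
        (1 + δ) * ∫ t, (herm (F t) (Afun M N a t - g t) + herm (G t) (g t)) ∂circ +
        (1 + δ⁻¹) * ∫ t, herm ((F + G) t) (g t - trigPoly x t) ∂circ := by
      rw [← integral_const_mul, ← integral_const_mul,
        ← integral_add (h1.const_mul _) (h2.const_mul _)]
      refine integral_mono_ae (integrable_mse ha hF hG hxL)
        ((h1.const_mul _).add (h2.const_mul _)) ?_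
      filter_upwards [hF.2, hG.2] with t h3 h4
      exact integrand_le h3 h4 _ _ _ hδ
    have hpi : (0 : ℝ) < 2 * Real.pi := by positivity
    have h4 : (1 + δ⁻¹) * ∫ t, herm ((F + G) t) (g t - trigPoly x t) ∂circ ≤
        2 * Real.pi * δ := by
      calc _ ≤ (1 + δ⁻¹) * (2 * Real.pi * (δ / (1 + δ⁻¹))) := by gcongr
        _ = _ := by field_simp
    set I := ∫ t, (herm (F t) (Afun M N a t - g t) + herm (G t) (g t)) ∂circ
    calc _ ≤ 1 / (2 * Real.pi) * ((1 + δ) * I + 2 * Real.pi * δ) := by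
          gcongr
          linarith
      _ = _ := by field_simp
  have hlim : Tendsto (fun δ : ℝ => (1 + δ) * mse M N a g F G + δ) (𝓝[>] 0)
      (𝓝 ((1 + 0) * mse M N a g F G + 0)) := by
    refine tendsto_nhdsWithin_of_tendsto_nhds (Continuous.tendsto ?_ 0)
    fun_prop
  have := ge_of_tendsto hlim (by filter_upwards [self_mem_nhdsWithin] with δ hδ using key δ hδ)
  simpa using this

end

/-! ### Mixtures of densities -/

section Mixture

variable {F₀ G₀ F₁ G₁ : ℝ → Matrix (Fin T) (Fin T) ℂ}

/-- For a fixed estimate the error is linear in the pair. Membership in both spaces ensures that all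
integrals converge. -/
theorem mse_mixture (ha : Summable fun j : ZS M N => ∑ k, ‖a j k‖) (hF₀ : IsSpectralDensity F₀)
    (hG₀ : IsSpectralDensity G₀) (hF₁ : IsSpectralDensity F₁) (hG₁ : IsSpectralDensity G₁)
    (α β : ℝ) {h : ℝ → Fin T → ℂ} (h₀ : MemL2 (F₀ + G₀) h) (h₁ : MemL2 (F₁ + G₁) h) :
    mse M N a h (α • F₀ + β • F₁) (α • G₀ + β • G₁) =
      α * mse M N a h F₀ G₀ + β * mse M N a h F₁ G₁ := by
  have e : ∀ (V W : ℝ → Matrix (Fin T) (Fin T) ℂ) (g : ℝ → Fin T → ℂ), MemL2 V g → MemL2 W g →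
      ∫ t, herm ((α • V + β • W) t) (g t) ∂circ =
        α * ∫ t, herm (V t) (g t) ∂circ + β * ∫ t, herm (W t) (g t) ∂circ := by
    intro V W g hV hW
    rw [← integral_const_mul, ← integral_const_mul,
      ← integral_add (hV.2.const_mul _) (hW.2.const_mul _)]
    congr 1; ext t
    rw [Pi.add_apply, Pi.smul_apply, Pi.smul_apply, herm_add_left, herm_smul_left, herm_smul_left]
  simp only [mse]
  rw [e F₀ F₁ _ ((memL2_Afun ha hF₀).sub hF₀ (h₀.left hF₀ hG₀))
    ((memL2_Afun ha hF₁).sub hF₁ (h₁.left hF₁ hG₁)),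
    e G₀ G₁ _ (h₀.right hF₀ hG₀) (h₁.right hF₁ hG₁)]
  ring

/-- Inversion reverses the order of matrices. The inequality is `herm_vecMul_le` for the pair `(αV,
W)` at the vector `vᵀ V⁻¹`. -/
theorem herm_inv_add_le {V W : Matrix (Fin T) (Fin T) ℂ} (hV : V.PosSemidef) (hu : IsUnit V.det)
    (hW : W.PosSemidef) {α : ℝ} (hα : 0 < α) (hs : IsUnit (α • V + W).det) (v : Fin T → ℂ) :
    herm (α • V + W)⁻¹ v ≤ α⁻¹ * herm V⁻¹ v := by
  have hVα : (α • V).PosSemidef := hV.smul hα.le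
  have h1 := herm_vecMul_le hVα hW hs (v ᵥ* V⁻¹)
  have h2 : v ᵥ* V⁻¹ ᵥ* (α • V) = (α : ℂ) • v := by
    rw [vecMul_smul, vecMul_vecMul, nonsing_inv_mul _ hu, vecMul_one]
    ext i; simp
  have h3 : herm V (v ᵥ* V⁻¹) = herm V⁻¹ v := by
    rw [herm_inv hV, herm_eq_normSqVec hV, inv_eq_matSqrt hV, vecMul_vecMul, Matrix.mul_assoc,
      nonsing_inv_mul _ (isUnit_matSqrt hV hu), Matrix.mul_one]
  rw [h2, herm_smul, herm_smul_left, h3, Complex.norm_real, Real.norm_of_nonneg hα.le] at h1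
  rw [inv_mul_eq_div, le_div_iff₀ hα]
  nlinarith

theorem trace_re_eq_sum_herm (W : Matrix (Fin T) (Fin T) ℂ) :
    W.trace.re = ∑ i, herm W (Pi.single i 1) := by
  rw [trace, Complex.re_sum]
  refine Finset.sum_congr rfl fun i _ => ?_
  rw [herm, ← Pi.single_star, star_one]
  simp

/-- An entry of `W` is the inner product of two rows of its square root. -/
theorem norm_apply_le_trace {W : Matrix (Fin T) (Fin T) ℂ} (hW : W.PosSemidef) (i j : Fin T) :
    ‖W i j‖ ≤ W.trace.re := by
  have h1 := trace_mul_conjTranspose (matSqrt W)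
  rw [(posSemidef_matSqrt W).1, matSqrt_mul_self hW] at h1
  have hrow : ∀ i, ∑ k, ‖matSqrt W i k‖ ^ 2 ≤ W.trace.re := fun i => by
    rw [h1]
    exact Finset.single_le_sum (f := fun i => ∑ k, ‖matSqrt W i k‖ ^ 2)
      (fun _ _ => Finset.sum_nonneg fun _ _ => sq_nonneg _) (Finset.mem_univ i)
  have h2 : W i j = ∑ k, matSqrt W i k * star (matSqrt W j k) := by
    have : W = matSqrt W * (matSqrt W)ᴴ := by
      rw [(posSemidef_matSqrt W).1, matSqrt_mul_self hW]
    conv_lhs => rw [this]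
    simp [mul_apply]
  calc ‖W i j‖ ≤ ∑ k, ‖matSqrt W i k‖ * ‖matSqrt W j k‖ := by
        rw [h2]
        refine (norm_sum_le _ _).trans (le_of_eq ?_)
        simp
    _ ≤ ∑ k, (‖matSqrt W i k‖ ^ 2 / 2 + ‖matSqrt W j k‖ ^ 2 / 2) :=
        Finset.sum_le_sum fun k _ => by
          nlinarith [sq_nonneg (‖matSqrt W i k‖ - ‖matSqrt W j k‖)]
    _ ≤ W.trace.re := by
        rw [Finset.sum_add_distrib, ← Finset.sum_div, ← Finset.sum_div]
        linarith [hrow i, hrow j]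

theorem aestronglyMeasurable_inv {W : ℝ → Matrix (Fin T) (Fin T) ℂ}
    (hW : ∀ i j, AEStronglyMeasurable (fun t => W t i j) circ) (i j : Fin T) :
    AEStronglyMeasurable (fun t => (W t)⁻¹ i j) circ := by
  have hWm : AEStronglyMeasurable (β := Fin T → Fin T → ℂ) W circ :=
    (aemeasurable_pi_iff.2 fun i => aemeasurable_pi_iff.2 fun j =>
      (hW i j).aemeasurable).aestronglyMeasurable
  have h1 : AEStronglyMeasurable (fun t => (W t).det) circ :=
    (continuous_id.matrix_det (A := fun M : Matrix (Fin T) (Fin T) ℂ => M)).comp_aestronglyMeasurable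
      hWm
  have hadj : Continuous fun M : Matrix (Fin T) (Fin T) ℂ => M.adjugate i j :=
    (continuous_id.matrix_adjugate).matrix_elem i j
  have h2 : AEStronglyMeasurable (fun t => (W t).adjugate i j) circ :=
    hadj.comp_aestronglyMeasurable hWm
  refine (h1.aemeasurable.inv.aestronglyMeasurable.mul h2).congr (ae_of_all _ fun t => ?_)
  simp [Matrix.inv_def, Ring.inverse_eq_inv']

theorem IsSpectralDensity.mixture {V W : ℝ → Matrix (Fin T) (Fin T) ℂ} (hV : IsSpectralDensity V)
    (hW : IsSpectralDensity W) {α β : ℝ} (hα : 0 ≤ α) (hβ : 0 ≤ β) :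
    IsSpectralDensity (α • V + β • W) := by
  refine ⟨fun i j => ((hV.1 i j).smul α).add ((hW.1 i j).smul β), ?_⟩
  filter_upwards [hV.2, hW.2] with t h1 h2
  exact (h1.smul hα).add (h2.smul hβ)

/-- The inverse of the mixture is dominated by `α⁻¹ (F₀ + G₀)⁻¹`, so only the first pair has to be
minimal. -/
theorem IsMinimal.mixture (hF₀ : IsSpectralDensity F₀) (hG₀ : IsSpectralDensity G₀)
    (hF₁ : IsSpectralDensity F₁) (hG₁ : IsSpectralDensity G₁) (hmin : IsMinimal F₀ G₀)
    {α β : ℝ} (hα : 0 < α) (hβ : 0 ≤ β) :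
    IsMinimal (α • F₀ + β • F₁) (α • G₀ + β • G₁) := by
  have hR := hmin.isRegular hF₀ hG₀
  have e : ∀ t, (α • F₀ + β • F₁) t + (α • G₀ + β • G₁) t =
      α • (F₀ t + G₀ t) + β • (F₁ t + G₁ t) := by
    intro t
    simp only [Pi.add_apply, Pi.smul_apply, smul_add]
    abel
  have hu : ∀ᵐ t ∂circ, IsUnit (α • (F₀ t + G₀ t) + β • (F₁ t + G₁ t)).det := by
    filter_upwards [hR.density.2, hmin.1, hF₁.2, hG₁.2] with t h1 h2 h3 h4
    have h5 : (F₀ t + G₀ t).PosDef := h1.posDef_iff_det_ne_zero.2 h2.ne_zero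
    have h6 : (α • (F₀ t + G₀ t) + β • (F₁ t + G₁ t)).PosDef :=
      (h5.smul hα).add_posSemidef ((h3.add h4).smul hβ)
    exact (Matrix.isUnit_iff_isUnit_det _).1 h6.isUnit
  refine ⟨by simpa only [e] using hu, fun i j => ?_⟩
  simp only [e]
  refine ((integrable_trace hR.inv.1).const_mul α⁻¹).mono' (aestronglyMeasurable_inv (fun i j => ?_)
    i j) ?_
  · exact (((hF₀.1 i j).add (hG₀.1 i j)).smul α |>.add (((hF₁.1 i j).add (hG₁.1 i j)).smul β)).1
  · filter_upwards [hR.density.2, hmin.1, hF₁.2, hG₁.2, hu] with t h1 h2 h3 h4 h5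
    have h6 : (β • (F₁ t + G₁ t)).PosSemidef := (h3.add h4).smul hβ
    have h7 : (α • (F₀ t + G₀ t) + β • (F₁ t + G₁ t)).PosSemidef := (h1.smul hα.le).add h6
    refine (norm_apply_le_trace h7.inv i j).trans ?_
    rw [trace_re_eq_sum_herm, trace_re_eq_sum_herm, Finset.mul_sum]
    exact Finset.sum_le_sum fun i _ => herm_inv_add_le h1 h2 h6 hα h5 _

/-- Lower semicontinuity of the error for a density `(F₁, G₁)` with respect to the distance
of a nondegenerate pair `(F₀, G₀)`. -/
theorem exists_mse_lower_bound (ha : Summable fun j : ZS M N => ∑ k, ‖a j k‖)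
    (hF₁ : IsSpectralDensity F₁) (hG₁ : IsSpectralDensity G₁)
    (hR : IsRegular (F₀ + G₀)) {h : ℝ → Fin T → ℂ}
    (h₀ : MemL2 (F₀ + G₀) h) (h₁ : MemL2 (F₁ + G₁) h) {b : ℝ} (hb : b < mse M N a h F₁ G₁) :
    ∃ K : ℝ, 0 ≤ K ∧ ∀ x : ℤ →₀ (Fin T → ℂ), b - K * (1 / (2 * Real.pi) *
      ∫ t, herm (F₀ t + G₀ t) (trigPoly x t - h t) ∂circ) ≤ mse M N a (trigPoly x) F₁ G₁ := by
  set I : ℝ → ℝ := fun t => herm (F₁ t) (Afun M N a t - h t) + herm (G₁ t) (h t) with hI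
  have hIi : Integrable I circ := integrable_mse ha hF₁ hG₁ h₁
  have hI0 : ∀ᵐ t ∂circ, 0 ≤ I t := by
    filter_upwards [hF₁.2, hG₁.2] with t h1 h2
    exact add_nonneg (herm_nonneg h1 _) (herm_nonneg h2 _)
  -- A pointwise bound for the form of `F₁ + G₁` in terms of that of `F₀ + G₀`. It may be unbounded
  -- in `t`.
  set κ : ℝ → ℝ := fun t => (F₁ t + G₁ t).trace.re * (F₀ t + G₀ t)⁻¹.trace.re with hκ
  have hκm : AEStronglyMeasurable κ circ :=
    (integrable_trace (hF₁.add hG₁).1).1.mul (integrable_trace hR.inv.1).1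
  have hκ0 : ∀ᵐ t ∂circ, 0 ≤ κ t := by
    filter_upwards [(hF₁.add hG₁).2, hR.inv.2] with t h1 h2
    exact mul_nonneg (trace_re_nonneg h1) (trace_re_nonneg h2)
  -- A soft truncation: `θ n` increases to `1`, yet `θ n * κ ≤ n + 1`. Replacing `I` by `θ n * I`
  -- loses little of the integral and makes the comparison of the two norms uniform.
  set θ : ℕ → ℝ → ℝ := fun n t => ((n : ℝ) + 1) / ((n : ℝ) + 1 + κ t) with hθ
  have hθm : ∀ n, AEStronglyMeasurable (θ n) circ := fun n =>
    ((aemeasurable_const (b := (n : ℝ) + 1)).div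
      (hκm.aemeasurable.const_add ((n : ℝ) + 1))).aestronglyMeasurable
  have hθ01 : ∀ n, ∀ᵐ t ∂circ, 0 ≤ θ n t ∧ θ n t ≤ 1 ∧ θ n t * κ t ≤ (n : ℝ) + 1 := by
    intro n
    filter_upwards [hκ0] with t ht
    have hn : (0 : ℝ) < (n : ℝ) + 1 := by positivity
    refine ⟨by positivity, ?_, ?_⟩
    · rw [div_le_one (by positivity)]; linarith
    · simp only [hθ]
      rw [div_mul_eq_mul_div, div_le_iff₀ (by positivity)]
      nlinarith
  have hθi : ∀ n, Integrable (fun t => θ n t * I t) circ := fun n => by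
    refine hIi.bdd_mul (c := 1) (hθm n) ?_
    filter_upwards [hθ01 n] with t ht
    rw [Real.norm_of_nonneg ht.1]; exact ht.2.1
  have hlim : Tendsto (fun n : ℕ => (1 + 1 / ((n : ℝ) + 1))⁻¹ * (1 / (2 * Real.pi) *
      ∫ t, θ n t * I t ∂circ)) atTop (𝓝 ((1 + 0)⁻¹ * (1 / (2 * Real.pi) * ∫ t, I t ∂circ))) := by
    refine Tendsto.mul (Tendsto.inv₀ (tendsto_one_div_add_atTop_nhds_zero_nat.const_add 1)
      (by norm_num)) (Tendsto.const_mul _ ?_)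
    refine tendsto_integral_of_dominated_convergence I (fun n => (hθi n).1) hIi (fun n => ?_) ?_
    · filter_upwards [hθ01 n, hI0] with t h1 h2
      rw [Real.norm_of_nonneg (mul_nonneg h1.1 h2)]
      exact mul_le_of_le_one_left h2 h1.2.1
    · filter_upwards [hκ0] with t ht
      have h1 : Tendsto (fun n : ℕ => θ n t) atTop (𝓝 1) := by
        have h2 : ∀ n : ℕ, θ n t = (1 + κ t * (1 / ((n : ℝ) + 1)))⁻¹ := by
          intro n
          simp only [hθ]
          have hn : (0 : ℝ) < (n : ℝ) + 1 := by positivity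
          field_simp
        simp only [h2]
        have h3 := Tendsto.inv₀ (((tendsto_one_div_add_atTop_nhds_zero_nat (𝕜 := ℝ)).const_mul
          (κ t)).const_add 1) (by simp)
        simpa using h3
      simpa using h1.mul_const (I t)
  have hmse : (1 + 0)⁻¹ * (1 / (2 * Real.pi) * ∫ t, I t ∂circ) = mse M N a h F₁ G₁ := by
    rw [mse_eq_integral ha hF₁ hG₁ h₁]; simp [hI]
  rw [hmse] at hlim
  obtain ⟨n, hn⟩ := ((tendsto_order.1 hlim).1 b hb).exists
  have hn0 : (0 : ℝ) < (n : ℝ) + 1 := by positivity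
  -- One factor is `d⁻¹` from the quadratic triangle inequality with `d = 1/(n+1)`, the other is the
  -- bound of `θ n * κ`.
  refine ⟨((n : ℝ) + 1) * ((n : ℝ) + 1), by positivity, fun x => ?_⟩
  have hx₁ := memL2_trigPoly (hF₁.add hG₁) x
  have hg := ((memL2_trigPoly hR.density x).sub hR.density h₀).2
  have hJ : Integrable (fun t => herm (F₀ t + G₀ t) (trigPoly x t - h t)) circ := hg
  have hle : (1 + 1 / ((n : ℝ) + 1))⁻¹ * ∫ t, θ n t * I t ∂circ -
      ((n : ℝ) + 1) * ((n : ℝ) + 1) * ∫ t, herm (F₀ t + G₀ t) (trigPoly x t - h t) ∂circ ≤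
      ∫ t, (herm (F₁ t) (Afun M N a t - trigPoly x t) + herm (G₁ t) (trigPoly x t)) ∂circ := by
    rw [← integral_const_mul, ← integral_const_mul,
      ← integral_sub ((hθi n).const_mul _) (hJ.const_mul _)]
    refine integral_mono_ae (((hθi n).const_mul _).sub (hJ.const_mul _))
      (integrable_mse ha hF₁ hG₁ hx₁) ?_
    filter_upwards [hF₁.2, hG₁.2, hR.density.2, hR.isUnit, hθ01 n] with t h1 h2 h3 h4 h5
    obtain ⟨h50, h51, h52⟩ := h5
    have h6 := integrand_le h1 h2 (Afun M N a t) (h t) (trigPoly x t)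
      (δ := 1 / ((n : ℝ) + 1)) (by positivity)
    set E := herm (F₁ t) (Afun M N a t - trigPoly x t) + herm (G₁ t) (trigPoly x t) with hE
    have hE0 : 0 ≤ E := add_nonneg (herm_nonneg h1 _) (herm_nonneg h2 _)
    set H := herm (F₀ t + G₀ t) (trigPoly x t - h t) with hH
    have hH0 : 0 ≤ H := herm_nonneg h3 _
    have h7 : herm (F₁ t + G₁ t) (trigPoly x t - h t) ≤ κ t * H := by
      have h8 := herm_le_trace (h1.add h2) (trigPoly x t - h t)
      have h9 := normSqVec_le_trace_inv h3 h4 (trigPoly x t - h t)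
      calc _ ≤ _ := h8
        _ ≤ (F₁ t + G₁ t).trace.re * ((F₀ t + G₀ t)⁻¹.trace.re * H) :=
          mul_le_mul_of_nonneg_left h9 (trace_re_nonneg (h1.add h2))
        _ = _ := by rw [hκ, mul_assoc]
    change (1 + 1 / ((n : ℝ) + 1))⁻¹ * (θ n t * I t) - ((n : ℝ) + 1) * ((n : ℝ) + 1) * H ≤ E
    set d := 1 / ((n : ℝ) + 1) with hd
    have hd0 : 0 < d := by positivity
    have h10 : I t ≤ (1 + d) * E + (1 + d⁻¹) * (κ t * H) :=
      h6.trans (by gcongr)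
    have h11 : (1 + d)⁻¹ * (θ n t * I t) ≤
        (1 + d)⁻¹ * (θ n t * ((1 + d) * E + (1 + d⁻¹) * (κ t * H))) := by gcongr
    have h12 : (1 + d)⁻¹ * (θ n t * ((1 + d) * E + (1 + d⁻¹) * (κ t * H))) =
        θ n t * E + d⁻¹ * (θ n t * κ t) * H := by
      field_simp
      ring
    have h13 : d⁻¹ = (n : ℝ) + 1 := by rw [hd, one_div, inv_inv]
    have h14 : d⁻¹ * (θ n t * κ t) * H ≤ ((n : ℝ) + 1) * ((n : ℝ) + 1) * H := by
      rw [h13]; gcongr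
    have h15 : θ n t * E ≤ E := mul_le_of_le_one_left hE0 h51
    linarith
  rw [mse_eq_integral ha hF₁ hG₁ hx₁]
  have hpi : (0 : ℝ) < 1 / (2 * Real.pi) := by positivity
  have := mul_le_mul_of_nonneg_left hle hpi.le
  calc _ ≤ (1 + 1 / ((n : ℝ) + 1))⁻¹ * (1 / (2 * Real.pi) * ∫ t, θ n t * I t ∂circ) -
        ((n : ℝ) + 1) * ((n : ℝ) + 1) * (1 / (2 * Real.pi) *
          ∫ t, herm (F₀ t + G₀ t) (trigPoly x t - h t) ∂circ) := by linarith
    _ = _ := by ring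
    _ ≤ _ := this

/-- If mixtures with `(F₁, G₁)` do not increase the minimal error of `(F₀, G₀)`, then the minimal
error of `(F₁, G₁)` is not larger. -/
theorem optError_le_of_mixture (ha : Summable fun j : ZS M N => ∑ k, ‖a j k‖)
    (hF₀ : IsSpectralDensity F₀) (hG₀ : IsSpectralDensity G₀) (hF₁ : IsSpectralDensity F₁)
    (hG₁ : IsSpectralDensity G₁) {h : ℝ → Fin T → ℂ} (ho : IsOptimal M N a F₀ G₀ h) {ε : ℝ}
    (hε : 0 < ε) (hε1 : ε < 1)
    (hmix : optError M N a ((1 - ε) • F₀ + ε • F₁) ((1 - ε) • G₀ + ε • G₁) ≤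
      mse M N a h F₀ G₀) : optError M N a F₁ G₁ ≤ mse M N a h F₀ G₀ := by
  have h1 : (1 - ε) * mse M N a h F₀ G₀ + ε * optError M N a F₁ G₁ ≤
      optError M N a ((1 - ε) • F₀ + ε • F₁) ((1 - ε) • G₀ + ε • G₁) := by
    -- Concavity: each polynomial has an affine error along the mixture, bounded below at the two
    -- ends by the two minimal errors.
    refine le_optError ha (hF₀.mixture hF₁ (by linarith) hε.le)
      (hG₀.mixture hG₁ (by linarith) hε.le) fun x hx => ?_
    rw [mse_mixture ha hF₀ hG₀ hF₁ hG₁ _ _ (memL2_trigPoly (hF₀.add hG₀) x)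
      (memL2_trigPoly (hF₁.add hG₁) x)]
    have h2 := ho.2 _ (memL2s_trigPoly (hF₀.add hG₀) hx)
    have h3 := optError_le_trigPoly (a := a) hF₁ hG₁ hx
    have : 0 ≤ 1 - ε := by linarith
    gcongr
  have h2 : ε * optError M N a F₁ G₁ ≤ ε * mse M N a h F₀ G₀ := by linarith
  exact le_of_mul_le_mul_left h2 hε

/-- If small mixtures with `(F₁, G₁)` do not increase the minimal error of `(F₀, G₀)`, then the
optimal estimate for `(F₀, G₀)` has no larger error at `(F₁, G₁)`. -/
theorem mse_le_of_mixture (ha : Summable fun j : ZS M N => ∑ k, ‖a j k‖)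
    (hF₀ : IsSpectralDensity F₀) (hG₀ : IsSpectralDensity G₀) (hF₁ : IsSpectralDensity F₁)
    (hG₁ : IsSpectralDensity G₁) (hR : IsRegular (F₀ + G₀)) {h : ℝ → Fin T → ℂ}
    (ho : IsOptimal M N a F₀ G₀ h) (h₁ : MemL2 (F₁ + G₁) h)
    (hmix : ∀ ε : ℝ, 0 < ε → ε < 1 →
      optError M N a ((1 - ε) • F₀ + ε • F₁) ((1 - ε) • G₀ + ε • G₁) ≤ mse M N a h F₀ G₀) :
    mse M N a h F₁ G₁ ≤ mse M N a h F₀ G₀ := by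
  by_contra! hlt
  obtain ⟨b, hb0, hb⟩ := exists_between hlt
  obtain ⟨K, hK, hKx⟩ := exists_mse_lower_bound ha hF₁ hG₁ hR ho.1.1 h₁ hb
  -- Chosen so that `1 - ε` exceeds `ε K`: the quadratic growth at `(F₀, G₀)` then outweighs the
  -- loss `K J` at `(F₁, G₁)`, and `+ 2` keeps `ε < 1` even for `K = 0`.
  set ε : ℝ := 1 / (K + 2) with hε
  have hε0 : 0 < ε := by positivity
  have hεK : ε * (K + 2) = 1 := by rw [hε]; field_simp
  have hε1 : ε < 1 := by nlinarith
  have h2 : (1 - ε) * mse M N a h F₀ G₀ + ε * b ≤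
      optError M N a ((1 - ε) • F₀ + ε • F₁) ((1 - ε) • G₀ + ε • G₁) := by
    refine le_optError ha (hF₀.mixture hF₁ (by linarith) hε0.le)
      (hG₀.mixture hG₁ (by linarith) hε0.le) fun x hx => ?_
    rw [mse_mixture ha hF₀ hG₀ hF₁ hG₁ _ _ (memL2_trigPoly (hF₀.add hG₀) x)
      (memL2_trigPoly (hF₁.add hG₁) x), mse_trigPoly_of_isOptimal ha hF₀ hG₀ hR ho hx]
    have h3 := hKx x
    set J := 1 / (2 * Real.pi) * ∫ t, herm (F₀ t + G₀ t) (trigPoly x t - h t) ∂circ with hJ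
    have hJ0 : 0 ≤ J := by
      refine mul_nonneg (by positivity) (integral_nonneg_of_ae ?_)
      filter_upwards [hR.density.2] with t ht using herm_nonneg ht _
    have h4 : ε * (b - K * J) ≤ ε * mse M N a (trigPoly x) F₁ G₁ :=
      mul_le_mul_of_nonneg_left h3 hε0.le
    have h5 : (1 - ε) * J - ε * (K * J) = ε * J := by linear_combination (-J) * hεK
    have h6 : 0 ≤ ε * J := mul_nonneg hε0.le hJ0
    linarith
  have h3 := hmix ε hε0 hε1
  have h4 : ε * b ≤ ε * mse M N a h F₀ G₀ := by linarith
  exact absurd (le_of_mul_le_mul_left h4 hε0) hb0.not_ge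

end Mixture

end RobustFilter

/-! ### Least favorable pair and saddle point -/

open RobustFilter in
theorem lemma1 {s T : ℕ} (M N : Fin s → ℕ) (a : ℤ → Fin T → ℂ)
    (ha : Summable fun j : ZS M N => ∑ k, ‖a j k‖)
    (DF DG : Set (ℝ → Matrix (Fin T) (Fin T) ℂ))
    (hDF : ∀ F ∈ DF, IsSpectralDensity F) (hDG : ∀ G ∈ DG, IsSpectralDensity G)
    (F0 G0 : ℝ → Matrix (Fin T) (Fin T) ℂ) (hF0 : F0 ∈ DF) (hG0 : G0 ∈ DG)
    (hmin : IsMinimal F0 G0) (hext : SolvesExtremal M N a DF DG F0 G0) :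
    -- least favorable among the pairs that satisfy the minimality condition
    IsLeastFavorable M N a {P | P ∈ DF ×ˢ DG ∧ IsMinimal P.1 P.2} F0 G0 ∧
    -- least favorable among all pairs of a convex class
    (Convex ℝ DF → Convex ℝ DG → IsLeastFavorable M N a (DF ×ˢ DG) F0 G0) ∧
    -- the optimal spectral characteristic is exactly the function given by the formula
    (∀ h, IsOptimal M N a F0 G0 h ↔ GivenByFormula M N a F0 G0 h) ∧
    -- it is minimax-robust if it belongs to `H_D`
    (Convex ℝ DF → Convex ℝ DG → ∀ h, IsOptimal M N a F0 G0 h →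
      h ∈ HD M N (DF ×ˢ DG) → IsMinimaxRobust M N a (DF ×ˢ DG) h) := by
  have hR := hmin.isRegular (hDF F0 hF0) (hDG G0 hG0)
  obtain ⟨v0, hv0, hmax⟩ := hext
  have hvalue : ∀ h, IsOptimal M N a F0 G0 h → mse M N a h F0 G0 = v0 := fun h ho => by
    rw [mse_eq_of_isOptimal ha (hDF F0 hF0) (hDG G0 hG0) hR ho,
      (isValue_iff ha (hDF F0 hF0) (hDG G0 hG0) hR).1 hv0]
  have core : ∀ h, IsOptimal M N a F0 G0 h → ∀ F ∈ DF, ∀ G ∈ DG, IsMinimal F G →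
      optError M N a F G ≤ mse M N a h F0 G0 := by
    intro h ho F hF G hG hm
    have hR' := hm.isRegular (hDF F hF) (hDG G hG)
    obtain ⟨g, hg⟩ := exists_isOptimal ha (hDF F hF) (hDG G hG) hR'
    rw [hvalue h ho, optError_eq_of_isOptimal (hDF F hF) (hDG G hG) hg,
      mse_eq_of_isOptimal ha (hDF F hF) (hDG G hG) hR' hg]
    exact hmax F hF G hG hm _ ((isValue_iff ha (hDF F hF) (hDG G hG) hR').2 rfl)
  obtain ⟨h0, ho⟩ := exists_isOptimal ha (hDF F0 hF0) (hDG G0 hG0) hR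
  have hmix : Convex ℝ DF → Convex ℝ DG → ∀ h, IsOptimal M N a F0 G0 h → ∀ F ∈ DF, ∀ G ∈ DG,
      ∀ ε : ℝ, 0 < ε → ε < 1 →
      optError M N a ((1 - ε) • F0 + ε • F) ((1 - ε) • G0 + ε • G) ≤ mse M N a h F0 G0 := by
    intro hcF hcG h ho F hF G hG ε hε hε1
    exact core h ho _ (hcF hF0 hF (by linarith) hε.le (by ring)) _
      (hcG hG0 hG (by linarith) hε.le (by ring))
      (hmin.mixture (hDF F0 hF0) (hDG G0 hG0) (hDF F hF) (hDG G hG) (by linarith) hε.le)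
  refine ⟨⟨⟨⟨hF0, hG0⟩, hmin⟩, h0, ho, fun P hP => core h0 ho _ hP.1.1 _ hP.1.2 hP.2⟩,
    fun hcF hcG => ⟨⟨hF0, hG0⟩, h0, ho, fun P hP => ?_⟩,
    fun h => isOptimal_iff_givenByFormula ha (hDF F0 hF0) (hDG G0 hG0) hR h,
    fun hcF hcG h hh hHD => ?_⟩
  -- Any `ε` strictly between `0` and `1` would do, by concavity.
  · exact optError_le_of_mixture ha (hDF F0 hF0) (hDG G0 hG0) (hDF _ hP.1) (hDG _ hP.2) ho
      (ε := 1 / 2) (by norm_num) (by norm_num)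
      (hmix hcF hcG h0 ho _ hP.1 _ hP.2 _ (by norm_num) (by norm_num))
  · have hmem : (F0, G0) ∈ DF ×ˢ DG := ⟨hF0, hG0⟩
    have hle : ∀ P ∈ DF ×ˢ DG, mse M N a h P.1 P.2 ≤ mse M N a h F0 G0 := fun P hP =>
      mse_le_of_mixture ha (hDF F0 hF0) (hDG G0 hG0) (hDF _ hP.1) (hDG _ hP.2) hR hh
        (hHD P hP).1 (hmix hcF hcG h hh _ hP.1 _ hP.2)
    refine ⟨hHD, ⟨(F0, G0), hmem, hle⟩, fun g hg => ?_⟩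
    have h1 : (mse M N a g F0 G0 : EReal) ≤ ⨆ P ∈ DF ×ˢ DG, (mse M N a g P.1 P.2 : EReal) :=
      le_iSup₂ (f := fun (P : _ × _) (_ : P ∈ DF ×ˢ DG) => (mse M N a g P.1 P.2 : EReal))
        (F0, G0) hmem
    -- Saddle point chain: `Δ(h; P) ≤ Δ(h; F⁰, G⁰) ≤ Δ(g; F⁰, G⁰)`, and the last number is at most
    -- the supremum for `g`.
    exact iSup₂_le fun P hP =>
      (EReal.coe_le_coe_iff.2 ((hle P hP).trans (hh.2 g (hg (F0, G0) hmem)))).trans h1
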